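/- Let $3/4<H<1$ and $1<t\le T$. Let $W^H=\{W^H_s(A):s\in[0,T],\ A\subset\mathbb R\text{ bounded Borel}\}$ be a fractional-white noise, i.e. a centered Gaussian field with $\mathbf E[W^H_s(A)W^H_r(B)]=\frac12\left(s^{2H}+r^{2H}-|s-r|^{2H}\right)\lambda(A\cap B)$, where $\lambda$ is Lebesgue measure. Let $u(t,x)=\int_0^t\int_{\mathbb R}G_1(t-s,x-y)\,W^H(ds,dy)$, with $G_1(s,x)=\frac12 1_{\{|x|<s\}}$, be the mild solution of the one-dimensional wave equation driven by $W^H$ with zero initial conditions. For $N\ge1$ let $$V_N=\frac1N\sum_{i=1}^N\left[\frac{\left(u(t,\frac iN)-u(t,\frac{i-1}N)\right)^2}{\mathbf E\left(u(t,\frac iN)-u(t,\frac{i-1}N)\right)^2}-1\right],\qquad v_N=\mathbf E[V_N^2],\qquad F_N=\frac{V_N}{\sqrt{v_N}}$$ (quadratic variation along the filter $\alpha=(1,-1)$). Put $$k_1=\frac t2,\qquad k_2=-\frac{4H-1}{4(2H+1)},\qquad \kappa(x)=k_1H(2H-1)|x|^{2H-2}+k_2H(2H+1)|x|^{2H-1},$$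 $$K_0=\int_0^1\kappa(x)^2(1-x)\,dx .$$ Then: 1. For every $N\ge 1$ the variances in the definition of $V_N$ and $v_N$ are positive, and $F_N$ belongs to the second Wiener chaos of $W^H$. 2. $N^{4-4H}v_N\to 4K_0/k_1^2$ as $N\to\infty$, where $$K_0=k_1^2\frac{H^2(2H-1)}{2(4H-3)}+2k_1k_2\frac{H^2(2H+1)}{2(4H-1)}+k_2^2\frac{H(2H+1)^2}{4(4H-1)}>0 .$$ 3. $F_N$ converges in distribution, as $N\to\infty$, to a non-Gaussian random variable $F$ that has moments of all orders and whose cumulants $k_m(F)=(-i)^m\frac{d^m}{ds^m}\log\mathbf E[e^{isF}]\big|_{s=0}$ are $k_1(F)=0$, $k_2(F)=1$ and, for $m\ge3$, $$k_m(F)=2^{m-1}(m-1)!\,(4K_0)^{-m/2}\int_{[0,1]^m}\kappa(x_1-x_2)\,\kappa(x_2-x_3)\cdots\kappa(x_{m-1}-x_m)\,\kappa(x_m-x_1)\,dx_1\cdots dx_m,$$ the integrals being absolutely convergent. The law of $F$ is determined by these cumulants: it is the only probability law on $\mathbb R$ with moments of all orders and these cumulants. -/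

import Mathlib

open MeasureTheory ProbabilityTheory Filter Topology

noncomputable section

namespace FracWave

/-- Covariance of fractional Brownian motion with Hurst parameter `H`. -/
def fbmCov (H s t : ℝ) : ℝ := (s ^ (2 * H) + t ^ (2 * H) - |t - s| ^ (2 * H)) / 2

/-- Index set of the noise on `[0, T]`: pairs `(t, A)` with `t ∈ [0, T]` and `A` a bounded Borel
subset of `ℝ`. -/
structure NoiseIndex (T : ℝ) where
  time : ℝ
  time_mem : time ∈ Set.Icc 0 T
  region : Set ℝ
  measurable_region : MeasurableSet region
  bounded_region : Bornology.IsBounded region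

variable {Ω : Type*} [MeasurableSpace Ω]

/-- `W` is a fractional-white Gaussian noise on `[0, T] × ℝ` with Hurst parameter `H`: a centered
Gaussian field with `E[W_t(A) W_s(B)] = R_H(t, s) λ(A ∩ B)`. -/
structure IsFractionalWhiteNoise (H T : ℝ) (P : Measure Ω) (W : NoiseIndex T → Ω → ℝ) : Prop where
  gaussian : IsGaussianProcess W P
  centered : ∀ i, ∫ ω, W i ω ∂P = 0
  covariance : ∀ i j, ∫ ω, W i ω * W j ω ∂P
    = fbmCov H i.time j.time * volume.real (i.region ∩ j.region)

/-- The simple function `∑ cᵢ 1_{[0, tᵢ] × Aᵢ}` of `(s, y)`. -/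
def simpleFunction {T : ℝ} (c : NoiseIndex T →₀ ℝ) (p : ℝ × ℝ) : ℝ :=
  c.sum fun i a => a * (Set.Icc 0 i.time ×ˢ i.region).indicator (fun _ => (1 : ℝ)) p

/-- The Wiener integral `∑ cᵢ W_{tᵢ}(Aᵢ)` of a simple function. -/
def simpleIntegral {T : ℝ} (W : NoiseIndex T → Ω → ℝ) (c : NoiseIndex T →₀ ℝ) (ω : Ω) : ℝ :=
  c.sum fun i a => a * W i ω

/-- The integrand `f(r, x) f(s, x) |r - s|^{2H-2}` of the squared norm of the canonical Hilbert
space of the noise, as a function of `(r, s, x)`. -/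
def normIntegrand (H : ℝ) (f : ℝ × ℝ → ℝ) (p : ℝ × ℝ × ℝ) : ℝ :=
  f (p.1, p.2.2) * f (p.2.1, p.2.2) * |p.1 - p.2.1| ^ (2 * H - 2)

/-- Lebesgue measure on `[0, T] × [0, T] × ℝ`. -/
def normMeasure (T : ℝ) : Measure (ℝ × ℝ × ℝ) :=
  volume.restrict (Set.Icc 0 T ×ˢ Set.Icc 0 T ×ˢ Set.univ)

/-- Squared norm of `f` in the canonical Hilbert space of the noise. -/
def noiseNormSq (H T : ℝ) (f : ℝ × ℝ → ℝ) : ℝ :=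
  H * (2 * H - 1) * ∫ p, normIntegrand H f p ∂(normMeasure T)

/-- `X` is the Wiener integral `∫ f dW` of `f` with respect to the noise: `f` is a limit of simple
functions in the canonical Hilbert space of the noise, and `X` is the `L²` limit of the integrals
of these simple functions. -/
def IsWienerIntegral (H T : ℝ) (P : Measure Ω) (W : NoiseIndex T → Ω → ℝ) (f : ℝ × ℝ → ℝ)
    (X : Ω → ℝ) : Prop :=
  MemLp X 2 P ∧ ∃ c : ℕ → NoiseIndex T →₀ ℝ,
    (∀ n, Integrable (normIntegrand H fun p => f p - simpleFunction (c n) p) (normMeasure T)) ∧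
    Tendsto (fun n => noiseNormSq H T fun p => f p - simpleFunction (c n) p) atTop (𝓝 0) ∧
    Tendsto (fun n => eLpNorm (fun ω => X ω - simpleIntegral W (c n) ω) 2 P) atTop (𝓝 0)

/-- Fundamental solution of the one-dimensional wave equation (it vanishes for `t ≤ 0`). -/
def waveKernel (t x : ℝ) : ℝ := if |x| < t then 1 / 2 else 0

/-- `u` is the mild solution on `[0, T] × ℝ` of the wave equation driven by the noise `W` with zero
initial conditions: `u(t, x) = ∫₀ᵗ ∫ G₁(t - s, x - y) W(ds, dy)`. -/
def IsMildSolution (H T : ℝ) (P : Measure Ω) (W : NoiseIndex T → Ω → ℝ) (u : ℝ → ℝ → Ω → ℝ) :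
    Prop :=
  ∀ t ∈ Set.Icc 0 T, ∀ x : ℝ,
    IsWienerIntegral H T P W (fun p => waveKernel (t - p.1) (x - p.2)) (u t x)

/-- The spatial increment `U^α(i/N)` along the filter `α = (1, -1)`. -/
def increment (u : ℝ → ℝ → Ω → ℝ) (t : ℝ) (N i : ℕ) (ω : Ω) : ℝ :=
  u t ((i : ℝ) / N) ω - u t (((i : ℝ) - 1) / N) ω

/-- The centered quadratic variation `V_N`. -/
def quadVar (P : Measure Ω) (u : ℝ → ℝ → Ω → ℝ) (t : ℝ) (N : ℕ) (ω : Ω) : ℝ :=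
  (1 / (N : ℝ)) * ∑ i ∈ Finset.Icc 1 N,
    ((increment u t N i ω) ^ 2 / (∫ ω', (increment u t N i ω') ^ 2 ∂P) - 1)

/-- `v_N = E[V_N²]`. -/
def quadVarSq (P : Measure Ω) (u : ℝ → ℝ → Ω → ℝ) (t : ℝ) (N : ℕ) : ℝ :=
  ∫ ω, (quadVar P u t N ω) ^ 2 ∂P

/-- `F_N = V_N / √v_N`. -/
def normQuadVar (P : Measure Ω) (u : ℝ → ℝ → Ω → ℝ) (t : ℝ) (N : ℕ) (ω : Ω) : ℝ :=
  quadVar P u t N ω / √(quadVarSq P u t N)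

/-- The first Wiener chaos of the noise: the closed linear span of the `W_t(A)` in `L²`. -/
def firstChaos {T : ℝ} (P : Measure Ω) (W : NoiseIndex T → Ω → ℝ) : Submodule ℝ (Lp ℝ 2 P) :=
  (Submodule.span ℝ {Z : Lp ℝ 2 P | ∃ i, Z =ᵐ[P] W i}).topologicalClosure

/-- The second Wiener chaos of the noise: the closed linear span in `L²` of the `H₂(Z) = Z² - 1`,
`Z` in the first chaos with unit norm. -/
def secondChaos {T : ℝ} (P : Measure Ω) (W : NoiseIndex T → Ω → ℝ) : Submodule ℝ (Lp ℝ 2 P) :=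
  (Submodule.span ℝ {Y : Lp ℝ 2 P | ∃ Z ∈ firstChaos P W, ‖Z‖ = 1 ∧
    Y =ᵐ[P] fun ω => (Z ω) ^ 2 - 1}).topologicalClosure

/-- The `m`-th cumulant `(-i)ᵐ (d/ds)ᵐ log E[e^{isF}]` at `s = 0` of a law `μ` on `ℝ`. -/
def cumulant (μ : Measure ℝ) (m : ℕ) : ℂ :=
  (-Complex.I) ^ m * iteratedDeriv m (fun s : ℝ => Complex.log (charFun μ s)) 0

/-- The constant `k₁`. -/
def k₁ (t : ℝ) : ℝ := t / 2

/-- The constant `k₂ = -c_H`. -/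
def k₂ (H : ℝ) : ℝ := -((4 * H - 1) / (4 * (2 * H + 1)))

/-- The kernel `k₁ H(2H-1) |x|^{2H-2} + k₂ H(2H+1) |x|^{2H-1}`, as a function of the difference of
the two variables. -/
def limitKernel (H t x : ℝ) : ℝ :=
  k₁ t * (H * (2 * H - 1)) * |x| ^ (2 * H - 2) + k₂ H * (H * (2 * H + 1)) * |x| ^ (2 * H - 1)

/-- The constant `K₀`. -/
def K₀ (H t : ℝ) : ℝ := ∫ x in (0 : ℝ)..1, (limitKernel H t x) ^ 2 * (1 - x)

/-- The cyclic product `∏ κ(x_j - x_{j+1})`, indices modulo `m`. -/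
def cyclicProduct (H t : ℝ) (m : ℕ) (x : Fin m → ℝ) : ℝ :=
  ∏ j : Fin m, limitKernel H t (x j - x (finRotate m j))

/-- The unit cube `[0, 1]^m`. -/
def unitCube (m : ℕ) : Set (Fin m → ℝ) := Set.Icc 0 1

/-- The cumulants of the limit law: `0` for `m = 1`, `1` for `m = 2`, and the cyclic integrals for
`m ≥ 3`. (Values at `m = 0` are not used.) -/
def limitCumulant (H t : ℝ) (m : ℕ) : ℝ :=
  if m = 1 then 0 else if m = 2 then 1 else
    2 ^ (m - 1) * ((m - 1).factorial : ℝ) * (4 * K₀ H t) ^ (-(m : ℝ) / 2) *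
      ∫ x in unitCube m, cyclicProduct H t m x

end FracWave

end

/-!
The spatial increments of the solution are Wiener integrals, hence jointly centered Gaussian. The
isometry of the Wiener integral, together with an explicit evaluation of the Riesz kernel on the
two travelling intervals that make up an increment of the wave kernel, gives
`E (u(t, x) - u(t, y))² = Q(|x - y|)` with `Q(h) = k₁ h^{2H} + k₂ h^{2H+1}`, if `|x - y| ≤ t`
(`noiseForm_waveKernel_sub`, `IsMildSolution.integral_sub_sq`). The only analytic input to the
isometry is that the form of the noise is positive semidefinite, which holds because the Riesz
kernel is a mixture of products (`integral_powerKernel_mul`, `noiseForm_self_nonneg`).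

By polarization the covariance matrix `R` of the `N` increments consists of second differences of
`Q`, and `F_N = (∑ Dᵢ² - tr R) / √(2 tr R²)`. Diagonalizing `R` reduces this quadratic form to a
sum of independent weighted centered chi-square variables, so that, for complex `|z| ≤ 1/2` and
`c = 1 / √(2 tr R²)`, `E exp(z F_N) = exp (½ ∑_{m ≥ 2} (2z)^m c^m tr R^m / m)`
(`quadratic_form_law`). Everything is thereby reduced to the traces `tr R^m`. Since `κ = Q'' / 2`,
the number `N^m tr R^m` is the integral over the unit cube of a cyclic product of step kernels
which converge to `κ` off the diagonal and are dominated by a multiple of `|x - y|^{2H-2}`. As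
`H > 3/4`, this Riesz kernel is square integrable, cyclic products of it are integrable, and
dominated convergence yields the cyclic integrals of `κ` (`integrable_cyclic_rpow`,
`tendsto_trace_covMatrix`). The case `m = 2` gives `2 K₀` and the asymptotics of `v_N`.

The bound on the moment generating functions is uniform in `N`, so the laws of the `F_N` are tight
and every cluster point has an exponential moment and the limiting moment generating function near
the origin. Such a law is determined by its moments, through the analyticity of its complex moment
generating function (`eq_of_moments_eq`); hence the cluster point is unique (`exists_limit_law`).
Its cumulants are read off from the series in the exponent (`cumulant_eq_of_hasSum`), and they
determine the moments by a recursion (`iteratedDeriv_charFun_succ`).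

Positivity of the cyclic integrals of orders two and four comes from the Cauchy-Schwarz
inequality: the sum of the entries of `R` is the variance `k₁ + k₂ > 0` of the increment over the
unit interval, whatever `N` is, and this bounds `N^m tr R^m` from below. A positive fourth
cumulant excludes a Gaussian limit.
-/


open MeasureTheory ProbabilityTheory Filter Topology

noncomputable section

namespace FracWave

/-! ### Integrals of difference kernels over a square -/

/-- The density of `a - b`, for `(a, b)` uniform on a square of side `t`. -/
lemma volume_real_Icc_inter_preimage_add {t z : ℝ} :
    ∫ b, (Set.Icc 0 t).indicator (fun _ => (1 : ℝ)) (b + z) *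
      (Set.Icc 0 t).indicator (fun _ => (1 : ℝ)) b = max (t - |z|) 0 := by
  have h : ∀ b, (Set.Icc 0 t).indicator (fun _ => (1 : ℝ)) (b + z) *
      (Set.Icc 0 t).indicator (fun _ => (1 : ℝ)) b =
      (Set.Icc (max 0 (-z)) (min t (t - z))).indicator (fun _ => (1 : ℝ)) b := by
    intro b
    simp only [Set.indicator_apply, Set.mem_Icc, max_le_iff, le_min_iff]
    split_ifs <;> first | simp; done | (exfalso; grind)
  simp_rw [h]
  rw [integral_indicator_const _ measurableSet_Icc, smul_eq_mul, mul_one, measureReal_def,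
    Real.volume_Icc, ENNReal.toReal_ofReal']
  congr 1
  rcases le_total 0 z with hz | hz
  · rw [abs_of_nonneg hz, max_eq_left (by linarith), min_eq_right (by linarith)]; ring
  · rw [abs_of_nonpos hz, max_eq_right (by linarith), min_eq_left (by linarith)]

/-- A locally integrable function of the difference is integrable on a square, and its integral
is an integral over the difference. -/
lemma integrable_and_integral_sub_square {φ : ℝ → ℝ} {t : ℝ}
    (hφ : IntegrableOn φ (Set.Icc (-t) t)) :
    Integrable (fun q : ℝ × ℝ => φ (q.1 - q.2))
      ((volume.restrict (Set.Icc 0 t)).prod (volume.restrict (Set.Icc 0 t))) ∧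
    ∫ q, φ (q.1 - q.2) ∂((volume.restrict (Set.Icc 0 t)).prod (volume.restrict (Set.Icc 0 t))) =
      ∫ z in Set.Icc (-t) t, (t - |z|) * φ z := by
  set I : ℝ → ℝ := (Set.Icc 0 t).indicator (fun _ => (1 : ℝ)) with hI
  set ψ : ℝ → ℝ := (Set.Icc (-t) t).indicator φ with hψ
  set F : ℝ × ℝ → ℝ := fun p => ψ p.1 * (I (p.2 + p.1) * I p.2) with hF
  have hIm : Measurable I := measurable_const.indicator measurableSet_Icc
  have hψi : Integrable ψ := hφ.integrable_indicator measurableSet_Icc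
  have hIi : Integrable I :=
    (integrableOn_const (by simp) (by simp)).integrable_indicator measurableSet_Icc
  have hI1 : ∀ x, |I x| ≤ 1 := fun x => by
    simp only [hI, Set.indicator_apply]; split_ifs <;> simp
  have hFi : Integrable F (volume.prod volume) := by
    have h1 : Integrable (fun p : ℝ × ℝ => ψ p.1 * I p.2) (volume.prod volume) :=
      hψi.mul_prod hIi
    refine h1.mono ?_ (ae_of_all _ fun p => ?_)
    · exact hψi.aestronglyMeasurable.comp_fst.mul
        (((hIm.comp (measurable_snd.add measurable_fst)).mul
          (hIm.comp measurable_snd)).aestronglyMeasurable)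
    · simp only [hF, norm_mul, Real.norm_eq_abs]
      have := hI1 (p.2 + p.1)
      gcongr
      nlinarith [abs_nonneg (I p.2)]
  have hmp := measurePreserving_sub_prod (volume : Measure ℝ) (volume : Measure ℝ)
  have heq : ∀ q : ℝ × ℝ, F (q.1 - q.2, q.2) =
      (Set.Icc 0 t ×ˢ Set.Icc 0 t).indicator (fun q => φ (q.1 - q.2)) q := by
    intro q
    simp only [hF, hI, hψ, Set.indicator_apply, Set.mem_Icc, Set.mem_prod,
      add_sub_cancel]
    split_ifs <;> first | simp; done | (exfalso; grind)
  have hcomp : Integrable (fun q : ℝ × ℝ => F (q.1 - q.2, q.2)) (volume.prod volume) :=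
    hmp.integrable_comp_of_integrable hFi
  have hms : MeasurableSet (Set.Icc 0 t ×ˢ Set.Icc 0 t : Set (ℝ × ℝ)) :=
    measurableSet_Icc.prod measurableSet_Icc
  rw [Measure.prod_restrict]
  simp_rw [heq] at hcomp
  refine ⟨(integrable_indicator_iff hms).1 hcomp, ?_⟩
  rw [← integral_indicator hms]
  simp_rw [← heq]
  have : ∫ q : ℝ × ℝ, F (q.1 - q.2, q.2) ∂(volume.prod volume) =
      ∫ p, F p ∂(volume.prod volume) := by
    conv_rhs => rw [← hmp.map_eq]
    rw [integral_map hmp.measurable.aemeasurable]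
    rw [hmp.map_eq]; exact hFi.aestronglyMeasurable
  rw [this, integral_prod _ hFi, ← integral_indicator measurableSet_Icc]
  refine integral_congr_ae (ae_of_all _ fun z => ?_)
  simp only [hF]
  rw [integral_const_mul, volume_real_Icc_inter_preimage_add]
  simp only [hψ, Set.indicator_apply, Set.mem_Icc]
  split_ifs with h
  · rw [max_eq_left (by rw [sub_nonneg]; exact abs_le.2 h), mul_comm]
  · simp

/-- For an even kernel the integral reduces to the positive differences. -/
lemma integral_sub_square_of_even {φ : ℝ → ℝ} {t : ℝ} (ht : 0 ≤ t) (he : ∀ z, φ (-z) = φ z)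
    (hφ : IntegrableOn φ (Set.Icc (-t) t)) :
    ∫ q, φ (q.1 - q.2) ∂((volume.restrict (Set.Icc 0 t)).prod (volume.restrict (Set.Icc 0 t))) =
      2 * ∫ z in (0 : ℝ)..t, (t - z) * φ z := by
  rw [(integrable_and_integral_sub_square hφ).2, integral_Icc_eq_integral_Ioc,
    ← intervalIntegral.integral_of_le (by linarith)]
  have hi : IntervalIntegrable (fun z => (t - |z|) * φ z) volume (-t) t := by
    rw [intervalIntegrable_iff_integrableOn_Icc_of_le (by linarith)]
    exact IntegrableOn.continuousOn_mul (by fun_prop) hφ isCompact_Icc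
  have hsub : Set.uIcc (-t) 0 ⊆ Set.uIcc (-t) t ∧ Set.uIcc 0 t ⊆ Set.uIcc (-t) t := by
    rw [Set.uIcc_of_le (by linarith), Set.uIcc_of_le (by linarith), Set.uIcc_of_le (by linarith)]
    exact ⟨Set.Icc_subset_Icc_right ht, Set.Icc_subset_Icc_left (by linarith)⟩
  rw [← intervalIntegral.integral_add_adjacent_intervals (hi.mono_set hsub.1)
    (hi.mono_set hsub.2)]
  have h1 : ∫ z in (-t)..0, (t - |z|) * φ z = ∫ z in (0:ℝ)..t, (t - |z|) * φ z := by
    have := intervalIntegral.integral_comp_neg (a := 0) (b := t) (fun z => (t - |z|) * φ z)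
    simp only [abs_neg, he, neg_zero] at this
    exact this.symm
  have h2 : ∫ z in (0:ℝ)..t, (t - |z|) * φ z = ∫ z in (0:ℝ)..t, (t - z) * φ z := by
    refine intervalIntegral.integral_congr fun z hz => ?_
    rw [Set.uIcc_of_le ht] at hz
    simp only [abs_of_nonneg hz.1]
  rw [h1, h2]; ring

/-- The Riesz kernel `|z|^p` is integrable near the origin for `p > -1`. -/
lemma integrableOn_abs_rpow {p : ℝ} (hp : -1 < p) (t : ℝ) :
    IntegrableOn (fun z : ℝ => |z| ^ p) (Set.Icc (-t) t) := by
  rcases lt_or_ge t 0 with h | ht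
  · rw [Set.Icc_eq_empty (by linarith)]; simp
  have h1 : IntervalIntegrable (fun z : ℝ => |z| ^ p) volume 0 t := by
    refine (intervalIntegral.intervalIntegrable_rpow' hp (a := 0) (b := t)).congr ?_
    intro z hz
    rw [Set.uIoc_of_le ht] at hz
    simp only [abs_of_pos hz.1]
  have h2 : IntervalIntegrable (fun z : ℝ => |z| ^ p) volume (-t) 0 := by
    have := (h1.comp_sub_left 0).symm
    simpa using this
  rw [← intervalIntegrable_iff_integrableOn_Icc_of_le (by linarith)]
  exact h2.trans h1

/-! ### The positive definite form of the noise -/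

/-- The bilinear form of the canonical Hilbert space of the noise. -/
def noiseForm (H T : ℝ) (f g : ℝ × ℝ → ℝ) : ℝ :=
  ∫ p : ℝ × ℝ × ℝ, f (p.1, p.2.2) * g (p.2.1, p.2.2) * |p.1 - p.2.1| ^ (2 * H - 2) ∂(normMeasure T)

/-- Bounded measurable integrands which vanish for large values of the space variable. -/
structure IsAdmissible (T : ℝ) (f : ℝ × ℝ → ℝ) : Prop where
  measurable : Measurable f
  bound : ∃ C M : ℝ, ∀ s ∈ Set.Icc 0 T, ∀ y, |f (s, y)| ≤
    (Set.Icc (-M) M).indicator (fun _ => C) y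

lemma IsAdmissible.add {T : ℝ} {f g : ℝ × ℝ → ℝ} (hf : IsAdmissible T f) (hg : IsAdmissible T g) :
    IsAdmissible T (fun p => f p + g p) := by
  obtain ⟨hfm, C, M, hC⟩ := hf
  obtain ⟨hgm, D, N, hD⟩ := hg
  refine ⟨hfm.add hgm, |C| + |D|, max M N, fun s hs y => ?_⟩
  have h1 := hC s hs y
  have h2 := hD s hs y
  refine (abs_add_le _ _).trans ((add_le_add h1 h2).trans ?_)
  simp only [Set.indicator_apply, Set.mem_Icc]
  have := le_abs_self C
  have := le_abs_self D
  have := abs_nonneg C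
  have := abs_nonneg D
  have := le_max_left M N
  have := le_max_right M N
  split_ifs <;> first | linarith | (exfalso; grind)

lemma IsAdmissible.const_mul {T : ℝ} {f : ℝ × ℝ → ℝ} (hf : IsAdmissible T f) (a : ℝ) :
    IsAdmissible T (fun p => a * f p) := by
  obtain ⟨hfm, C, M, hC⟩ := hf
  refine ⟨hfm.const_mul a, |a| * C, M, fun s hs y => ?_⟩
  rw [abs_mul]
  refine (mul_le_mul_of_nonneg_left (hC s hs y) (abs_nonneg a)).trans_eq ?_
  simp only [Set.indicator_apply]; split_ifs <;> simp

lemma IsAdmissible.sub {T : ℝ} {f g : ℝ × ℝ → ℝ} (hf : IsAdmissible T f) (hg : IsAdmissible T g) :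
    IsAdmissible T (fun p => f p - g p) := by
  have := hf.add (hg.const_mul (-1))
  simpa [sub_eq_add_neg] using this

lemma normMeasure_eq (T : ℝ) : normMeasure T = (volume.restrict (Set.Icc 0 T)).prod
    ((volume.restrict (Set.Icc 0 T)).prod volume) := by
  have h : (volume : Measure ℝ) = volume.restrict Set.univ := Measure.restrict_univ.symm
  rw [normMeasure, Measure.volume_eq_prod, Measure.volume_eq_prod, ← Measure.prod_restrict,
    ← Measure.prod_restrict, ← h]

/-- Reordering of the variables `((r, s), y)` and `(r, (s, y))`. -/
lemma measurePreserving_assoc_normMeasure (T : ℝ) :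
    MeasurePreserving (MeasurableEquiv.prodAssoc : (ℝ × ℝ) × ℝ ≃ᵐ ℝ × ℝ × ℝ)
      (((volume.restrict (Set.Icc 0 T)).prod (volume.restrict (Set.Icc 0 T))).prod volume)
      (normMeasure T) := by
  rw [normMeasure_eq]
  exact measurePreserving_prodAssoc _ _ _

lemma integrable_normMeasure_iff {T : ℝ} {F : ℝ × ℝ × ℝ → ℝ} : Integrable F (normMeasure T) ↔
    Integrable (fun q : (ℝ × ℝ) × ℝ => F (q.1.1, q.1.2, q.2))
      (((volume.restrict (Set.Icc 0 T)).prod (volume.restrict (Set.Icc 0 T))).prod volume) :=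
  ((measurePreserving_assoc_normMeasure T).integrable_comp_emb
    (MeasurableEquiv.measurableEmbedding _)).symm

lemma integral_normMeasure {T : ℝ} (F : ℝ × ℝ × ℝ → ℝ) : ∫ p, F p ∂(normMeasure T) =
    ∫ q : (ℝ × ℝ) × ℝ, F (q.1.1, q.1.2, q.2)
      ∂(((volume.restrict (Set.Icc 0 T)).prod (volume.restrict (Set.Icc 0 T))).prod volume) :=
  ((measurePreserving_assoc_normMeasure T).integral_comp'
    (g := F)).symm

lemma ae_normMeasure_mem (T : ℝ) : ∀ᵐ p ∂(normMeasure T), p.1 ∈ Set.Icc 0 T ∧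
    p.2.1 ∈ Set.Icc 0 T := by
  rw [normMeasure]
  filter_upwards [ae_restrict_mem (measurableSet_Icc.prod
    (measurableSet_Icc.prod MeasurableSet.univ))] with p hp
  exact ⟨hp.1, hp.2.1⟩

/-- The form of the noise is an absolutely convergent integral on bounded integrands. -/
lemma integrable_noiseForm {H T : ℝ} (hH : 1 / 2 < H) {f g : ℝ × ℝ → ℝ}
    (hf : IsAdmissible T f) (hg : IsAdmissible T g) :
    Integrable (fun p : ℝ × ℝ × ℝ =>
      f (p.1, p.2.2) * g (p.2.1, p.2.2) * |p.1 - p.2.1| ^ (2 * H - 2)) (normMeasure T) := by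
  rcases lt_or_ge T 0 with hT | hT
  · rw [normMeasure, Set.Icc_eq_empty (by linarith)]; simp
  obtain ⟨hfm, C, M, hC⟩ := hf
  obtain ⟨hgm, D, N, hD⟩ := hg
  have hdom : Integrable (fun p : ℝ × ℝ × ℝ => |p.1 - p.2.1| ^ (2 * H - 2) *
      (Set.Icc (-M) M).indicator (fun _ => C * D) p.2.2) (normMeasure T) := by
    rw [integrable_normMeasure_iff]
    refine Integrable.mul_prod (f := fun q : ℝ × ℝ => |q.1 - q.2| ^ (2 * H - 2))
      (integrable_and_integral_sub_square
        (integrableOn_abs_rpow (by linarith) T)).1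
      ((integrableOn_const (by simp) (by finiteness)).integrable_indicator measurableSet_Icc)
  refine hdom.mono (by fun_prop) ?_
  filter_upwards [ae_normMeasure_mem T] with p hp
  have h1 := hC _ hp.1 p.2.2
  have h2 := hD _ hp.2 p.2.2
  have h3 : |p.1 - p.2.1| ^ (2 * H - 2) ≥ 0 := by positivity
  simp only [norm_mul, Real.norm_eq_abs, abs_of_nonneg h3]
  rw [mul_comm (|p.1 - p.2.1| ^ (2 * H - 2))]
  gcongr
  refine (mul_le_mul h1 h2 (abs_nonneg _) ((abs_nonneg _).trans h1)).trans
    ((le_abs_self _).trans ?_)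
  simp only [Set.indicator_apply]
  split_ifs <;> simp [abs_mul]
  positivity

/-- The convolution kernel `v₊^b`. -/
def powerKernel (b v : ℝ) : ℝ := if 0 < v then v ^ b else 0

lemma powerKernel_nonneg (b v : ℝ) : 0 ≤ powerKernel b v := by
  unfold powerKernel; split_ifs <;> positivity

lemma measurable_powerKernel (b : ℝ) : Measurable (powerKernel b) :=
  Measurable.ite measurableSet_Ioi (by fun_prop) measurable_const

/-- The constant of the self-convolution of `v₊^b`. -/
def powerConst (b : ℝ) : ℝ := ∫ v in Set.Ioi (0 : ℝ), v ^ b * (v + 1) ^ b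

lemma integrableOn_powerConst {b : ℝ} (hb : -1 < b) (hb' : b < -1 / 2) :
    IntegrableOn (fun v : ℝ => v ^ b * (v + 1) ^ b) (Set.Ioi 0) := by
  rw [← Set.Ioc_union_Ioi_eq_Ioi zero_le_one]
  have hm : Measurable (fun v : ℝ => v ^ b * (v + 1) ^ b) := by fun_prop
  refine IntegrableOn.union ?_ ?_
  · have h1 : IntegrableOn (fun v : ℝ => v ^ b) (Set.Ioc 0 1) := by
      rw [← intervalIntegrable_iff_integrableOn_Ioc_of_le zero_le_one]
      exact intervalIntegral.intervalIntegrable_rpow' hb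
    refine Integrable.mono h1 hm.aestronglyMeasurable ?_
    filter_upwards [ae_restrict_mem measurableSet_Ioc] with v hv
    have hv0 := hv.1
    have h2 : (v + 1) ^ b ≤ 1 := Real.rpow_le_one_of_one_le_of_nonpos (by linarith) (by linarith)
    rw [norm_mul]
    have h3 : ‖(v + 1) ^ b‖ ≤ 1 := by
      rw [Real.norm_of_nonneg (by positivity)]; exact h2
    nlinarith [norm_nonneg (v ^ b)]
  · have h1 : IntegrableOn (fun v : ℝ => v ^ (2 * b)) (Set.Ioi 1) :=
      integrableOn_Ioi_rpow_of_lt (by linarith) one_pos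
    refine Integrable.mono h1 hm.aestronglyMeasurable ?_
    filter_upwards [ae_restrict_mem measurableSet_Ioi] with v hv
    have hv0 : 0 < v := lt_trans one_pos hv
    have h2 : (v + 1) ^ b ≤ v ^ b :=
      Real.rpow_le_rpow_of_nonpos hv0 (by linarith) (by linarith)
    rw [Real.norm_of_nonneg (by positivity), Real.norm_of_nonneg (by positivity), two_mul,
      Real.rpow_add hv0]
    gcongr

lemma powerConst_pos {b : ℝ} (hb : -1 < b) (hb' : b < -1 / 2) : 0 < powerConst b := by
  rw [powerConst, setIntegral_pos_iff_support_of_nonneg_ae _ (integrableOn_powerConst hb hb')]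
  · have : Function.support (fun v : ℝ => v ^ b * (v + 1) ^ b) ∩ Set.Ioi 0 = Set.Ioi 0 := by
      refine Set.inter_eq_right.2 fun v hv => ?_
      have hv : 0 < v := hv
      have : 0 < v ^ b * (v + 1) ^ b := by positivity
      exact this.ne'
    rw [this]; simp
  · filter_upwards [ae_restrict_mem measurableSet_Ioi] with v hv
    have hv : 0 < v := hv
    simp only [Pi.zero_apply]; positivity

/-- The Riesz kernel is a mixture of products: `|r - s|^{2b+1}` is, up to a constant, the integral
of `(r - v)₊^b (s - v)₊^b` over `v`. -/
lemma integral_powerKernel_mul {b : ℝ} (hb : -1 < b) (hb' : b < -1 / 2) {r s : ℝ} (hrs : r ≠ s) :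
    Integrable (fun v => powerKernel b (r - v) * powerKernel b (s - v)) ∧
    ∫ v, powerKernel b (r - v) * powerKernel b (s - v) = powerConst b * |r - s| ^ (2 * b + 1) := by
  wlog h : s < r generalizing r s
  · have := this hrs.symm (lt_of_le_of_ne (not_lt.1 h) hrs)
    rw [abs_sub_comm]
    simpa only [mul_comm (powerKernel b (r - _))] using this
  set d := r - s with hd
  have hd0 : 0 < d := by linarith
  set G : ℝ → ℝ := fun w => powerKernel b (w + d) * powerKernel b w with hG
  have hGeq : ∀ v, powerKernel b (r - v) * powerKernel b (s - v) = G (s - v) := by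
    intro v; simp only [hG]; congr 2; simp only [hd]; ring
  have hind : G = (Set.Ioi 0).indicator (fun w => (w + d) ^ b * w ^ b) := by
    ext w
    simp only [hG, powerKernel, Set.indicator_apply, Set.mem_Ioi]
    split_ifs <;> first | simp; done | (exfalso; linarith)
  have hscale : ∀ w ∈ Set.Ioi (0 : ℝ), (d * w + d) ^ b * (d * w) ^ b =
      d ^ (2 * b) * (w ^ b * (w + 1) ^ b) := by
    intro w hw
    have hw : 0 < w := hw
    rw [show d * w + d = d * (w + 1) by ring, Real.mul_rpow hd0.le (by linarith),
      Real.mul_rpow hd0.le hw.le, two_mul b, Real.rpow_add hd0]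
    ring
  have hint : IntegrableOn (fun w => (w + d) ^ b * w ^ b) (Set.Ioi 0) := by
    have := (integrableOn_Ioi_comp_mul_left_iff (fun w => (w + d) ^ b * w ^ b) 0 hd0).1
    rw [mul_zero] at this
    refine this (IntegrableOn.congr_fun ((integrableOn_powerConst hb hb').const_mul (d ^ (2 * b)))
      ?_ measurableSet_Ioi)
    intro w hw; exact (hscale w hw).symm
  have hGi : Integrable G := by rw [hind]; exact hint.integrable_indicator measurableSet_Ioi
  simp_rw [hGeq]
  refine ⟨hGi.comp_sub_left s, ?_⟩
  rw [integral_sub_left_eq_self G volume s, hind, integral_indicator measurableSet_Ioi]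
  have h1 := integral_comp_mul_left_Ioi' (fun w => (w + d) ^ b * w ^ b) 0 hd0
  rw [mul_zero] at h1
  rw [← h1, setIntegral_congr_fun measurableSet_Ioi hscale, integral_const_mul, smul_eq_mul,
    abs_of_pos hd0, Real.rpow_add hd0, Real.rpow_one, powerConst]
  ring

lemma ae_normMeasure_ne (T : ℝ) : ∀ᵐ p ∂(normMeasure T), p.1 ≠ p.2.1 := by
  have hms : MeasurableSet {p : ℝ × ℝ × ℝ | p.1 = p.2.1} :=
    measurableSet_eq_fun (by fun_prop) (by fun_prop)
  rw [normMeasure_eq, ae_iff]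
  simp only [ne_eq, not_not]
  rw [Measure.measure_prod_null hms]
  refine ae_of_all _ fun r => ?_
  have : Prod.mk r ⁻¹' {p : ℝ × ℝ × ℝ | p.1 = p.2.1} = {r} ×ˢ Set.univ := by
    ext q; simp [eq_comm]
  simp only [Pi.zero_apply]
  rw [this, Measure.prod_prod]
  simp

/-- The form of the noise is positive semidefinite: it is an integral of squares, since the Riesz
kernel is a mixture of products. -/
lemma noiseForm_self_nonneg {H T : ℝ} (hH : 1 / 2 < H) (hH1 : H < 1) {f : ℝ × ℝ → ℝ}
    (hf : IsAdmissible T f) : 0 ≤ noiseForm H T f f := by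
  have hb : -1 < H - 3 / 2 := by linarith
  have hb' : H - 3 / 2 < -1 / 2 := by linarith
  set b := H - 3 / 2 with hbdef
  have hexp : 2 * H - 2 = 2 * b + 1 := by rw [hbdef]; ring
  have hc := powerConst_pos hb hb'
  have hfm := hf.measurable
  have hφm := measurable_powerKernel b
  set G : (ℝ × ℝ × ℝ) → ℝ → ℝ := fun p v =>
    f (p.1, p.2.2) * f (p.2.1, p.2.2) *
      (powerKernel b (p.1 - v) * powerKernel b (p.2.1 - v)) with hG
  have hbase := integrable_noiseForm hH hf hf
  have hsf : SFinite (normMeasure T) := by rw [normMeasure]; infer_instance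
  have hGm : Measurable (Function.uncurry G) := by
    simp only [hG, Function.uncurry_def]; fun_prop
  have hGi : Integrable (Function.uncurry G) ((normMeasure T).prod volume) := by
    rw [integrable_prod_iff hGm.aestronglyMeasurable]
    constructor
    · filter_upwards [ae_normMeasure_ne T] with p hp
      exact (integral_powerKernel_mul hb hb' hp).1.const_mul (f (p.1, p.2.2) * f (p.2.1, p.2.2))
    · refine (hbase.norm.const_mul (powerConst b)).congr ?_
      filter_upwards [ae_normMeasure_ne T] with p hp
      simp only [Function.uncurry, hG, norm_mul]
      rw [integral_const_mul]
      have : ∀ v, ‖powerKernel b (p.1 - v)‖ * ‖powerKernel b (p.2.1 - v)‖ =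
          powerKernel b (p.1 - v) * powerKernel b (p.2.1 - v) := fun v => by
        rw [Real.norm_of_nonneg (powerKernel_nonneg _ _),
          Real.norm_of_nonneg (powerKernel_nonneg _ _)]
      simp_rw [this]
      rw [(integral_powerKernel_mul hb hb' hp).2, hexp,
        Real.norm_of_nonneg (by positivity : (0:ℝ) ≤ |p.1 - p.2.1| ^ (2 * b + 1))]
      ring
  have h1 : powerConst b * noiseForm H T f f = ∫ p, (∫ v, G p v) ∂(normMeasure T) := by
    rw [noiseForm, ← integral_const_mul]
    refine integral_congr_ae ?_
    filter_upwards [ae_normMeasure_ne T] with p hp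
    simp only [hG]
    rw [integral_const_mul, (integral_powerKernel_mul hb hb' hp).2, hexp]
    ring
  have h2 : 0 ≤ ∫ p, (∫ v, G p v) ∂(normMeasure T) := by
    rw [integral_integral_swap hGi]
    refine integral_nonneg fun v => ?_
    by_cases hv : Integrable (fun p => G p v) (normMeasure T)
    · simp only [Pi.zero_apply]
      rw [integral_normMeasure, integral_prod_symm _ (integrable_normMeasure_iff.1 hv)]
      refine integral_nonneg fun y => ?_
      have : ∀ x : ℝ × ℝ, G (x.1, x.2, y) v = (f (x.1, y) * powerKernel b (x.1 - v)) *
          (f (x.2, y) * powerKernel b (x.2 - v)) := fun x => by simp only [hG]; ring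
      simp only [Pi.zero_apply, this]
      rw [integral_prod_mul (fun r => f (r, y) * powerKernel b (r - v))
        (fun r => f (r, y) * powerKernel b (r - v))]
      exact mul_self_nonneg _
    · simp only [Pi.zero_apply]; rw [integral_undef hv]
  rw [← h1] at h2
  exact nonneg_of_mul_nonneg_right h2 hc

lemma noiseForm_add_smul {H T : ℝ} (hH : 1 / 2 < H) {f e : ℝ × ℝ → ℝ}
    (hf : IsAdmissible T f) (he : IsAdmissible T e) (τ : ℝ) :
    noiseForm H T (fun p => f p + τ * e p) (fun p => f p + τ * e p) =
      noiseForm H T f f + τ * (noiseForm H T f e + noiseForm H T e f)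
        + τ ^ 2 * noiseForm H T e e := by
  have h1 := integrable_noiseForm hH hf hf
  have h2 := integrable_noiseForm hH hf he
  have h3 := integrable_noiseForm hH he hf
  have h4 := integrable_noiseForm hH he he
  simp only [noiseForm]
  rw [← integral_add h2 h3, ← integral_const_mul, ← integral_const_mul,
    ← integral_add h1, ← integral_add _ (h4.const_mul (τ ^ 2))]
  · refine integral_congr_ae (ae_of_all _ fun p => ?_)
    ring
  · exact h1.add ((h2.add h3).const_mul τ)
  · exact (h2.add h3).const_mul τ

/-- Cauchy-Schwarz inequality for the form of the noise. -/
lemma noiseForm_cauchySchwarz {H T : ℝ} (hH : 1 / 2 < H) (hH1 : H < 1) {f e : ℝ × ℝ → ℝ}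
    (hf : IsAdmissible T f) (he : IsAdmissible T e) :
    (noiseForm H T f e + noiseForm H T e f) ^ 2 ≤
      4 * (noiseForm H T e e * noiseForm H T f f) := by
  have h := discrim_le_zero (a := noiseForm H T e e)
    (b := noiseForm H T f e + noiseForm H T e f) (c := noiseForm H T f f) fun τ => by
      have := noiseForm_self_nonneg hH hH1 (hf.add (he.const_mul τ))
      rw [noiseForm_add_smul hH hf he τ] at this
      nlinarith
  rw [discrim] at h
  linarith

/-- Continuity of the squared norm under convergence in the space of the noise. -/
lemma tendsto_noiseForm_sub {H T : ℝ} (hH : 1 / 2 < H) (hH1 : H < 1) {f : ℝ × ℝ → ℝ}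
    {e : ℕ → ℝ × ℝ → ℝ} (hf : IsAdmissible T f) (he : ∀ n, IsAdmissible T (e n))
    (h : Tendsto (fun n => noiseForm H T (e n) (e n)) atTop (𝓝 0)) :
    Tendsto (fun n => noiseForm H T (fun p => f p - e n p) (fun p => f p - e n p)) atTop
      (𝓝 (noiseForm H T f f)) := by
  have hcross : Tendsto (fun n => noiseForm H T f (e n) + noiseForm H T (e n) f) atTop (𝓝 0) := by
    have hs : Tendsto (fun n => √(4 * (noiseForm H T (e n) (e n) * noiseForm H T f f))) atTop
        (𝓝 0) := by
      have := ((h.mul_const (noiseForm H T f f)).const_mul 4).sqrt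
      simpa using this
    refine squeeze_zero_norm (fun n => ?_) hs
    rw [Real.norm_eq_abs]
    exact Real.abs_le_sqrt (noiseForm_cauchySchwarz hH hH1 hf (he n))
  have heq : ∀ n, noiseForm H T (fun p => f p - e n p) (fun p => f p - e n p) =
      noiseForm H T f f - (noiseForm H T f (e n) + noiseForm H T (e n) f)
        + noiseForm H T (e n) (e n) := fun n => by
    have := noiseForm_add_smul hH hf (he n) (-1)
    simp only [neg_mul, one_mul, ← sub_eq_add_neg] at this
    rw [this]; ring
  simp_rw [heq]
  simpa using (hcross.const_sub (noiseForm H T f f)).add h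

/-- The parallelogram bound for the form of the noise. -/
lemma noiseForm_sub_le {H T : ℝ} (hH : 1 / 2 < H) (hH1 : H < 1) {f e : ℝ × ℝ → ℝ}
    (hf : IsAdmissible T f) (he : IsAdmissible T e) :
    noiseForm H T (fun p => f p - e p) (fun p => f p - e p) ≤
      2 * noiseForm H T f f + 2 * noiseForm H T e e := by
  have h1 := noiseForm_add_smul hH hf he (-1)
  have h2 := noiseForm_add_smul hH hf he 1
  have h3 := noiseForm_self_nonneg hH hH1 (hf.add (he.const_mul 1))
  simp only [neg_mul, one_mul, ← sub_eq_add_neg] at h1 h2 h3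
  rw [h2] at h3
  rw [h1]
  linarith

/-! ### The isometry on simple functions -/

/-- The indicator of `[0, t] × A`. -/
def rectIndicator {T : ℝ} (i : NoiseIndex T) : ℝ × ℝ → ℝ :=
  (Set.Icc 0 i.time ×ˢ i.region).indicator fun _ => (1 : ℝ)

lemma isAdmissible_rectIndicator {T : ℝ} (i : NoiseIndex T) : IsAdmissible T (rectIndicator i) := by
  classical
  obtain ⟨M, hM⟩ := i.bounded_region.subset_closedBall 0
  refine ⟨measurable_const.indicator (measurableSet_Icc.prod i.measurable_region), 1, M,
    fun s _ y => ?_⟩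
  simp only [rectIndicator, Set.indicator_apply, Set.mem_prod]
  split_ifs with h1 h2 h2
  · simp
  · exfalso
    have := hM h1.2
    rw [Real.closedBall_eq_Icc] at this
    exact h2 (by simpa using this)
  · simp
  · simp

lemma isAdmissible_sum {T : ℝ} {ι : Type*} (S : Finset ι) {f : ι → ℝ × ℝ → ℝ}
    (hf : ∀ i ∈ S, IsAdmissible T (f i)) : IsAdmissible T (fun p => ∑ i ∈ S, f i p) := by
  classical
  induction S using Finset.induction_on with
  | empty => exact ⟨by simp, 0, 0, by simp⟩
  | insert a S ha ih =>
    simp only [Finset.sum_insert ha]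
    exact (hf a (by simp)).add (ih fun i hi => hf i (by simp [hi]))

lemma isAdmissible_simpleFunction {T : ℝ} (c : NoiseIndex T →₀ ℝ) :
    IsAdmissible T (simpleFunction c) :=
  isAdmissible_sum c.support fun i _ => (isAdmissible_rectIndicator i).const_mul (c i)

lemma integral_abs_rpow_of_nonneg {p : ℝ} (hp : -1 < p) {r : ℝ} (hr : 0 ≤ r) :
    ∫ z in (0 : ℝ)..r, |z| ^ p = r ^ (p + 1) / (p + 1) := by
  have : ∫ z in (0 : ℝ)..r, |z| ^ p = ∫ z in (0 : ℝ)..r, z ^ p :=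
    intervalIntegral.integral_congr fun z hz => by
      rw [Set.uIcc_of_le hr] at hz; simp only [abs_of_nonneg hz.1]
  rw [this, integral_rpow (Or.inl hp), Real.zero_rpow (by linarith), sub_zero]

lemma integral_abs_rpow_neg (p r : ℝ) :
    ∫ z in (0 : ℝ)..(-r), |z| ^ p = - ∫ z in (0 : ℝ)..r, |z| ^ p := by
  have := intervalIntegral.integral_comp_neg (a := 0) (b := r) (fun z => |z| ^ p)
  simp only [abs_neg, neg_zero] at this
  rw [this, intervalIntegral.integral_symm]

lemma intervalIntegrable_abs_rpow {p : ℝ} (hp : -1 < p) (x y : ℝ) :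
    IntervalIntegrable (fun z : ℝ => |z| ^ p) volume x y := by
  have h := (intervalIntegrable_iff_integrableOn_Icc_of_le (by
    have := abs_nonneg x; have := abs_nonneg y; linarith)).2
      (integrableOn_abs_rpow hp (|x| + |y|))
  refine h.mono_set ?_
  rw [Set.uIcc_subset_uIcc_iff_mem]
  rw [Set.uIcc_of_le (by have := abs_nonneg x; have := abs_nonneg y; linarith)]
  constructor <;> rw [Set.mem_Icc] <;> constructor <;>
    linarith [neg_abs_le x, le_abs_self x, neg_abs_le y, le_abs_self y, abs_nonneg x,
      abs_nonneg y]

lemma integral_abs_rpow_primitive {p : ℝ} (hp : -1 < p) (x : ℝ) :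
    ∫ r in (0 : ℝ)..x, (∫ z in (0 : ℝ)..r, |z| ^ p) = |x| ^ (p + 2) / ((p + 1) * (p + 2)) := by
  have hpos : ∀ x : ℝ, 0 ≤ x → ∫ r in (0 : ℝ)..x, (∫ z in (0 : ℝ)..r, |z| ^ p) =
      |x| ^ (p + 2) / ((p + 1) * (p + 2)) := by
    intro x hx
    have : ∫ r in (0 : ℝ)..x, (∫ z in (0 : ℝ)..r, |z| ^ p) =
        ∫ r in (0 : ℝ)..x, r ^ (p + 1) / (p + 1) :=
      intervalIntegral.integral_congr fun z hz => by
        rw [Set.uIcc_of_le hx] at hz; exact integral_abs_rpow_of_nonneg hp hz.1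
    rw [this, intervalIntegral.integral_div, integral_rpow (Or.inl (by linarith)),
      Real.zero_rpow (by linarith), sub_zero, abs_of_nonneg hx, add_assoc, div_div,
        mul_comm (p + 1)]
    norm_num
  rcases le_total 0 x with hx | hx
  · exact hpos x hx
  · have h1 := hpos (-x) (by linarith)
    rw [abs_neg] at h1
    rw [← h1]
    have := intervalIntegral.integral_comp_neg (a := 0) (b := -x)
      (fun r => ∫ z in (0 : ℝ)..r, |z| ^ p)
    simp only [integral_abs_rpow_neg, neg_neg, neg_zero, intervalIntegral.integral_neg] at this
    rw [intervalIntegral.integral_symm 0 x] at this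
    linarith

/-- The Riesz kernel integrates over a rectangle to the covariance of fractional Brownian motion. -/
lemma integral_rect_riesz {p a b : ℝ} (hp : -1 < p) :
    ∫ r in (0 : ℝ)..a, ∫ s in (0 : ℝ)..b, |r - s| ^ p =
      (|a| ^ (p + 2) + |b| ^ (p + 2) - |a - b| ^ (p + 2)) / ((p + 1) * (p + 2)) := by
  have hint := intervalIntegrable_abs_rpow hp
  have hcont : Continuous fun r : ℝ => ∫ z in (0 : ℝ)..r, |z| ^ p :=
    intervalIntegral.continuous_primitive hint 0
  have h1 : ∀ r : ℝ, ∫ s in (0 : ℝ)..b, |r - s| ^ p =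
      (∫ z in (0 : ℝ)..r, |z| ^ p) - ∫ z in (0 : ℝ)..(r - b), |z| ^ p := by
    intro r
    rw [intervalIntegral.integral_comp_sub_left (fun z => |z| ^ p) r, sub_zero,
      intervalIntegral.integral_interval_sub_left (hint _ _) (hint _ _)]
  simp_rw [h1]
  rw [intervalIntegral.integral_sub (hcont.intervalIntegrable _ _)
    (Continuous.intervalIntegrable (by fun_prop) _ _),
    intervalIntegral.integral_comp_sub_right (fun r => ∫ z in (0 : ℝ)..r, |z| ^ p) b,
    ← intervalIntegral.integral_interval_sub_left (a := 0) (b := a - b)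
      (hcont.intervalIntegrable _ _)
      (hcont.intervalIntegrable _ _), integral_abs_rpow_primitive hp,
    integral_abs_rpow_primitive hp, integral_abs_rpow_primitive hp, zero_sub, abs_neg]
  ring

/-- On the indicators of `[0, s] × A` the form of the noise, multiplied by `H (2H - 1)`, is the
covariance of the noise. -/
lemma noiseForm_rectIndicator {H T : ℝ} (hH : 1 / 2 < H) (i j : NoiseIndex T) :
    H * (2 * H - 1) * noiseForm H T (rectIndicator i) (rectIndicator j) =
      fbmCov H i.time j.time * volume.real (i.region ∩ j.region) := by
  classical
  have hle : ∀ k : NoiseIndex T, Set.Icc 0 k.time ∩ Set.Icc 0 T = Set.Icc 0 k.time := fun k =>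
    Set.inter_eq_left.2 (Set.Icc_subset_Icc_right k.time_mem.2)
  have hfac : ∀ q : (ℝ × ℝ) × ℝ, rectIndicator i (q.1.1, q.2) * rectIndicator j (q.1.2, q.2) *
      |q.1.1 - q.1.2| ^ (2 * H - 2) =
      ((Set.Icc 0 i.time).indicator (fun _ => (1:ℝ)) q.1.1 *
        (Set.Icc 0 j.time).indicator (fun _ => (1:ℝ)) q.1.2 * |q.1.1 - q.1.2| ^ (2 * H - 2)) *
      (i.region ∩ j.region).indicator (fun _ => (1:ℝ)) q.2 := by
    intro q
    simp only [rectIndicator, Set.indicator_apply, Set.mem_prod, Set.mem_inter_iff]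
    split_ifs <;> first | simp; done | (exfalso; tauto)
  rw [noiseForm, integral_normMeasure]
  simp_rw [hfac]
  rw [integral_prod_mul (fun q : ℝ × ℝ => (Set.Icc 0 i.time).indicator (fun _ => (1:ℝ)) q.1 *
        (Set.Icc 0 j.time).indicator (fun _ => (1:ℝ)) q.2 * |q.1 - q.2| ^ (2 * H - 2)),
    integral_indicator_const _ (i.measurable_region.inter j.measurable_region),
    smul_eq_mul, mul_one]
  have hker : ∫ q : ℝ × ℝ, (Set.Icc 0 i.time).indicator (fun _ => (1:ℝ)) q.1 *
        (Set.Icc 0 j.time).indicator (fun _ => (1:ℝ)) q.2 * |q.1 - q.2| ^ (2 * H - 2)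
        ∂((volume.restrict (Set.Icc 0 T)).prod (volume.restrict (Set.Icc 0 T))) =
      ∫ r in (0 : ℝ)..i.time, ∫ s in (0 : ℝ)..j.time, |r - s| ^ (2 * H - 2) := by
    have hsq : Integrable (fun q : ℝ × ℝ => (Set.Icc 0 i.time).indicator (fun _ => (1:ℝ)) q.1 *
        (Set.Icc 0 j.time).indicator (fun _ => (1:ℝ)) q.2 * |q.1 - q.2| ^ (2 * H - 2))
        ((volume.restrict (Set.Icc 0 T)).prod (volume.restrict (Set.Icc 0 T))) := by
      refine ((integrable_and_integral_sub_square (φ := fun z => |z| ^ (2 * H - 2))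
        (integrableOn_abs_rpow (by linarith) T)).1).mono ?_ (ae_of_all _ fun q => ?_)
      · have h1 : Measurable ((Set.Icc 0 i.time).indicator (fun _ => (1:ℝ))) :=
          measurable_const.indicator measurableSet_Icc
        have h2 : Measurable ((Set.Icc 0 j.time).indicator (fun _ => (1:ℝ))) :=
          measurable_const.indicator measurableSet_Icc
        fun_prop
      · simp only [Set.indicator_apply]
        split_ifs <;> simp
    rw [integral_prod _ hsq]
    have hinner : ∀ r, ∫ s in Set.Icc 0 T, (Set.Icc 0 i.time).indicator (fun _ => (1:ℝ)) r *
        (Set.Icc 0 j.time).indicator (fun _ => (1:ℝ)) s * |r - s| ^ (2 * H - 2) =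
        (Set.Icc 0 i.time).indicator
          (fun r => ∫ s in (0 : ℝ)..j.time, |r - s| ^ (2 * H - 2)) r := by
      intro r
      have : ∀ s, (Set.Icc 0 i.time).indicator (fun _ => (1:ℝ)) r *
        (Set.Icc 0 j.time).indicator (fun _ => (1:ℝ)) s * |r - s| ^ (2 * H - 2) =
        (Set.Icc 0 i.time).indicator (fun _ => (1:ℝ)) r *
          (Set.Icc 0 j.time).indicator (fun s => |r - s| ^ (2 * H - 2)) s := by
        intro s; simp only [Set.indicator_apply]; split_ifs <;> simp
      simp_rw [this]
      rw [integral_const_mul, integral_indicator measurableSet_Icc, Measure.restrict_restrict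
        measurableSet_Icc, hle, integral_Icc_eq_integral_Ioc,
        ← intervalIntegral.integral_of_le j.time_mem.1]
      simp only [Set.indicator_apply]; split_ifs <;> simp
    simp only [hinner]
    rw [integral_indicator measurableSet_Icc, Measure.restrict_restrict
        measurableSet_Icc, hle, integral_Icc_eq_integral_Ioc,
        ← intervalIntegral.integral_of_le i.time_mem.1]
  rw [hker, integral_rect_riesz (by linarith), fbmCov, abs_of_nonneg i.time_mem.1,
    abs_of_nonneg j.time_mem.1, abs_sub_comm i.time]
  have h1 : 2 * H - 2 + 2 = 2 * H := by ring
  have h2 : 2 * H - 2 + 1 = 2 * H - 1 := by ring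
  rw [h1, h2]
  have h3 : 2 * H - 1 ≠ 0 := by linarith
  have h4 : H ≠ 0 := by linarith
  rw [← mul_assoc, mul_div_assoc', mul_comm (2 * H - 1) (2 * H)]
  congr 1
  rw [show H * (2 * H - 1) = (2 * H * (2 * H - 1)) / 2 by ring]
  have h5 : 2 * H * (2 * H - 1) ≠ 0 := by positivity
  field_simp

lemma noiseForm_finset_sum {H T : ℝ} (hH : 1 / 2 < H) {ι κ : Type*} (S : Finset ι) (S' : Finset κ)
    {f : ι → ℝ × ℝ → ℝ} {g : κ → ℝ × ℝ → ℝ} (hf : ∀ i ∈ S, IsAdmissible T (f i))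
    (hg : ∀ i ∈ S', IsAdmissible T (g i)) :
    noiseForm H T (fun p => ∑ i ∈ S, f i p) (fun p => ∑ i ∈ S', g i p) =
      ∑ i ∈ S, ∑ j ∈ S', noiseForm H T (f i) (g j) := by
  simp only [noiseForm]
  simp_rw [Finset.sum_mul_sum, Finset.sum_mul]
  rw [integral_finsetSum _ fun i hi => integrable_finsetSum _ fun j hj =>
    integrable_noiseForm hH (hf i hi) (hg j hj)]
  exact Finset.sum_congr rfl fun i hi => integral_finsetSum _ fun j hj =>
    integrable_noiseForm hH (hf i hi) (hg j hj)

variable {Ω : Type*} [MeasurableSpace Ω]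

/-- The Wiener integral of simple functions is isometric. -/
lemma integral_simpleIntegral_sq {H T : ℝ} (hH : 1 / 2 < H) {P : Measure Ω}
    {W : NoiseIndex T → Ω → ℝ} (hW : IsFractionalWhiteNoise H T P W) (c : NoiseIndex T →₀ ℝ) :
    ∫ ω, simpleIntegral W c ω ^ 2 ∂P =
      H * (2 * H - 1) * noiseForm H T (simpleFunction c) (simpleFunction c) := by
  have hL2 : ∀ i, MemLp (W i) 2 P := fun i => (hW.gaussian.hasGaussianLaw_eval i).memLp_two
  have hi : ∀ i j, Integrable (fun ω => c i * W i ω * (c j * W j ω)) P := fun i j =>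
    ((hL2 i).const_mul (c i)).integrable_mul ((hL2 j).const_mul (c j))
  have h1 : noiseForm H T (simpleFunction c) (simpleFunction c) =
      ∑ i ∈ c.support, ∑ j ∈ c.support, noiseForm H T (fun p => c i * rectIndicator i p)
        (fun p => c j * rectIndicator j p) :=
    noiseForm_finset_sum hH _ _ (fun i _ => (isAdmissible_rectIndicator i).const_mul (c i))
      (fun i _ => (isAdmissible_rectIndicator i).const_mul (c i))
  have h2 : ∀ i j, noiseForm H T (fun p => c i * rectIndicator i p)
        (fun p => c j * rectIndicator j p) =
        c i * c j * noiseForm H T (rectIndicator i) (rectIndicator j) := by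
    intro i j
    simp only [noiseForm]
    rw [← integral_const_mul]
    refine integral_congr_ae (ae_of_all _ fun p => ?_)
    simp only; ring
  simp only [simpleIntegral, Finsupp.sum]
  simp_rw [pow_two, Finset.sum_mul_sum]
  rw [integral_finsetSum _ fun i _ => integrable_finsetSum _ fun j _ => hi i j, h1,
    Finset.mul_sum]
  refine Finset.sum_congr rfl fun i _ => ?_
  rw [integral_finsetSum _ fun j _ => hi i j, Finset.mul_sum]
  refine Finset.sum_congr rfl fun j _ => ?_
  rw [h2, show H * (2 * H - 1) * (c i * c j * noiseForm H T (rectIndicator i) (rectIndicator j)) =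
    c i * c j * (H * (2 * H - 1) * noiseForm H T (rectIndicator i) (rectIndicator j)) by ring,
    noiseForm_rectIndicator hH, ← hW.covariance, ← integral_const_mul]
  refine integral_congr_ae (ae_of_all _ fun ω => ?_)
  simp only; ring

/-! ### The variance of the spatial increments -/

/-- The variance of a spatial increment of length `h` of the solution at time `t`. -/
def incrVar (H t h : ℝ) : ℝ := k₁ t * h ^ (2 * H) + k₂ H * h ^ (2 * H + 1)

lemma measurable_waveKernel : Measurable fun p : ℝ × ℝ => waveKernel p.1 p.2 := by
  unfold waveKernel
  exact Measurable.ite (measurableSet_lt (by fun_prop) (by fun_prop)) measurable_const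
    measurable_const

lemma isAdmissible_waveKernel (T t x : ℝ) :
    IsAdmissible T (fun p => waveKernel (t - p.1) (x - p.2)) := by
  classical
  refine ⟨measurable_waveKernel.comp (by fun_prop : Measurable fun p : ℝ × ℝ => (t - p.1, x - p.2)),
    1 / 2, |x| + |t|, fun s hs y => ?_⟩
  simp only [waveKernel, Set.indicator_apply, Set.mem_Icc]
  have h1 := hs.1
  have h2 := abs_lt (a := x - y) (b := t - s)
  have := neg_abs_le x
  have := le_abs_self x
  have := le_abs_self t
  split_ifs with h3 h4 h4
  · norm_num [abs_of_pos]
  · exfalso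
    rw [h2] at h3
    exact h4 ⟨by linarith, by linarith⟩
  · norm_num
  · norm_num

lemma integral_indicator_Ioc_mul (a b c d : ℝ) :
    ∫ y, (Set.Ioc a b).indicator (fun _ => (1 : ℝ)) y * (Set.Ioc c d).indicator (fun _ => (1 : ℝ)) y
      = max (min b d - max a c) 0 := by
  have h : ∀ y, (Set.Ioc a b).indicator (fun _ => (1 : ℝ)) y *
      (Set.Ioc c d).indicator (fun _ => (1 : ℝ)) y =
      (Set.Ioc (max a c) (min b d)).indicator (fun _ => (1 : ℝ)) y := by
    intro y
    simp only [Set.indicator_apply, Set.mem_Ioc, max_lt_iff, le_min_iff]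
    split_ifs <;> first | simp; done | (exfalso; grind)
  simp_rw [h]
  rw [integral_indicator_const _ measurableSet_Ioc, smul_eq_mul, mul_one, measureReal_def,
    Real.volume_Ioc, ENNReal.toReal_ofReal']

lemma integrable_indicator_Ioc_mul (a b c d : ℝ) :
    Integrable fun y => (Set.Ioc a b).indicator (fun _ => (1 : ℝ)) y *
      (Set.Ioc c d).indicator (fun _ => (1 : ℝ)) y := by
  have h : Integrable ((Set.Ioc a b).indicator (fun _ => (1 : ℝ))) :=
    (integrableOn_const (by simp) (by simp)).integrable_indicator measurableSet_Ioc
  refine h.mono (by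
    exact ((measurable_const.indicator measurableSet_Ioc).mul
      (measurable_const.indicator measurableSet_Ioc)).aestronglyMeasurable)
    (ae_of_all _ fun y => ?_)
  simp only [Set.indicator_apply]
  split_ifs <;> simp

/-- The increment of the wave kernel is the difference of the indicators of two intervals of the
length of the increment, which travel in opposite directions. -/
lemma waveKernel_sub_ae {a x x' : ℝ} (ha : 0 < a) (hx : x' ≤ x) : ∀ᵐ y : ℝ,
    waveKernel a (x - y) - waveKernel a (x' - y) = 1 / 2 *
      ((Set.Ioc (x' + a) (x + a)).indicator (fun _ => (1 : ℝ)) y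
        - (Set.Ioc (x' - a) (x - a)).indicator (fun _ => (1 : ℝ)) y) := by
  have hfin : ({x + a, x' + a, x - a, x' - a} : Set ℝ).Finite := by simp
  filter_upwards [measure_eq_zero_iff_ae_notMem.1 (hfin.measure_zero volume)] with y hy
  simp only [Set.mem_insert_iff, Set.mem_singleton_iff, not_or] at hy
  obtain ⟨h1, h2, h3, h4⟩ := hy
  simp only [waveKernel, abs_lt, Set.indicator_apply, Set.mem_Ioc]
  have := lt_or_gt_of_ne h1
  have := lt_or_gt_of_ne h2
  have := lt_or_gt_of_ne h3
  have := lt_or_gt_of_ne h4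
  split_ifs <;> first | norm_num; done | (exfalso; grind)

/-- The overlap of two travelling pairs of intervals: the intervals which move in the same direction
contribute with a positive sign, those which move in opposite directions with a negative one. -/
lemma integral_waveKernel_sub_mul {a b x x' : ℝ} (ha : 0 < a) (hb : 0 < b) (hx : x' ≤ x) :
    ∫ y, (waveKernel a (x - y) - waveKernel a (x' - y)) *
      (waveKernel b (x - y) - waveKernel b (x' - y)) =
      1 / 2 * (max ((x - x') - |a - b|) 0 - max ((x - x') - (a + b)) 0) := by
  set I : ℝ → ℝ → ℝ → ℝ := fun c d => (Set.Ioc c d).indicator (fun _ => (1 : ℝ)) with hI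
  have hint : ∀ c d c' d', Integrable fun y => I c d y * I c' d' y :=
    integrable_indicator_Ioc_mul
  have h1 : ∫ y, (waveKernel a (x - y) - waveKernel a (x' - y)) *
      (waveKernel b (x - y) - waveKernel b (x' - y)) =
      ∫ y, 1 / 4 * ((I (x' + a) (x + a) y * I (x' + b) (x + b) y +
        I (x' - a) (x - a) y * I (x' - b) (x - b) y) -
        (I (x' + a) (x + a) y * I (x' - b) (x - b) y +
        I (x' - a) (x - a) y * I (x' + b) (x + b) y)) := by
    refine integral_congr_ae ?_
    filter_upwards [waveKernel_sub_ae ha hx, waveKernel_sub_ae hb hx] with y h1 h2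
    rw [h1, h2]; ring
  rw [h1, integral_const_mul, integral_sub (by exact (hint _ _ _ _).add (hint _ _ _ _))
    (by exact (hint _ _ _ _).add (hint _ _ _ _)), integral_add (hint _ _ _ _) (hint _ _ _ _),
    integral_add (hint _ _ _ _) (hint _ _ _ _)]
  simp only [hI]
  rw [integral_indicator_Ioc_mul, integral_indicator_Ioc_mul, integral_indicator_Ioc_mul,
    integral_indicator_Ioc_mul]
  have e1 : min (x + a) (x + b) - max (x' + a) (x' + b) = (x - x') - |a - b| := by
    rcases le_total a b with h | h
    · rw [min_eq_left (by linarith), max_eq_right (by linarith), abs_of_nonpos (by linarith)]; ring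
    · rw [min_eq_right (by linarith), max_eq_left (by linarith), abs_of_nonneg (by linarith)]; ring
  have e2 : min (x - a) (x - b) - max (x' - a) (x' - b) = (x - x') - |a - b| := by
    rcases le_total a b with h | h
    · rw [min_eq_right (by linarith), max_eq_left (by linarith), abs_of_nonpos (by linarith)]; ring
    · rw [min_eq_left (by linarith), max_eq_right (by linarith), abs_of_nonneg (by linarith)]; ring
  have e3 : min (x + a) (x - b) - max (x' + a) (x' - b) = (x - x') - (a + b) := by
    rw [min_eq_right (by linarith), max_eq_left (by linarith)]; ring
  have e4 : min (x - a) (x + b) - max (x' - a) (x' + b) = (x - x') - (a + b) := by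
    rw [min_eq_left (by linarith), max_eq_right (by linarith)]; ring
  rw [e1, e2, e3, e4]; ring

/-- The part of the increment variance in which both intervals travel in the same direction. -/
lemma integral_riesz_mul_tent {p t h : ℝ} (hp : -1 < p) (hh : 0 ≤ h) (hht : h ≤ t) :
    ∫ q : ℝ × ℝ, |q.1 - q.2| ^ p * max (h - |q.1 - q.2|) 0
      ∂((volume.restrict (Set.Icc 0 t)).prod (volume.restrict (Set.Icc 0 t))) =
      2 * (t * h ^ (p + 2) / ((p + 1) * (p + 2)) - h ^ (p + 3) / ((p + 2) * (p + 3))) := by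
  have ht : 0 ≤ t := hh.trans hht
  rw [integral_sub_square_of_even (φ := fun z => |z| ^ p * max (h - |z|) 0) ht
    (fun z => by simp only [abs_neg])
    ((integrableOn_abs_rpow hp t).mul_continuousOn (by fun_prop) isCompact_Icc)]
  congr 1
  have hi : ∀ x y, IntervalIntegrable (fun z : ℝ => (t - z) * (|z| ^ p * max (h - |z|) 0))
      volume x y := fun x y =>
    (((intervalIntegrable_abs_rpow hp x y).mul_continuousOn (by fun_prop))).continuousOn_mul
      (by fun_prop)
  rw [← intervalIntegral.integral_add_adjacent_intervals (hi 0 h) (hi h t)]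
  have h2 : ∫ z in h..t, (t - z) * (|z| ^ p * max (h - |z|) 0) = 0 := by
    rw [intervalIntegral.integral_congr (g := fun _ => 0)]
    · simp
    · intro z hz
      rw [Set.uIcc_of_le hht] at hz
      simp only
      rw [max_eq_right (by rw [abs_of_nonneg (hh.trans hz.1)]; linarith [hz.1])]; ring
  have h1 : ∫ z in (0:ℝ)..h, (t - z) * (|z| ^ p * max (h - |z|) 0) =
      ∫ z in (0:ℝ)..h, (t * h * z ^ p - (t + h) * z ^ (p + 1) + z ^ (p + 2)) := by
    refine intervalIntegral.integral_congr_ae (ae_of_all _ fun z hz => ?_)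
    rw [Set.uIoc_of_le hh] at hz
    rw [abs_of_pos hz.1, max_eq_left (by linarith [hz.2]), Real.rpow_add hz.1,
      Real.rpow_add hz.1, Real.rpow_one, Real.rpow_two]
    ring
  have i0 : IntervalIntegrable (fun z : ℝ => z ^ p) volume 0 h :=
    intervalIntegral.intervalIntegrable_rpow' hp
  have i1 : IntervalIntegrable (fun z : ℝ => z ^ (p + 1)) volume 0 h :=
    intervalIntegral.intervalIntegrable_rpow' (by linarith)
  have i2 : IntervalIntegrable (fun z : ℝ => z ^ (p + 2)) volume 0 h :=
    intervalIntegral.intervalIntegrable_rpow' (by linarith)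
  rw [h2, h1, intervalIntegral.integral_add ((i0.const_mul _).sub (i1.const_mul _)) i2,
    intervalIntegral.integral_sub (i0.const_mul _) (i1.const_mul _),
    intervalIntegral.integral_const_mul, intervalIntegral.integral_const_mul,
    integral_rpow (Or.inl hp), integral_rpow (Or.inl (by linarith)),
    integral_rpow (Or.inl (by linarith)), Real.zero_rpow (by linarith),
    Real.zero_rpow (by linarith), Real.zero_rpow (by linarith)]
  have e1 : p + 1 ≠ 0 := by linarith
  have e2 : p + 2 ≠ 0 := by linarith
  have e3 : p + 3 ≠ 0 := by linarith
  have s1 : p + 1 + 1 = p + 2 := by ring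
  have s2 : p + 2 + 1 = p + 3 := by ring
  rw [s1, s2]
  rcases hh.eq_or_lt with rfl | hh
  · simp [Real.zero_rpow e2, Real.zero_rpow e3]
  · have f2 : h ^ (p + 2) = h ^ (p + 1) * h := by rw [← s1, Real.rpow_add hh, Real.rpow_one]
    have f3 : h ^ (p + 3) = h ^ (p + 1) * h * h := by
      rw [← s2, Real.rpow_add hh, Real.rpow_one, f2]
    rw [f3, f2]
    field_simp
    ring

/-- The part of the increment variance in which the intervals travel in opposite directions. -/
lemma integral_riesz_mul_sum {p t h : ℝ} (hp : -1 < p) (hh : 0 ≤ h) (hht : h ≤ t) :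
    Integrable (fun q : ℝ × ℝ => |q.1 - q.2| ^ p * max (h - (q.1 + q.2)) 0)
      ((volume.restrict (Set.Icc 0 t)).prod (volume.restrict (Set.Icc 0 t))) ∧
    ∫ q : ℝ × ℝ, |q.1 - q.2| ^ p * max (h - (q.1 + q.2)) 0
      ∂((volume.restrict (Set.Icc 0 t)).prod (volume.restrict (Set.Icc 0 t))) =
      h ^ (p + 3) / ((p + 1) * (p + 2) * (p + 3)) := by
  have ht : 0 ≤ t := hh.trans hht
  have hms : MeasurableSet (Set.Icc 0 t ×ˢ Set.Icc 0 t : Set (ℝ × ℝ)) :=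
    measurableSet_Icc.prod measurableSet_Icc
  have hint : Integrable (fun q : ℝ × ℝ => |q.1 - q.2| ^ p * max (h - (q.1 + q.2)) 0)
      ((volume.restrict (Set.Icc 0 t)).prod (volume.restrict (Set.Icc 0 t))) := by
    refine ((integrable_and_integral_sub_square (φ := fun z => |z| ^ p)
      (integrableOn_abs_rpow hp t)).1.const_mul h).mono (by fun_prop) ?_
    rw [Measure.prod_restrict]
    filter_upwards [ae_restrict_mem hms] with q hq
    rw [norm_mul, norm_mul, mul_comm]
    gcongr
    rw [Real.norm_of_nonneg (le_max_right _ _), Real.norm_of_nonneg hh]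
    exact max_le (by linarith [hq.1.1, hq.2.1]) hh
  refine ⟨hint, ?_⟩
  set F : ℝ × ℝ → ℝ := fun q => (Set.Icc 0 t).indicator (fun _ => (1 : ℝ)) q.1 *
    (Set.Icc 0 t).indicator (fun _ => (1 : ℝ)) (q.2 - q.1) *
      (|2 * q.1 - q.2| ^ p * max (h - q.2) 0) with hF
  have heq : ∀ q : ℝ × ℝ, F (MeasurableEquiv.shearAddRight ℝ q) =
      (Set.Icc 0 t ×ˢ Set.Icc 0 t).indicator
        (fun q => |q.1 - q.2| ^ p * max (h - (q.1 + q.2)) 0) q := by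
    intro q
    have : MeasurableEquiv.shearAddRight ℝ q = (q.1, q.1 + q.2) := rfl
    simp only [hF, this, add_sub_cancel_left, Set.indicator_apply, Set.mem_prod]
    rw [show 2 * q.1 - (q.1 + q.2) = q.1 - q.2 by ring]
    split_ifs <;> first | simp; done | (exfalso; tauto)
  have hmp : MeasurePreserving (MeasurableEquiv.shearAddRight ℝ)
      ((volume : Measure ℝ).prod (volume : Measure ℝ)) (volume.prod volume) :=
    measurePreserving_prod_add volume volume
  rw [Measure.prod_restrict] at hint ⊢
  have hFi : Integrable F (volume.prod volume) := by
    rw [← hmp.integrable_comp_emb (MeasurableEquiv.measurableEmbedding _)]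
    have : F ∘ (MeasurableEquiv.shearAddRight ℝ) = (Set.Icc 0 t ×ˢ Set.Icc 0 t).indicator
        (fun q => |q.1 - q.2| ^ p * max (h - (q.1 + q.2)) 0) := funext heq
    rw [this]
    exact (integrable_indicator_iff hms).2 hint
  rw [← integral_indicator hms]
  simp_rw [← heq]
  rw [hmp.integral_comp' (g := F), integral_prod_symm _ hFi]
  have hinner : ∀ w, ∫ a, F (a, w) = (Set.Ioc 0 h).indicator
      (fun w => (h * w ^ (p + 1) - w ^ (p + 2)) / (p + 1)) w := by
    intro w
    by_cases hw : w ∈ Set.Ioc 0 h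
    · have h1 : ∀ a, F (a, w) = (h - w) * (Set.Icc 0 w).indicator (fun a => |2 * a - w| ^ p) a := by
        intro a
        have h3 := hw.1
        have h4 := hw.2
        simp only [hF, max_eq_left (sub_nonneg.2 hw.2), Set.indicator_apply, Set.mem_Icc]
        split_ifs <;> first | (simp; try ring); done | (exfalso; grind)
      simp_rw [h1]
      rw [integral_const_mul, integral_indicator measurableSet_Icc, integral_Icc_eq_integral_Ioc,
        ← intervalIntegral.integral_of_le hw.1.le,
        intervalIntegral.integral_comp_mul_sub (fun z => |z| ^ p) two_ne_zero,
        Set.indicator_of_mem hw, mul_zero, zero_sub, show 2 * w - w = w by ring,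
        ← intervalIntegral.integral_interval_sub_left (a := 0)
          (intervalIntegrable_abs_rpow hp _ _) (intervalIntegrable_abs_rpow hp _ _),
        integral_abs_rpow_neg, integral_abs_rpow_of_nonneg hp hw.1.le,
        show p + 2 = p + 1 + 1 by ring, Real.rpow_add hw.1 (p + 1) 1, Real.rpow_one, smul_eq_mul]
      have e1 : p + 1 ≠ 0 := by linarith
      field_simp
      ring
    · rw [Set.indicator_of_notMem hw]
      have h1 : ∀ᵐ a, F (a, w) = 0 := by
        have hfin : ({0} : Set ℝ).Finite := by simp
        filter_upwards [measure_eq_zero_iff_ae_notMem.1 (hfin.measure_zero volume)] with a ha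
        simp only [hF, Set.indicator_apply, Set.mem_Icc]
        simp only [Set.mem_Ioc, not_and_or, not_lt, not_le] at hw
        simp only [Set.mem_singleton_iff] at ha
        rcases hw with hw | hw
        · split_ifs <;> first | simp; done | (exfalso; grind)
        · rw [max_eq_right (by linarith)]; simp
      rw [integral_congr_ae h1]; simp
  simp_rw [hinner]
  have i1 : IntervalIntegrable (fun z : ℝ => z ^ (p + 1)) volume 0 h :=
    intervalIntegral.intervalIntegrable_rpow' (by linarith)
  have i2 : IntervalIntegrable (fun z : ℝ => z ^ (p + 2)) volume 0 h :=
    intervalIntegral.intervalIntegrable_rpow' (by linarith)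
  rw [integral_indicator measurableSet_Ioc, ← intervalIntegral.integral_of_le hh,
    intervalIntegral.integral_div, intervalIntegral.integral_sub (i1.const_mul _) i2,
    intervalIntegral.integral_const_mul, integral_rpow (Or.inl (by linarith)),
    integral_rpow (Or.inl (by linarith)), Real.zero_rpow (by linarith),
    Real.zero_rpow (by linarith), show p + 1 + 1 = p + 2 by ring, show p + 2 + 1 = p + 3 by ring]
  have e1 : p + 1 ≠ 0 := by linarith
  have e2 : p + 2 ≠ 0 := by linarith
  have e3 : p + 3 ≠ 0 := by linarith
  rcases hh.eq_or_lt with rfl | hh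
  · simp [Real.zero_rpow e3, Real.zero_rpow e2]
  · rw [show p + 3 = p + 2 + 1 by ring, Real.rpow_add hh (p + 2) 1, Real.rpow_one]
    have e4 : p + 2 + 1 ≠ 0 := by linarith
    field_simp
    ring

/-- The squared norm of the increment of the wave kernel. -/
lemma noiseForm_waveKernel_sub {H T t x x' : ℝ} (hH : 1 / 2 < H) (htT : t ≤ T)
    (hx : x' ≤ x) (hxt : x - x' ≤ t) :
    H * (2 * H - 1) * noiseForm H T
      (fun p => waveKernel (t - p.1) (x - p.2) - waveKernel (t - p.1) (x' - p.2))
      (fun p => waveKernel (t - p.1) (x - p.2) - waveKernel (t - p.1) (x' - p.2)) =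
      incrVar H t (x - x') := by
  set h := x - x' with hh
  have hh0 : 0 ≤ h := by linarith
  have ht : 0 ≤ t := by linarith
  set p := 2 * H - 2 with hp
  have hp1 : -1 < p := by linarith
  have hadm := (isAdmissible_waveKernel T t x).sub (isAdmissible_waveKernel T t x')
  have hint := integrable_noiseForm hH hadm hadm
  rw [noiseForm, integral_normMeasure, integral_prod _ (integrable_normMeasure_iff.1 hint)]
  have hms : ∀ c : ℝ, MeasurableSet (Set.Icc 0 c ×ˢ Set.Icc 0 c : Set (ℝ × ℝ)) := fun c =>
    measurableSet_Icc.prod measurableSet_Icc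
  have hmio : MeasurableSet (Set.Ico 0 t ×ˢ Set.Ico 0 t : Set (ℝ × ℝ)) :=
    measurableSet_Ico.prod measurableSet_Ico
  -- The inner integral vanishes unless both times precede `t`.
  have hinner : ∀ q : ℝ × ℝ, q ∈ (Set.Icc 0 T ×ˢ Set.Icc 0 T : Set (ℝ × ℝ)) →
      ∫ y, (waveKernel (t - q.1) (x - y) - waveKernel (t - q.1) (x' - y)) *
        (waveKernel (t - q.2) (x - y) - waveKernel (t - q.2) (x' - y)) * |q.1 - q.2| ^ p =
      (Set.Ico 0 t ×ˢ Set.Ico 0 t).indicator (fun q : ℝ × ℝ => 1 / 2 *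
        (|q.1 - q.2| ^ p * max (h - |q.1 - q.2|) 0 -
          |(t - q.1) - (t - q.2)| ^ p * max (h - ((t - q.1) + (t - q.2))) 0)) q := by
    intro q hq
    rw [integral_mul_const]
    have hzero : ∀ a, a ≤ 0 → ∀ z, waveKernel a z = 0 := fun a ha z => by
      rw [waveKernel, if_neg]; intro hlt; linarith [abs_nonneg z]
    by_cases hq1 : q.1 < t
    · by_cases hq2 : q.2 < t
      · have hmem : q ∈ (Set.Ico 0 t ×ˢ Set.Ico 0 t : Set (ℝ × ℝ)) :=
          ⟨⟨hq.1.1, hq1⟩, ⟨hq.2.1, hq2⟩⟩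
        rw [Set.indicator_of_mem hmem, integral_waveKernel_sub_mul (by linarith) (by linarith) hx,
          show t - q.1 - (t - q.2) = -(q.1 - q.2) by ring, abs_neg]
        ring
      · rw [Set.indicator_of_notMem (fun hmem => hq2 hmem.2.2)]
        simp [hzero (t - q.2) (by linarith)]
    · rw [Set.indicator_of_notMem (fun hmem => hq1 hmem.1.2)]
      simp [hzero (t - q.1) (by linarith)]
  have h1 : ∫ q : ℝ × ℝ, (∫ y, (waveKernel (t - q.1) (x - y) - waveKernel (t - q.1) (x' - y)) *
        (waveKernel (t - q.2) (x - y) - waveKernel (t - q.2) (x' - y)) * |q.1 - q.2| ^ p)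
        ∂((volume.restrict (Set.Icc 0 T)).prod (volume.restrict (Set.Icc 0 T))) =
      ∫ q : ℝ × ℝ, 1 / 2 * (|q.1 - q.2| ^ p * max (h - |q.1 - q.2|) 0 -
          |(t - q.1) - (t - q.2)| ^ p * max (h - ((t - q.1) + (t - q.2))) 0)
        ∂((volume.restrict (Set.Icc 0 t)).prod (volume.restrict (Set.Icc 0 t))) := by
    rw [Measure.prod_restrict, setIntegral_congr_fun (hms T) hinner,
      setIntegral_indicator hmio, Set.inter_eq_right.2 (Set.prod_mono
        (Set.Ico_subset_Icc_self.trans (Set.Icc_subset_Icc_right htT))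
        (Set.Ico_subset_Icc_self.trans (Set.Icc_subset_Icc_right htT))),
      ← Measure.prod_restrict, restrict_Ico_eq_restrict_Icc]
  have hrefl : MeasurePreserving (fun a : ℝ => t - a) (volume.restrict (Set.Icc 0 t))
      (volume.restrict (Set.Icc 0 t)) := by
    have := (Measure.measurePreserving_sub_left (volume : Measure ℝ) t).restrict_preimage
      (measurableSet_Icc (a := (0:ℝ)) (b := t))
    simpa using this
  have hrefl2 := hrefl.prod hrefl
  have hemb : MeasurableEmbedding (Prod.map (fun a : ℝ => t - a) (fun a : ℝ => t - a)) :=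
    ((MeasurableEquiv.subLeft t).prodCongr (MeasurableEquiv.subLeft t)).measurableEmbedding
  obtain ⟨j1, j2⟩ := integral_riesz_mul_sum hp1 hh0 hxt
  have j3 := (hrefl2.integrable_comp_emb hemb).2 j1
  have j4 := hrefl2.integral_comp hemb
    (fun q : ℝ × ℝ => |q.1 - q.2| ^ p * max (h - (q.1 + q.2)) 0)
  simp only [Function.comp_def, Prod.map_fst, Prod.map_snd] at j3 j4
  rw [h1, integral_const_mul, integral_sub _ j3, integral_riesz_mul_tent hp1 hh0 hxt, j4, j2]
  · have s1 : p + 1 = 2 * H - 1 := by rw [hp]; ring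
    have s2 : p + 2 = 2 * H := by rw [hp]; ring
    have s3 : p + 3 = 2 * H + 1 := by rw [hp]; ring
    rw [s1, s2, s3, incrVar, k₁, k₂]
    have e1 : 2 * H - 1 ≠ 0 := by linarith
    have e2 : H ≠ 0 := by linarith
    have e3 : 2 * H + 1 ≠ 0 := by linarith
    generalize h ^ (2 * H) = A
    generalize h ^ (2 * H + 1) = B
    generalize hD : 2 * H - 1 = D at *
    generalize hE : 2 * H + 1 = E at *
    have hHD : H = (D + 1) / 2 := by linarith
    have hHE : E = D + 2 := by linarith
    subst hHD hHE
    have e4 : D + 1 ≠ 0 := by linarith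
    field_simp
    ring
  · exact (integrable_and_integral_sub_square (φ := fun z => |z| ^ p * max (h - |z|) 0)
      ((integrableOn_abs_rpow hp1 t).mul_continuousOn (by fun_prop) isCompact_Icc)).1

/-! ### The first chaos -/

lemma simpleFunction_sub {T : ℝ} (c c' : NoiseIndex T →₀ ℝ) (p : ℝ × ℝ) :
    simpleFunction (c - c') p = simpleFunction c p - simpleFunction c' p :=
  Finsupp.sum_sub_index fun _ _ _ => sub_mul _ _ _

lemma simpleIntegral_sub {Ω : Type*} {T : ℝ} (W : NoiseIndex T → Ω → ℝ)
    (c c' : NoiseIndex T →₀ ℝ) (ω : Ω) :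
    simpleIntegral W (c - c') ω = simpleIntegral W c ω - simpleIntegral W c' ω :=
  Finsupp.sum_sub_index fun _ _ _ => sub_mul _ _ _

section Chaos

variable {Ω : Type*} [MeasurableSpace Ω] {P : Measure Ω} {T : ℝ} {W : NoiseIndex T → Ω → ℝ}

lemma norm_sq_eq_integral (Z : Lp ℝ 2 P) : ‖Z‖ ^ 2 = ∫ ω, Z ω ^ 2 ∂P := by
  rw [← real_inner_self_eq_norm_sq, L2.inner_def]
  simp [pow_two]

lemma norm_toLp_sq {X : Ω → ℝ} (hX : MemLp X 2 P) : ‖hX.toLp X‖ ^ 2 = ∫ ω, X ω ^ 2 ∂P := by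
  rw [norm_sq_eq_integral]
  refine integral_congr_ae ?_
  filter_upwards [hX.coeFn_toLp] with ω h
  rw [h]

lemma memLp_noise {H : ℝ} (hW : IsFractionalWhiteNoise H T P W) (i : NoiseIndex T) :
    MemLp (W i) 2 P := (hW.gaussian.hasGaussianLaw_eval i).memLp_two

lemma memLp_simpleIntegral {H : ℝ} (hW : IsFractionalWhiteNoise H T P W) (c : NoiseIndex T →₀ ℝ) :
    MemLp (simpleIntegral W c) 2 P :=
  memLp_finsetSum _ fun i _ => (memLp_noise hW i).const_mul (c i)

lemma span_noise_eq {H : ℝ} (hW : IsFractionalWhiteNoise H T P W) :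
    {Z : Lp ℝ 2 P | ∃ i, Z =ᵐ[P] W i} = Set.range fun i => (memLp_noise hW i).toLp (W i) := by
  ext Z
  constructor
  · rintro ⟨i, hi⟩
    exact ⟨i, Lp.ext ((memLp_noise hW i).coeFn_toLp.trans hi.symm)⟩
  · rintro ⟨i, rfl⟩
    exact ⟨i, (memLp_noise hW i).coeFn_toLp⟩

lemma sum_toLp_noise_ae {H : ℝ} (hW : IsFractionalWhiteNoise H T P W) (c : NoiseIndex T →₀ ℝ) :
    (c.sum fun i a => a • (memLp_noise hW i).toLp (W i) : Lp ℝ 2 P) =ᵐ[P] simpleIntegral W c := by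
  have h1 := Lp.coeFn_finsetSum c.support fun i => c i • (memLp_noise hW i).toLp (W i)
  have h2 : ∀ᵐ ω ∂P, ∀ i ∈ c.support,
      (c i • (memLp_noise hW i).toLp (W i) : Lp ℝ 2 P) ω = c i * W i ω := by
    rw [Filter.eventually_all_finset]
    intro i _
    filter_upwards [Lp.coeFn_smul (c i) ((memLp_noise hW i).toLp (W i)),
      (memLp_noise hW i).coeFn_toLp] with ω h h'
    rw [h, Pi.smul_apply, h', smul_eq_mul]
  filter_upwards [h1, h2] with ω h h'
  simp only [Finsupp.sum, simpleIntegral]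
  rw [h, Finset.sum_apply]
  exact Finset.sum_congr rfl h'

lemma toLp_simpleIntegral_mem {H : ℝ} (hW : IsFractionalWhiteNoise H T P W)
    (c : NoiseIndex T →₀ ℝ) :
    (memLp_simpleIntegral hW c).toLp (simpleIntegral W c) ∈
      Submodule.span ℝ {Z : Lp ℝ 2 P | ∃ i, Z =ᵐ[P] W i} := by
  rw [span_noise_eq hW, Finsupp.mem_span_range_iff_exists_finsupp]
  exact ⟨c, Lp.ext ((sum_toLp_noise_ae hW c).trans
    (memLp_simpleIntegral hW c).coeFn_toLp.symm)⟩

lemma map_simpleIntegral {H : ℝ} (hW : IsFractionalWhiteNoise H T P W) (c : NoiseIndex T →₀ ℝ) :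
    P.map (simpleIntegral W c) =
      gaussianReal 0 (∫ ω, simpleIntegral W c ω ^ 2 ∂P).toNNReal := by
  have hg : HasGaussianLaw (simpleIntegral W c) P := by
    have := (hW.gaussian.smul c).hasGaussianLaw_fun_sum (I := c.support)
    simpa [simpleIntegral, Finsupp.sum] using! this
  have hm : ∫ ω, simpleIntegral W c ω ∂P = 0 := by
    simp only [simpleIntegral, Finsupp.sum]
    rw [integral_finsetSum _ fun i _ =>
      ((hW.gaussian.hasGaussianLaw_eval i).integrable.const_mul (c i))]
    simp [integral_const_mul, hW.centered]
  rw [hg.map_eq_gaussianReal, hm, variance_of_integral_eq_zero hg.aemeasurable hm]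

lemma tendsto_charFun_of_tendsto_Lp [IsProbabilityMeasure P] {Z : ℕ → Lp ℝ 2 P} {Z₀ : Lp ℝ 2 P}
    (h : Tendsto Z atTop (𝓝 Z₀)) (s : ℝ) :
    Tendsto (fun n => charFun (P.map (Z n)) s) atTop (𝓝 (charFun (P.map Z₀) s)) := by
  rw [Lp.tendsto_Lp_iff_tendsto_eLpNorm'] at h
  have h1 : TendstoInMeasure P (fun n => (Z n : Ω → ℝ)) atTop Z₀ :=
    tendstoInMeasure_of_tendsto_eLpNorm two_ne_zero (fun n => Lp.aestronglyMeasurable _)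
      (Lp.aestronglyMeasurable _) h
  exact ProbabilityMeasure.tendsto_iff_tendsto_charFun.1
    (h1.tendstoInDistribution fun n => (Lp.aestronglyMeasurable _).aemeasurable).tendsto s

/-- The elements of the first chaos are centered Gaussian: the Gaussian laws are closed in `L²`. -/
lemma map_of_mem_firstChaos [IsProbabilityMeasure P] {H : ℝ}
    (hW : IsFractionalWhiteNoise H T P W) {Z : Lp ℝ 2 P} (hZ : Z ∈ firstChaos P W) :
    P.map Z = gaussianReal 0 (‖Z‖ ^ 2).toNNReal := by
  have hspan : ∀ Y ∈ Submodule.span ℝ {Z : Lp ℝ 2 P | ∃ i, Z =ᵐ[P] W i},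
      P.map Y = gaussianReal 0 (‖Y‖ ^ 2).toNNReal := by
    intro Y hY
    rw [span_noise_eq hW, Finsupp.mem_span_range_iff_exists_finsupp] at hY
    obtain ⟨c, rfl⟩ := hY
    have h := sum_toLp_noise_ae hW c
    rw [Measure.map_congr h, map_simpleIntegral hW, norm_sq_eq_integral]
    congr 2
    refine integral_congr_ae ?_
    filter_upwards [h] with ω hω
    rw [hω]
  rw [firstChaos, ← SetLike.mem_coe, Submodule.topologicalClosure_coe,
    mem_closure_iff_seq_limit] at hZ
  obtain ⟨Y, hY, hlim⟩ := hZ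
  have hp : IsProbabilityMeasure (P.map Z) :=
    Measure.isProbabilityMeasure_map (Lp.aestronglyMeasurable _).aemeasurable
  refine Measure.ext_of_charFun (funext fun s => ?_)
  refine tendsto_nhds_unique (tendsto_charFun_of_tendsto_Lp hlim s) ?_
  simp_rw [hspan _ (hY _), charFun_gaussianReal]
  have hn : Tendsto (fun n => (((‖Y n‖ ^ 2).toNNReal : ℝ) : ℂ)) atTop
      (𝓝 (((‖Z‖ ^ 2).toNNReal : ℝ) : ℂ)) := by
    have : Continuous fun x : Lp ℝ 2 P => (((‖x‖ ^ 2).toNNReal : ℝ) : ℂ) := by fun_prop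
    exact this.continuousAt.tendsto.comp hlim
  have hc : Continuous fun x : ℂ => Complex.exp (s * (0 : ℝ) * Complex.I - x * s ^ 2 / 2) := by
    fun_prop
  exact (hc.tendsto _).comp hn

/-- A finite family of elements of the first chaos is jointly Gaussian. -/
lemma hasGaussianLaw_of_mem_firstChaos [IsProbabilityMeasure P] {H : ℝ}
    (hW : IsFractionalWhiteNoise H T P W) {ι : Type*} [Fintype ι] {D : ι → Ω → ℝ}
    (hD : ∀ i, ∃ Z ∈ firstChaos P W, Z =ᵐ[P] D i) :
    HasGaussianLaw (fun ω i => D i ω) P := by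
  classical
  choose Z hZ hZD using hD
  have hm : AEMeasurable (fun ω i => D i ω) P := aemeasurable_pi_lambda _ fun i =>
    (Lp.aestronglyMeasurable (Z i)).aemeasurable.congr (hZD i)
  refine ⟨⟨fun L => ?_⟩⟩
  have hL : ∀ x : ι → ℝ, L x = ∑ i, L (Pi.single i 1) * x i := by
    intro x
    conv_lhs => rw [← Finset.univ_sum_single x]
    rw [map_sum]
    refine Finset.sum_congr rfl fun i _ => ?_
    rw [mul_comm, ← smul_eq_mul, ← map_smul, ← Pi.single_smul, smul_eq_mul, mul_one]
  set Y : Lp ℝ 2 P := ∑ i, L (Pi.single i 1) • Z i with hY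
  have hYm : Y ∈ firstChaos P W := Submodule.sum_mem _ fun i _ => Submodule.smul_mem _ _ (hZ i)
  have hYae : (fun ω => L fun i => D i ω) =ᵐ[P] Y := by
    have h2 : ∀ᵐ ω ∂P, ∀ i ∈ Finset.univ,
        (L (Pi.single i 1) • Z i : Lp ℝ 2 P) ω = L (Pi.single i 1) * D i ω := by
      rw [Filter.eventually_all_finset]
      intro i _
      filter_upwards [Lp.coeFn_smul (L (Pi.single i 1)) (Z i), hZD i] with ω h h'
      rw [h, Pi.smul_apply, h', smul_eq_mul]
    filter_upwards [Lp.coeFn_finsetSum Finset.univ fun i => L (Pi.single i 1) • Z i, h2] with ω h h'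
    rw [hY, h, hL, Finset.sum_apply]
    exact (Finset.sum_congr rfl h').symm
  have hmap : (P.map fun ω i => D i ω).map L = P.map Y := by
    rw [AEMeasurable.map_map_of_aemeasurable L.continuous.measurable.aemeasurable hm]
    exact Measure.map_congr hYae
  have hLm : ∀ (f : ℝ → ℝ), Measurable f →
      ∫ x, f (L x) ∂(P.map fun ω i => D i ω) = ∫ y, f y ∂((P.map fun ω i => D i ω).map L) := by
    intro f hf
    rw [integral_map L.continuous.measurable.aemeasurable hf.aestronglyMeasurable]
  rw [← variance_id_map L.continuous.measurable.aemeasurable, hLm (fun y => y) measurable_id, hmap,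
    map_of_mem_firstChaos hW hYm, integral_id_gaussianReal, variance_id_gaussianReal,
    Real.toNNReal_coe]

lemma IsWienerIntegral.mem_firstChaos {H : ℝ} (hW : IsFractionalWhiteNoise H T P W)
    {f : ℝ × ℝ → ℝ} {X : Ω → ℝ} (h : IsWienerIntegral H T P W f X) :
    h.1.toLp X ∈ firstChaos P W := by
  obtain ⟨hX, c, -, -, hlim⟩ := h
  rw [firstChaos, ← SetLike.mem_coe, Submodule.topologicalClosure_coe, mem_closure_iff_seq_limit]
  refine ⟨fun n => (memLp_simpleIntegral hW (c n)).toLp _,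
    fun n => toLp_simpleIntegral_mem hW (c n), ?_⟩
  rw [Lp.tendsto_Lp_iff_tendsto_eLpNorm'']
  refine hlim.congr fun n => ?_
  rw [← eLpNorm_neg]
  congr 1
  ext ω
  simp

/-- Isometry: the variance of a difference of Wiener integrals is the squared norm of the
difference of the integrands. -/
lemma IsWienerIntegral.integral_sub_sq {H : ℝ} (hH : 1 / 2 < H) (hH1 : H < 1)
    (hW : IsFractionalWhiteNoise H T P W) {f g : ℝ × ℝ → ℝ} {X Y : Ω → ℝ}
    (hf : IsAdmissible T f) (hg : IsAdmissible T g)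
    (hX : IsWienerIntegral H T P W f X) (hY : IsWienerIntegral H T P W g Y) :
    ∫ ω, (X ω - Y ω) ^ 2 ∂P =
      H * (2 * H - 1) * noiseForm H T (fun p => f p - g p) (fun p => f p - g p) := by
  obtain ⟨hX2, c, -, hc, hcX⟩ := hX
  obtain ⟨hY2, d, -, hd, hdY⟩ := hY
  have hHpos : 0 < H * (2 * H - 1) := by nlinarith
  have hsub : MemLp (fun ω => X ω - Y ω) 2 P := hX2.sub hY2
  have hlim : Tendsto (fun n => (memLp_simpleIntegral hW (c n - d n)).toLp
      (simpleIntegral W (c n - d n))) atTop (𝓝 (hsub.toLp _)) := by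
    rw [Lp.tendsto_Lp_iff_tendsto_eLpNorm'']
    have hsum := hcX.add hdY
    rw [add_zero] at hsum
    refine tendsto_of_tendsto_of_tendsto_of_le_of_le tendsto_const_nhds hsum
      (fun n => zero_le) fun n => ?_
    have heq : (simpleIntegral W (c n - d n) - fun ω => X ω - Y ω) =
        (fun ω => Y ω - simpleIntegral W (d n) ω) - fun ω => X ω - simpleIntegral W (c n) ω := by
      ext ω
      simp only [Pi.sub_apply, simpleIntegral_sub]
      ring
    rw [heq, add_comm]
    exact eLpNorm_sub_le (hY2.sub (memLp_simpleIntegral hW (d n))).aestronglyMeasurable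
      (hX2.sub (memLp_simpleIntegral hW (c n))).aestronglyMeasurable (by norm_num)
  have hnorm := (hlim.norm.pow 2)
  simp only [norm_toLp_sq, integral_simpleIntegral_sq hH hW] at hnorm
  refine tendsto_nhds_unique hnorm (Tendsto.const_mul _ ?_)
  set e : ℕ → ℝ × ℝ → ℝ := fun n p =>
    (f p - simpleFunction (c n) p) - (g p - simpleFunction (d n) p) with he
  have hfe : ∀ n, IsAdmissible T fun p => f p - simpleFunction (c n) p := fun n =>
    hf.sub (isAdmissible_simpleFunction _)
  have hge : ∀ n, IsAdmissible T fun p => g p - simpleFunction (d n) p := fun n =>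
    hg.sub (isAdmissible_simpleFunction _)
  have hlim0 : ∀ (φ : ℕ → ℝ × ℝ → ℝ), Tendsto (fun n => noiseNormSq H T (φ n)) atTop (𝓝 0) →
      Tendsto (fun n => noiseForm H T (φ n) (φ n)) atTop (𝓝 0) := by
    intro φ hφ
    have := hφ.const_mul (H * (2 * H - 1))⁻¹
    rw [mul_zero] at this
    refine this.congr fun n => ?_
    change (H * (2 * H - 1))⁻¹ * (H * (2 * H - 1) * noiseForm H T (φ n) (φ n)) = _
    exact inv_mul_cancel_left₀ hHpos.ne' _
  have hez : Tendsto (fun n => noiseForm H T (e n) (e n)) atTop (𝓝 0) := by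
    have hsum := ((hlim0 _ hc).const_mul 2).add ((hlim0 _ hd).const_mul 2)
    rw [mul_zero, add_zero] at hsum
    exact squeeze_zero (fun n => noiseForm_self_nonneg hH hH1 ((hfe n).sub (hge n)))
      (fun n => noiseForm_sub_le hH hH1 (hfe n) (hge n)) hsum
  refine (tendsto_noiseForm_sub hH hH1 (hf.sub hg) (fun n => (hfe n).sub (hge n)) hez).congr
    fun n => ?_
  have : (fun p => f p - g p - (f p - simpleFunction (c n) p - (g p - simpleFunction (d n) p))) =
      simpleFunction (c n - d n) := by
    ext p
    rw [simpleFunction_sub]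
    ring
  rw [this]

/-- The variance of the spatial increments of the solution. -/
lemma IsMildSolution.integral_sub_sq {H t : ℝ} (hH : 1 / 2 < H) (hH1 : H < 1)
    (hW : IsFractionalWhiteNoise H T P W) {u : ℝ → ℝ → Ω → ℝ} (hu : IsMildSolution H T P W u)
    (ht : 0 ≤ t) (htT : t ≤ T) {x y : ℝ} (hxy : |x - y| ≤ t) :
    ∫ ω, (u t x ω - u t y ω) ^ 2 ∂P = incrVar H t |x - y| := by
  wlog h : y ≤ x generalizing x y
  · have := this (by rwa [abs_sub_comm]) (not_le.1 h).le
    rw [abs_sub_comm, ← this]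
    refine integral_congr_ae (ae_of_all _ fun ω => ?_)
    simp only; ring
  rw [abs_of_nonneg (by linarith)] at hxy ⊢
  rw [(hu t ⟨ht, htT⟩ x).integral_sub_sq hH hH1 hW (isAdmissible_waveKernel T t x)
    (isAdmissible_waveKernel T t y) (hu t ⟨ht, htT⟩ y)]
  exact noiseForm_waveKernel_sub hH htT h hxy

end Chaos

/-! ### Quadratic forms of Gaussian vectors -/

/-- The power series of `-log (1 - w) - w`, which starts at order two. -/
lemma complex_hasSum_log_sub {w : ℂ} (hw : ‖w‖ < 1) :
    HasSum (fun m : ℕ => w ^ (m + 2) / (2 * (m + 2 : ℂ))) (1 / 2 * (-Complex.log (1 - w) - w)) := by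
  have h := Complex.hasSum_taylorSeries_neg_log hw
  have h2 := (hasSum_nat_add_iff' 2).2 h
  have h3 := h2.mul_left (1 / 2)
  simp only [Finset.sum_range_succ, Finset.sum_range_zero] at h3
  have e1 : (fun m : ℕ => w ^ (m + 2) / (2 * (m + 2 : ℂ))) =
      fun m : ℕ => 1 / 2 * (w ^ (m + 2) / ((m + 2 : ℕ) : ℂ)) := by
    funext m
    push_cast
    rw [← div_div, one_div_mul_eq_div, div_right_comm]
  have e2 : -Complex.log (1 - w) - w =
      -Complex.log (1 - w) - (0 + w ^ 0 / ((0 : ℕ) : ℂ) + w ^ 1 / ((1 : ℕ) : ℂ)) := by simp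
  rw [e1, e2]
  exact h3

/-- The exponential moments of a centered chi-square variable. -/
lemma integral_cexp_sq_gaussianReal {v : ℝ} (hv : 0 ≤ v) {z : ℂ} (hz : ‖2 * z * v‖ < 1) :
    ∫ y : ℝ, Complex.exp (z * (y ^ 2 - v)) ∂(gaussianReal 0 v.toNNReal) =
      Complex.exp (1 / 2 * (-Complex.log (1 - 2 * z * v) - 2 * z * v)) := by
  rcases hv.eq_or_lt with rfl | hv
  · simp
  have hv' : v.toNNReal ≠ 0 := by simpa using hv
  rw [integral_gaussianReal_eq_integral_smul hv']
  set b : ℂ := 1 / (2 * v) - z with hb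
  set w : ℂ := 1 - 2 * z * v with hw
  have hvc : (v : ℂ) ≠ 0 := by exact_mod_cast hv.ne'
  have hbw : b = w / (2 * v) := by rw [hb, hw]; field_simp
  have hwre : 0 < w.re := by
    have := (Complex.abs_re_le_norm (2 * z * v)).trans_lt hz
    rw [hw, Complex.sub_re, Complex.one_re]
    linarith [le_abs_self (2 * z * v).re]
  have hw0 : w ≠ 0 := fun h => by rw [h] at hwre; simp at hwre
  have hbre : 0 < b.re := by
    rw [hbw, show w / (2 * (v : ℂ)) = w / ((2 * v : ℝ) : ℂ) by push_cast; rfl,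
      Complex.div_ofReal_re]
    positivity
  have hfun : ∀ y : ℝ, gaussianPDFReal 0 v.toNNReal y • Complex.exp (z * ((y : ℂ) ^ 2 - v)) =
      (((√(2 * Real.pi * v))⁻¹ : ℝ) * Complex.exp (-z * v)) * Complex.exp (-b * (y : ℂ) ^ 2) := by
    intro y
    rw [gaussianPDFReal, Real.coe_toNNReal _ hv.le, Complex.real_smul]
    push_cast
    rw [mul_assoc (_⁻¹), mul_assoc (_⁻¹), ← Complex.exp_add, ← Complex.exp_add, mul_assoc]
    congr 2
    rw [hb]
    field_simp
    ring
  simp_rw [hfun]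
  rw [integral_const_mul, integral_gaussian_complex hbre]
  have hpb : (Real.pi : ℂ) / b = ((2 * Real.pi * v : ℝ) : ℂ) * w⁻¹ := by
    rw [hbw]; push_cast; field_simp
  have hr : 0 < 2 * Real.pi * v := by positivity
  have harg : w.arg ≠ Real.pi := by
    intro h
    have := (Complex.arg_eq_pi_iff.1 h).1
    linarith
  have hcpow : ((Real.pi : ℂ) / b) ^ (1 / 2 : ℂ) =
      (√(2 * Real.pi * v) : ℝ) * Complex.exp (-(1 / 2) * Complex.log w) := by
    rw [hpb, Complex.cpow_def_of_ne_zero (mul_ne_zero (by exact_mod_cast hr.ne')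
      (inv_ne_zero hw0)), Complex.log_ofReal_mul hr (inv_ne_zero hw0), Complex.log_inv _ harg,
      Real.sqrt_eq_rpow, Real.rpow_def_of_pos hr, Complex.ofReal_exp, ← Complex.exp_add]
    congr 1
    push_cast
    ring
  rw [hcpow, mul_mul_mul_comm, ← Complex.ofReal_mul, inv_mul_cancel₀ (Real.sqrt_pos.2 hr).ne',
    Complex.ofReal_one, one_mul, ← Complex.exp_add]
  congr 1
  ring

lemma integral_pow_four_gaussianReal (v : NNReal) :
    ∫ y : ℝ, y ^ 4 ∂(gaussianReal 0 v) = 3 * (v : ℝ) ^ 2 := by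
  have h := iteratedDeriv_mgf_zero (X := id) (μ := gaussianReal 0 v)
    (by rw [integrableExpSet_id_gaussianReal]; simp) 4
  have hder : ∀ (p p' : ℝ → ℝ), (∀ t, HasDerivAt p (p' t) t) →
      deriv (fun t : ℝ => p t * Real.exp (v * t ^ 2 / 2)) =
        fun t => (p' t + p t * (v * t)) * Real.exp (v * t ^ 2 / 2) := by
    intro p p' hp
    ext t
    have h1 : HasDerivAt (fun t : ℝ => (v : ℝ) * t ^ 2 / 2) (v * t) t := by
      exact (((hasDerivAt_pow 2 t).const_mul (v : ℝ)).div_const 2).congr_deriv (by push_cast; ring)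
    rw [((hp t).fun_mul h1.exp).deriv]
    ring
  have h0 : mgf id (gaussianReal 0 v) =
      fun t : ℝ => (fun _ => (1 : ℝ)) t * Real.exp (v * t ^ 2 / 2) := by
    rw [mgf_id_gaussianReal]; ext t; simp
  have hid : ∀ t : ℝ, HasDerivAt (fun t : ℝ => t) 1 t := hasDerivAt_id
  rw [iteratedDeriv_succ', iteratedDeriv_succ', iteratedDeriv_succ', iteratedDeriv_succ',
    iteratedDeriv_zero, h0, hder _ (fun _ => 0) (fun t => hasDerivAt_const t 1)] at h
  simp only [zero_add, one_mul] at h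
  rw [hder (fun t => v * t) (fun _ => v) (fun t => by simpa using (hid t).const_mul (v : ℝ)),
    hder (fun t => v + v * t * (v * t)) (fun t => 2 * v ^ 2 * t) (fun t => by
      exact ((((hid t).const_mul (v : ℝ)).fun_mul ((hid t).const_mul (v : ℝ))).const_add
        (v : ℝ)).congr_deriv (by ring)),
    hder (fun t => 2 * v ^ 2 * t + (v + v * t * (v * t)) * (v * t))
      (fun t => 3 * v ^ 2 + 3 * v ^ 3 * t ^ 2) (fun t => by
      have h1 := (hid t).const_mul (2 * (v : ℝ) ^ 2)
      have h2 := ((((hid t).const_mul (v : ℝ)).fun_mul ((hid t).const_mul (v : ℝ))).const_add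
        (v : ℝ)).fun_mul ((hid t).const_mul (v : ℝ))
      exact (h1.fun_add h2).congr_deriv (by ring))] at h
  simp at h
  rw [← h]

/-- The second Hermite polynomial has mean zero and variance `2 v²` under the Gaussian law. -/
lemma integral_sq_sub_sq_gaussianReal {v : ℝ} (hv : 0 ≤ v) :
    ∫ y : ℝ, (y ^ 2 - v) ^ 2 ∂(gaussianReal 0 v.toNNReal) = 2 * v ^ 2 ∧
    ∫ y : ℝ, (y ^ 2 - v) ∂(gaussianReal 0 v.toNNReal) = 0 ∧
    MemLp (fun y : ℝ => y ^ 2 - v) 2 (gaussianReal 0 v.toNNReal) := by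
  have h4 : Integrable (fun y : ℝ => y ^ 4) (gaussianReal 0 v.toNNReal) := by
    have := (memLp_id_gaussianReal (μ := 0) (v := v.toNNReal) 4).integrable_norm_pow (by norm_num)
    refine this.congr (ae_of_all _ fun y => ?_)
    simp only [id, Real.norm_eq_abs]
    exact (Even.pow_abs (by decide) y)
  have h2 : Integrable (fun y : ℝ => y ^ 2) (gaussianReal 0 v.toNNReal) := by
    have := (memLp_id_gaussianReal (μ := 0) (v := v.toNNReal) 2).integrable_sq
    exact this
  have e2 : ∫ y : ℝ, y ^ 2 ∂(gaussianReal 0 v.toNNReal) = v := by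
    have h := variance_id_gaussianReal (μ := 0) (v := v.toNNReal)
    rw [variance_of_integral_eq_zero (by fun_prop) (by simp)] at h
    rw [Real.coe_toNNReal _ hv] at h
    exact h
  have hexp : ∀ y : ℝ, (y ^ 2 - v) ^ 2 = y ^ 4 - 2 * v * y ^ 2 + v ^ 2 := fun y => by ring
  refine ⟨?_, ?_, ?_⟩
  · simp_rw [hexp]
    rw [integral_add (by exact h4.sub (h2.const_mul _)) (integrable_const _), integral_sub h4
      (h2.const_mul _), integral_const_mul, e2, integral_pow_four_gaussianReal,
      Real.coe_toNNReal _ hv]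
    simp
    ring
  · rw [integral_sub h2 (integrable_const _), e2]; simp
  · rw [memLp_two_iff_integrable_sq (by fun_prop)]
    simp_rw [hexp]
    exact (h4.sub (h2.const_mul _)).add (integrable_const _)

section Quadratic

variable {Ω : Type*} [MeasurableSpace Ω] {P : Measure Ω} {ι : Type*} [Fintype ι] [DecidableEq ι]

lemma trace_pow_eq_sum_eigenvalues {R : Matrix ι ι ℝ} (hR : R.IsHermitian) (m : ℕ) :
    (R ^ m).trace = ∑ k, hR.eigenvalues k ^ m := by
  conv_lhs => rw [hR.spectral_theorem, ← map_pow, Unitary.conjStarAlgAut_apply,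
    Matrix.trace_mul_cycle, Unitary.coe_star_mul_self, one_mul, Matrix.diagonal_pow]
  simp [Matrix.trace]

/-- A centered Gaussian vector is, up to a rotation, a vector of independent centered Gaussian
variables, whose variances are the eigenvalues of the covariance matrix. -/
lemma exists_diagonalization {D : ι → Ω → ℝ} (hG : HasGaussianLaw (fun ω i => D i ω) P)
    (h0 : ∀ i, ∫ ω, D i ω ∂P = 0) {R : Matrix ι ι ℝ} (hR : ∀ i j, R i j = ∫ ω, D i ω * D j ω ∂P) :
    ∃ (lam : ι → ℝ) (Y : ι → Ω → ℝ), (∀ k, 0 ≤ lam k) ∧ iIndepFun Y P ∧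
      (∀ k, AEMeasurable (Y k) P) ∧ (∀ k, P.map (Y k) = gaussianReal 0 (lam k).toNNReal) ∧
      (∀ ω, ∑ k, Y k ω ^ 2 = ∑ i, D i ω ^ 2) ∧ ∀ m, (R ^ m).trace = ∑ k, lam k ^ m := by
  have hherm : R.IsHermitian := by
    ext i j
    simp only [Matrix.conjTranspose_apply, star_trivial, hR]
    simp_rw [mul_comm]
  have hP : IsProbabilityMeasure P := hG.isProbabilityMeasure
  set v := hherm.eigenvectorBasis with hv
  set Y : ι → Ω → ℝ := fun k ω => ∑ i, v k i * D i ω with hY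
  have hL2 : ∀ i, MemLp (D i) 2 P := fun i => (hG.eval i).memLp_two
  have hYG : HasGaussianLaw (fun ω k => Y k ω) P := by
    have := hG.map_fun (LinearMap.toContinuousLinearMap
      (Matrix.mulVecLin (Matrix.of fun k i => v k i)))
    exact this
  have hYL2 : ∀ k, MemLp (Y k) 2 P := fun k => (hYG.eval k).memLp_two
  have hY0 : ∀ k, ∫ ω, Y k ω ∂P = 0 := fun k => by
    simp only [hY]
    rw [integral_finsetSum _ fun i _ => ((hG.eval i).integrable.const_mul (v k i))]
    simp [integral_const_mul, h0]
  have hdot : ∀ k l, ∑ i, v k i * v l i = if k = l then 1 else 0 := by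
    intro k l
    have := orthonormal_iff_ite.1 v.orthonormal l k
    rw [PiLp.inner_apply] at this
    simp only [RCLike.inner_apply, conj_trivial] at this
    rw [this]
    simp [eq_comm]
  have hcov : ∀ k l, ∫ ω, Y k ω * Y l ω ∂P = if k = l then hherm.eigenvalues l else 0 := by
    intro k l
    simp only [hY]
    simp_rw [Finset.sum_mul_sum]
    have hi : ∀ i j, Integrable (fun ω => v k i * D i ω * (v l j * D j ω)) P := fun i j =>
      ((hL2 i).const_mul _).integrable_mul ((hL2 j).const_mul _)
    rw [integral_finsetSum _ fun i _ => integrable_finsetSum _ fun j _ => hi i j]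
    have h1 : ∀ i, ∫ ω, ∑ j, v k i * D i ω * (v l j * D j ω) ∂P =
        v k i * (hherm.eigenvalues l * v l i) := by
      intro i
      rw [integral_finsetSum _ fun j _ => hi i j]
      have h2 := congrFun (hherm.mulVec_eigenvectorBasis l) i
      simp only [Matrix.mulVec, dotProduct, Pi.smul_apply, smul_eq_mul] at h2
      rw [hv, ← h2, Finset.mul_sum]
      refine Finset.sum_congr rfl fun j _ => ?_
      rw [hR, ← hv, show v k i * ((∫ ω, D i ω * D j ω ∂P) * v l j) =
        (v k i * v l j) * ∫ ω, D i ω * D j ω ∂P by ring, ← integral_const_mul]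
      refine integral_congr_ae (ae_of_all _ fun ω => ?_)
      simp only; ring
    simp_rw [h1]
    rw [show ∑ i, v k i * (hherm.eigenvalues l * v l i) =
      hherm.eigenvalues l * ∑ i, v k i * v l i by
        rw [Finset.mul_sum]; exact Finset.sum_congr rfl fun i _ => by ring, hdot]
    split_ifs <;> simp
  have hlam : ∀ k, hherm.eigenvalues k = ∫ ω, Y k ω ^ 2 ∂P := fun k => by
    have := hcov k k
    rw [if_pos rfl] at this
    rw [← this]
    simp_rw [pow_two]
  refine ⟨hherm.eigenvalues, Y, fun k => ?_, ?_, fun k => (hYG.eval k).aemeasurable,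
    fun k => ?_, fun ω => ?_, trace_pow_eq_sum_eigenvalues hherm⟩
  · rw [hlam]; exact integral_nonneg fun ω => sq_nonneg _
  · refine hYG.iIndepFun_of_covariance_eq_zero fun k l hkl => ?_
    rw [covariance_eq_sub (hYL2 k) (hYL2 l), hY0, zero_mul, sub_zero]
    exact (hcov k l).trans (if_neg hkl)
  · rw [(hYG.eval k).map_eq_gaussianReal, hY0,
      variance_of_integral_eq_zero (hYG.eval k).aemeasurable (hY0 k), ← hlam]
  · have h1 := v.sum_sq_norm_inner_right (WithLp.toLp 2 fun i => D i ω)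
    rw [EuclideanSpace.norm_sq_eq] at h1
    simp only [PiLp.inner_apply, RCLike.inner_apply, conj_trivial, Real.norm_eq_abs, sq_abs] at h1
    rw [← h1]
    refine Finset.sum_congr rfl fun k _ => ?_
    simp only [hY]
    congr 1
    exact Finset.sum_congr rfl fun i _ => mul_comm _ _

/-- The power sums of nonnegative numbers with a given sum of squares decrease geometrically. -/
lemma sum_pow_le {ι : Type*} [Fintype ι] {lam : ι → ℝ} (h0 : ∀ k, 0 ≤ lam k) {c : ℝ} (hc : 0 ≤ c)
    (h2 : c ^ 2 * ∑ k, lam k ^ 2 = 1 / 2) :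
    (∀ k, c * lam k ≤ √(1 / 2)) ∧
      ∀ m : ℕ, c ^ (m + 2) * ∑ k, lam k ^ (m + 2) ≤ √(1 / 2) ^ m / 2 := by
  rw [Finset.mul_sum] at h2
  have h1 : ∀ k, c * lam k ≤ √(1 / 2) := fun k => by
    refine Real.le_sqrt_of_sq_le ?_
    rw [← h2, mul_pow]
    exact Finset.single_le_sum (f := fun k => c ^ 2 * lam k ^ 2) (fun i _ => by positivity)
      (Finset.mem_univ k)
  refine ⟨h1, fun m => ?_⟩
  calc c ^ (m + 2) * ∑ k, lam k ^ (m + 2) = ∑ k, (c * lam k) ^ m * (c ^ 2 * lam k ^ 2) := by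
        rw [Finset.mul_sum]; exact Finset.sum_congr rfl fun k _ => by ring
    _ ≤ ∑ k, √(1 / 2) ^ m * (c ^ 2 * lam k ^ 2) := by
        refine Finset.sum_le_sum fun k _ => mul_le_mul_of_nonneg_right
          (pow_le_pow_left₀ (mul_nonneg hc (h0 k)) (h1 k) m) (by positivity)
    _ = √(1 / 2) ^ m / 2 := by rw [← Finset.mul_sum, h2]; ring

/-- The logarithm of the moment generating function of a law of the second chaos whose `m`-th
cumulant is `2^{m-1} (m-1)! p_m` for `m ≥ 2`. -/
def chaosLogMgf (p : ℕ → ℝ) (z : ℂ) : ℂ :=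
  ∑' m : ℕ, (2 * z) ^ (m + 2) * p (m + 2) / (2 * (m + 2 : ℂ))

/-- The moment generating function, the second moment and the power sums of a normalized centered
quadratic form of a Gaussian vector. -/
lemma quadratic_form_law {D : ι → Ω → ℝ} (hG : HasGaussianLaw (fun ω i => D i ω) P)
    (h0 : ∀ i, ∫ ω, D i ω ∂P = 0) {R : Matrix ι ι ℝ} (hR : ∀ i j, R i j = ∫ ω, D i ω * D j ω ∂P) :
    ∫ ω, (∑ i, D i ω ^ 2 - R.trace) ^ 2 ∂P = 2 * (R ^ 2).trace ∧
    ∀ c : ℝ, 0 ≤ c → c ^ 2 * (R ^ 2).trace = 1 / 2 →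
      (∀ m, 0 ≤ c ^ m * (R ^ m).trace) ∧
      (∀ m : ℕ, c ^ (m + 2) * (R ^ (m + 2)).trace ≤ √(1 / 2) ^ m / 2) ∧
      ∀ z : ℂ, ‖z‖ ≤ 1 / 2 →
        ∫ ω, Complex.exp (z * (c * (∑ i, D i ω ^ 2 - R.trace) : ℝ)) ∂P =
          Complex.exp (chaosLogMgf (fun m => c ^ m * (R ^ m).trace) z) := by
  obtain ⟨lam, Y, hlam, hind, hYm, hYlaw, hYsq, htr⟩ := exists_diagonalization hG h0 hR
  have hP : IsProbabilityMeasure P := hG.isProbabilityMeasure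
  have htr1 : R.trace = ∑ k, lam k := by simpa using htr 1
  have hQ : ∀ ω, ∑ i, D i ω ^ 2 - R.trace = ∑ k, (Y k ω ^ 2 - lam k) := fun ω => by
    rw [← hYsq, htr1, Finset.sum_sub_distrib]
  simp_rw [hQ]
  constructor
  · have hmem : ∀ k, MemLp (fun ω => Y k ω ^ 2 - lam k) 2 P := fun k => by
      have := (integral_sq_sub_sq_gaussianReal (hlam k)).2.2
      rw [← hYlaw k] at this
      exact this.comp_of_map (hYm k)
    have hmean : ∀ k, ∫ ω, (Y k ω ^ 2 - lam k) ∂P = 0 := fun k => by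
      have := (integral_sq_sub_sq_gaussianReal (hlam k)).2.1
      rwa [← hYlaw k, integral_map (hYm k) (by fun_prop)] at this
    have hvar : ∀ k, Var[fun ω => Y k ω ^ 2 - lam k; P] = 2 * lam k ^ 2 := fun k => by
      rw [variance_of_integral_eq_zero (hmem k).aestronglyMeasurable.aemeasurable (hmean k),
        ← (integral_sq_sub_sq_gaussianReal (hlam k)).1, ← hYlaw k,
        integral_map (hYm k) (by fun_prop)]
    have hsum0 : ∫ ω, ∑ k, (Y k ω ^ 2 - lam k) ∂P = 0 := by
      rw [integral_finsetSum _ fun k _ => (hmem k).integrable (by norm_num)]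
      simp [hmean]
    have hv := variance_of_integral_eq_zero
      (memLp_finsetSum Finset.univ fun k _ => hmem k).aestronglyMeasurable.aemeasurable hsum0
    rw [← hv]
    have := IndepFun.variance_sum (s := Finset.univ) (X := fun k ω => Y k ω ^ 2 - lam k)
      (fun k _ => hmem k) (fun k _ l _ hkl => (hind.indepFun hkl).comp
        (φ := fun y => y ^ 2 - lam k) (ψ := fun y => y ^ 2 - lam l) (by fun_prop) (by fun_prop))
    have he : (∑ k, fun ω => Y k ω ^ 2 - lam k) = fun ω => ∑ k, (Y k ω ^ 2 - lam k) := by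
      ext ω; simp
    rw [he] at this
    rw [this, htr, Finset.mul_sum]
    exact Finset.sum_congr rfl fun k _ => hvar k
  · intro c hc hc2
    rw [htr] at hc2
    obtain ⟨hle, hpow⟩ := sum_pow_le hlam hc hc2
    refine ⟨fun m => htr m ▸ mul_nonneg (by positivity)
      (Finset.sum_nonneg fun k _ => pow_nonneg (hlam k) m), fun m => by rw [htr]; exact hpow m, ?_⟩
    intro z hz
    have hlt : √(1 / 2) < 1 := by rw [Real.sqrt_lt' one_pos]; norm_num
    have hnorm : ∀ k, ‖2 * (z * c) * lam k‖ < 1 := fun k => by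
      rw [norm_mul, norm_mul, norm_mul, Complex.norm_real, Complex.norm_real,
        Real.norm_of_nonneg hc, Real.norm_of_nonneg (hlam k), Complex.norm_ofNat]
      calc 2 * (‖z‖ * c) * lam k = 2 * ‖z‖ * (c * lam k) := by ring
        _ ≤ 1 * (c * lam k) := by
            gcongr
            · exact mul_nonneg hc (hlam k)
            · linarith
        _ < 1 := by rw [one_mul]; exact (hle k).trans_lt hlt
    have h1 : ∀ ω, Complex.exp (z * (c * ∑ k, (Y k ω ^ 2 - lam k) : ℝ)) =
        ∏ k, Complex.exp ((z * c) * ((Y k ω : ℂ) ^ 2 - lam k)) := fun ω => by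
      rw [← Complex.exp_sum, ← Finset.mul_sum]
      push_cast
      rw [mul_assoc]
    simp_rw [h1]
    rw [hind.integral_fun_prod_comp (X := Y)
      (f := fun (k : ι) (y : ℝ) => Complex.exp ((z * c) * ((y : ℂ) ^ 2 - lam k)))
      hYm (fun k => by fun_prop)]
    have h2 : ∀ k, ∫ ω, Complex.exp ((z * c) * ((Y k ω : ℂ) ^ 2 - lam k)) ∂P =
        Complex.exp (1 / 2 * (-Complex.log (1 - 2 * (z * c) * lam k) - 2 * (z * c) * lam k)) := by
      intro k
      rw [← integral_cexp_sq_gaussianReal (hlam k) (hnorm k), ← hYlaw k,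
        integral_map (hYm k) (by fun_prop)]
    simp_rw [h2]
    rw [← Complex.exp_sum]
    congr 1
    have hs := hasSum_sum fun k (_ : k ∈ Finset.univ) => complex_hasSum_log_sub (hnorm k)
    rw [← hs.tsum_eq, chaosLogMgf]
    refine tsum_congr fun m => ?_
    rw [htr, ← Finset.sum_div]
    congr 1
    push_cast
    rw [Finset.mul_sum, Finset.mul_sum]
    refine Finset.sum_congr rfl fun k _ => ?_
    ring

end Quadratic

/-! ### Second differences of the increment variance -/

/-- The covariance of the increments with indices `i` and `j`, `k = i - j`, on the grid of mesh
`1 / N`. -/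
def incrCov (H t : ℝ) (N : ℕ) (k : ℝ) : ℝ :=
  (incrVar H t (|k + 1| / N) + incrVar H t (|k - 1| / N) - 2 * incrVar H t (|k| / N)) / 2

lemma limitKernel_of_pos {H t x : ℝ} (hx : 0 < x) : limitKernel H t x =
    k₁ t * (H * (2 * H - 1)) * x ^ (2 * H - 2) + k₂ H * (H * (2 * H + 1)) * x ^ (2 * H - 1) := by
  rw [limitKernel, abs_of_pos hx]

lemma limitKernel_neg (H t x : ℝ) : limitKernel H t (-x) = limitKernel H t x := by
  simp [limitKernel]

lemma limitKernel_abs (H t x : ℝ) : limitKernel H t |x| = limitKernel H t x := by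
  simp [limitKernel]

/-- A second difference is a second derivative at an intermediate point. -/
lemma exists_second_difference {f f' f'' : ℝ → ℝ} {a δ : ℝ} (hδ : 0 < δ) (ha : δ < a)
    (hf : ∀ x, 0 < x → HasDerivAt f (f' x) x) (hf' : ∀ x, 0 < x → HasDerivAt f' (f'' x) x) :
    ∃ ξ ∈ Set.Ioo (a - δ) (a + δ), f (a + δ) + f (a - δ) - 2 * f a = δ ^ 2 * f'' ξ := by
  have hg : ∀ x, 0 < x → HasDerivAt (fun x => f (x + δ) - f x) (f' (x + δ) - f' x) x := fun x hx =>
    ((hf (x + δ) (by linarith)).comp_add_const x δ).sub (hf x hx)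
  obtain ⟨η, hη, h1⟩ := exists_hasDerivAt_eq_slope (fun x => f (x + δ) - f x)
    (fun x => f' (x + δ) - f' x) (by linarith : a - δ < a)
    (fun x hx => (hg x (by linarith [hx.1])).continuousAt.continuousWithinAt)
    (fun x hx => hg x (by linarith [hx.1]))
  have hη0 : 0 < η := by linarith [hη.1]
  obtain ⟨ξ, hξ, h2⟩ := exists_hasDerivAt_eq_slope f' f'' (by linarith : η < η + δ)
    (fun x hx => (hf' x (by linarith [hx.1])).continuousAt.continuousWithinAt)
    (fun x hx => hf' x (by linarith [hx.1]))
  refine ⟨ξ, ⟨by linarith [hη.1, hξ.1], by linarith [hη.2, hξ.2]⟩, ?_⟩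
  have e1 : a - (a - δ) = δ := by ring
  have e2 : η + δ - η = δ := by ring
  rw [e1, eq_div_iff hδ.ne', sub_add_cancel] at h1
  rw [e2, eq_div_iff hδ.ne'] at h2
  rw [pow_two, mul_assoc, mul_comm δ (f'' ξ), h2]
  linarith

/-- The kernel of the limit is half of the second derivative of the increment variance. -/
lemma exists_incrVar_second_difference {H t a δ : ℝ} (hδ : 0 < δ) (ha : δ < a) :
    ∃ ξ ∈ Set.Ioo (a - δ) (a + δ),
      incrVar H t (a + δ) + incrVar H t (a - δ) - 2 * incrVar H t a =
        δ ^ 2 * (2 * limitKernel H t ξ) := by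
  obtain ⟨ξ, hξ, h⟩ := exists_second_difference (f := incrVar H t)
    (f' := fun x => k₁ t * (2 * H * x ^ (2 * H - 1)) + k₂ H * ((2 * H + 1) * x ^ (2 * H)))
    (f'' := fun x => k₁ t * (2 * H * ((2 * H - 1) * x ^ (2 * H - 2)))
      + k₂ H * ((2 * H + 1) * (2 * H * x ^ (2 * H - 1)))) hδ ha
    (fun x hx => by
      have h1 := (Real.hasDerivAt_rpow_const (p := 2 * H) (Or.inl hx.ne')).const_mul (k₁ t)
      have h2 := (Real.hasDerivAt_rpow_const (p := 2 * H + 1) (Or.inl hx.ne')).const_mul (k₂ H)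
      rw [add_sub_cancel_right] at h2
      exact h1.add h2)
    (fun x hx => by
      have h1 := ((Real.hasDerivAt_rpow_const (p := 2 * H - 1) (Or.inl hx.ne')).const_mul
        (2 * H)).const_mul (k₁ t)
      have h2 := ((Real.hasDerivAt_rpow_const (p := 2 * H) (Or.inl hx.ne')).const_mul
        (2 * H + 1)).const_mul (k₂ H)
      rw [show 2 * H - 1 - 1 = 2 * H - 2 by ring] at h1
      exact h1.add h2)
  refine ⟨ξ, hξ, ?_⟩
  have hξ0 : 0 < ξ := by linarith [hξ.1]
  rw [h, limitKernel_of_pos hξ0]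
  ring

/-- The constant in the domination of the kernel by a Riesz kernel. -/
def kernelConst (H t : ℝ) : ℝ := |k₁ t * (H * (2 * H - 1))| + |k₂ H * (H * (2 * H + 1))|

lemma abs_limitKernel_le {H t x : ℝ} (hx : x ≠ 0) (hx1 : |x| ≤ 1) :
    |limitKernel H t x| ≤ kernelConst H t * |x| ^ (2 * H - 2) := by
  have h0 : 0 < |x| := abs_pos.2 hx
  have h1 : |x| ^ (2 * H - 1) ≤ |x| ^ (2 * H - 2) :=
    Real.rpow_le_rpow_of_exponent_ge h0 hx1 (by linarith)
  rw [limitKernel, kernelConst, add_mul]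
  refine (abs_add_le _ _).trans (add_le_add ?_ ?_)
  · rw [abs_mul, abs_of_nonneg (by positivity : 0 ≤ |x| ^ (2 * H - 2))]
  · rw [abs_mul, abs_of_nonneg (by positivity : 0 ≤ |x| ^ (2 * H - 1))]
    gcongr

/-- Away from the diagonal, the covariance of two increments is a value of the kernel. -/
lemma exists_incrCov_eq {H t : ℝ} {N : ℕ} (hN : 1 ≤ N) {k : ℝ} (hk : 2 ≤ |k|) :
    ∃ ξ ∈ Set.Ioo ((|k| - 1) / N) ((|k| + 1) / N), (N : ℝ) ^ 2 * incrCov H t N k =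
      limitKernel H t ξ := by
  have hN0 : (0 : ℝ) < N := by exact_mod_cast hN
  have heven : incrCov H t N k = incrCov H t N |k| := by
    rcases abs_choice k with h | h
    · rw [h]
    · rw [h, incrCov, incrCov, abs_neg, ← abs_neg (-k + 1), ← abs_neg (-k - 1),
        show -(-k + 1) = k - 1 by ring, show -(-k - 1) = k + 1 by ring]
      ring
  obtain ⟨ξ, hξ, h⟩ := exists_incrVar_second_difference (H := H) (t := t) (a := |k| / N)
    (δ := 1 / N) (by positivity) (by gcongr; linarith)
  rw [← add_div, ← sub_div] at hξ h
  refine ⟨ξ, hξ, ?_⟩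
  rw [heven, incrCov, abs_of_nonneg (by linarith : 0 ≤ |k| + 1),
    abs_of_nonneg (by linarith : 0 ≤ |k| - 1), abs_abs, h]
  field_simp

/-- The index of the grid cell of mesh `1 / N` which contains a point of `[0, 1]`. -/
def cellIndex (N : ℕ) (x : ℝ) : ℕ := min ⌊N * x⌋₊ (N - 1)

lemma cellIndex_lt {N : ℕ} (hN : 1 ≤ N) (x : ℝ) : cellIndex N x < N :=
  (min_le_right _ _).trans_lt (by omega)

lemma measurable_cellIndex (N : ℕ) : Measurable (cellIndex N) := by
  unfold cellIndex
  fun_prop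

lemma cellIndex_bounds {N : ℕ} (hN : 1 ≤ N) {x : ℝ} (hx : x ∈ Set.Icc (0 : ℝ) 1) :
    (cellIndex N x : ℝ) ≤ N * x ∧ N * x ≤ cellIndex N x + 1 := by
  have hN0 : (0 : ℝ) < N := by exact_mod_cast hN
  have h0 : 0 ≤ N * x := mul_nonneg hN0.le hx.1
  have h1 : N * x ≤ N := by nlinarith [hx.2]
  constructor
  · exact (Nat.cast_le.2 (min_le_left _ _)).trans (Nat.floor_le h0)
  · rcases le_total ⌊N * x⌋₊ (N - 1) with h | h
    · rw [cellIndex, min_eq_left h]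
      exact (Nat.lt_floor_add_one _).le
    · rw [cellIndex, min_eq_right h, Nat.cast_sub hN]
      simpa using h1

/-- The step kernel of the covariance matrix of the increments. -/
def stepKernel (H t : ℝ) (N : ℕ) (x y : ℝ) : ℝ :=
  (N : ℝ) ^ 2 * incrCov H t N ((cellIndex N x : ℝ) - cellIndex N y)

lemma cellIndex_sub_bounds {N : ℕ} (hN : 1 ≤ N) {x y : ℝ} (hx : x ∈ Set.Icc (0 : ℝ) 1)
    (hy : y ∈ Set.Icc (0 : ℝ) 1) :
    |((cellIndex N x : ℝ) - cellIndex N y) - N * (x - y)| ≤ 1 ∧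
      |(cellIndex N x : ℝ) - cellIndex N y| ≤ N - 1 := by
  obtain ⟨a1, a2⟩ := cellIndex_bounds hN hx
  obtain ⟨b1, b2⟩ := cellIndex_bounds hN hy
  have c1 : (cellIndex N x : ℝ) ≤ N - 1 := by
    have := cellIndex_lt hN x
    have h : cellIndex N x + 1 ≤ N := this
    have : (cellIndex N x : ℝ) + 1 ≤ N := by exact_mod_cast h
    linarith
  have c2 : (cellIndex N y : ℝ) ≤ N - 1 := by
    have := cellIndex_lt hN y
    have h : cellIndex N y + 1 ≤ N := this
    have : (cellIndex N y : ℝ) + 1 ≤ N := by exact_mod_cast h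
    linarith
  have d1 : (0 : ℝ) ≤ cellIndex N x := Nat.cast_nonneg _
  have d2 : (0 : ℝ) ≤ cellIndex N y := Nat.cast_nonneg _
  constructor <;> rw [abs_le] <;> constructor <;> nlinarith

lemma abs_incrVar_le {H t h : ℝ} (hH : 0 < H) (h0 : 0 ≤ h) :
    |incrVar H t h| ≤ (|k₁ t| + |k₂ H| * h) * h ^ (2 * H) := by
  rcases h0.eq_or_lt with rfl | h0
  · rw [incrVar, Real.zero_rpow (by positivity), Real.zero_rpow (by positivity)]; simp
  · rw [incrVar, Real.rpow_add h0, Real.rpow_one]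
    have hp : 0 ≤ h ^ (2 * H) := by positivity
    calc |k₁ t * h ^ (2 * H) + k₂ H * (h ^ (2 * H) * h)|
        ≤ |k₁ t * h ^ (2 * H)| + |k₂ H * (h ^ (2 * H) * h)| := abs_add_le _ _
      _ = _ := by
        rw [abs_mul, abs_mul, abs_mul, abs_of_nonneg hp, abs_of_pos h0]; ring

/-- The step kernels are dominated by a Riesz kernel, uniformly in the mesh. -/
lemma exists_abs_stepKernel_le {H t : ℝ} (hH : 3 / 4 < H) (hH1 : H < 1) :
    ∃ C, 0 ≤ C ∧ ∀ N : ℕ, 1 ≤ N → ∀ x ∈ Set.Icc (0 : ℝ) 1, ∀ y ∈ Set.Icc (0 : ℝ) 1, x ≠ y →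
      |stepKernel H t N x y| ≤ C * |x - y| ^ (2 * H - 2) := by
  set p := 2 * H - 2 with hp
  have hp0 : p ≤ 0 := by linarith
  set A := kernelConst H t with hA
  have hA0 : 0 ≤ A := by rw [hA, kernelConst]; positivity
  set B := |k₁ t| + |k₂ H| * 3 with hB
  have hB0 : 0 ≤ B := by positivity
  refine ⟨A * (1 / 3) ^ p + 2 * B * 2 ^ (2 * H) * (1 / 2) ^ p, by positivity,
    fun N hN x hx y hy hxy => ?_⟩
  have hN0 : (0 : ℝ) < N := by exact_mod_cast hN
  have hN1 : (1 : ℝ) ≤ N := by exact_mod_cast hN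
  obtain ⟨hb1, hb2⟩ := cellIndex_sub_bounds hN hx hy
  set k : ℝ := (cellIndex N x : ℝ) - cellIndex N y with hk
  have hd : 0 < |x - y| := abs_pos.2 (sub_ne_zero.2 hxy)
  have hkd : N * |x - y| ≤ |k| + 1 ∧ |k| - 1 ≤ N * |x - y| := by
    have h1 := abs_sub_abs_le_abs_sub k (N * (x - y))
    have h2 := abs_sub_abs_le_abs_sub (N * (x - y)) k
    rw [abs_sub_comm (N * (x - y)) k] at h2
    rw [abs_mul, abs_of_pos hN0] at h1 h2
    constructor <;> linarith
  have hdp : 0 ≤ |x - y| ^ p := by positivity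
  rw [stepKernel, ← hk, add_mul]
  by_cases hk2 : 2 ≤ |k|
  · obtain ⟨ξ, hξ, h⟩ := exists_incrCov_eq (H := H) (t := t) hN hk2
    have hξ0 : 0 < ξ := lt_trans (by apply div_pos _ hN0; linarith) hξ.1
    have hξ1 : ξ ≤ 1 := hξ.2.le.trans (by rw [div_le_one hN0]; linarith)
    have hξd : 1 / 3 * |x - y| ≤ ξ := by
      refine le_trans ?_ hξ.1.le
      rw [le_div_iff₀ hN0]
      nlinarith [hkd.1]
    rw [h]
    calc |limitKernel H t ξ| ≤ A * |ξ| ^ p :=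
          abs_limitKernel_le hξ0.ne' (by rwa [abs_of_pos hξ0])
      _ = A * ξ ^ p := by rw [abs_of_pos hξ0]
      _ ≤ A * (1 / 3 * |x - y|) ^ p := by
          exact mul_le_mul_of_nonneg_left
            (Real.rpow_le_rpow_of_nonpos (by positivity) hξd hp0) hA0
      _ = A * (1 / 3) ^ p * |x - y| ^ p := by rw [Real.mul_rpow (by norm_num) hd.le]; ring
      _ ≤ _ := le_add_of_nonneg_right (by positivity)
  · push Not at hk2
    have hint : ∃ n : ℕ, |k| = n := by
      refine ⟨((cellIndex N x : ℤ) - cellIndex N y).natAbs, ?_⟩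
      rw [Nat.cast_natAbs, hk]
      push_cast
      rfl
    have hk1 : |k| ≤ 1 := by
      obtain ⟨n, hn⟩ := hint
      rw [hn] at hk2 ⊢
      have : n < 2 := by exact_mod_cast hk2
      exact_mod_cast (by omega : n ≤ 1)
    have hQ : ∀ l : ℝ, 0 ≤ l → l ≤ 2 →
        |incrVar H t (l / N)| ≤ B * 2 ^ (2 * H) * (1 / N) ^ (2 * H) := by
      intro l hl0 hl2
      refine (abs_incrVar_le (by linarith) (by positivity)).trans ?_
      rw [mul_assoc, ← Real.mul_rpow (by norm_num) (by positivity)]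
      have h1 : l / N ≤ 2 * (1 / N) := by
        rw [div_le_iff₀ hN0, mul_assoc, one_div, inv_mul_cancel₀ hN0.ne', mul_one]; exact hl2
      have h2 : l / N ≤ 3 := by
        rw [div_le_iff₀ hN0]; nlinarith
      have h3 : |k₁ t| + |k₂ H| * (l / N) ≤ B := by
        rw [hB]; gcongr
      refine mul_le_mul h3 ?_ (by positivity) hB0
      exact Real.rpow_le_rpow (by positivity) h1 (by linarith)
    have hk3 := abs_le.1 hk1
    have q1 := hQ |k + 1| (abs_nonneg _) (by rw [abs_le]; constructor <;> linarith)
    have q2 := hQ |k - 1| (abs_nonneg _) (by rw [abs_le]; constructor <;> linarith)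
    have q3 := hQ |k| (abs_nonneg _) (by linarith)
    have hcov : |incrCov H t N k| ≤ 2 * (B * 2 ^ (2 * H) * (1 / N) ^ (2 * H)) := by
      rw [incrCov, abs_le]
      rw [abs_le] at q1 q2 q3
      constructor <;> linarith
    have hNp : (N : ℝ) ^ 2 * (1 / N) ^ (2 * H) = (1 / N) ^ p := by
      rw [hp, Real.rpow_sub (by positivity), Real.rpow_two]
      field_simp
    have hdN : 1 / 2 * |x - y| ≤ 1 / N := by
      rw [le_div_iff₀ hN0]; linarith [hkd.1]
    rw [abs_mul, abs_of_nonneg (by positivity : (0 : ℝ) ≤ (N : ℝ) ^ 2)]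
    calc (N : ℝ) ^ 2 * |incrCov H t N k| ≤ N ^ 2 * (2 * (B * 2 ^ (2 * H) * (1 / N) ^ (2 * H))) := by
          gcongr
      _ = 2 * B * 2 ^ (2 * H) * (1 / N) ^ p := by rw [← hNp]; ring
      _ ≤ 2 * B * 2 ^ (2 * H) * (1 / 2 * |x - y|) ^ p := by
          gcongr 2 * B * 2 ^ (2 * H) * ?_
          exact Real.rpow_le_rpow_of_nonpos (by positivity) hdN hp0
      _ = 2 * B * 2 ^ (2 * H) * (1 / 2) ^ p * |x - y| ^ p := by
          rw [Real.mul_rpow (by norm_num) hd.le]; ring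
      _ ≤ _ := le_add_of_nonneg_left (by positivity)

lemma continuousAt_limitKernel {H t x : ℝ} (hx : x ≠ 0) : ContinuousAt (limitKernel H t) x := by
  unfold limitKernel
  have h : ContinuousAt (fun x : ℝ => |x|) x := continuous_abs.continuousAt
  have h0 : |x| ≠ 0 := abs_ne_zero.2 hx
  exact ((h.rpow_const (Or.inl h0)).const_mul _).add ((h.rpow_const (Or.inl h0)).const_mul _)

/-- The step kernels converge to the kernel of the limit off the diagonal. -/
lemma tendsto_stepKernel {H t x y : ℝ} (hx : x ∈ Set.Icc (0 : ℝ) 1)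
    (hy : y ∈ Set.Icc (0 : ℝ) 1) (hxy : x ≠ y) :
    Tendsto (fun N : ℕ => stepKernel H t N x y) atTop (𝓝 (limitKernel H t (x - y))) := by
  have hd : 0 < |x - y| := abs_pos.2 (sub_ne_zero.2 hxy)
  have hev : ∀ᶠ N : ℕ in atTop, ∃ ξ : ℝ, |ξ - (|x - y|)| ≤ 2 / N ∧
      stepKernel H t N x y = limitKernel H t ξ := by
    have h1 : ∀ᶠ N : ℕ in atTop, 3 / |x - y| ≤ N :=
      tendsto_natCast_atTop_atTop.eventually_ge_atTop _
    filter_upwards [h1, eventually_ge_atTop 1] with N hN3 hN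
    have hN0 : (0 : ℝ) < N := by exact_mod_cast hN
    rw [div_le_iff₀ hd] at hN3
    obtain ⟨hb1, -⟩ := cellIndex_sub_bounds hN hx hy
    set k : ℝ := (cellIndex N x : ℝ) - cellIndex N y with hk
    have hkd : N * |x - y| ≤ |k| + 1 ∧ |k| - 1 ≤ N * |x - y| := by
      have h1 := abs_sub_abs_le_abs_sub k (N * (x - y))
      have h2 := abs_sub_abs_le_abs_sub (N * (x - y)) k
      rw [abs_sub_comm (N * (x - y)) k] at h2
      rw [abs_mul, abs_of_pos hN0] at h1 h2
      constructor <;> linarith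
    obtain ⟨ξ, hξ, h⟩ := exists_incrCov_eq (H := H) (t := t) hN (k := k) (by linarith)
    refine ⟨ξ, ?_, by rw [stepKernel, ← hk, h]⟩
    have h4 := hξ.1
    have h5 := hξ.2
    rw [div_lt_iff₀ hN0] at h4
    rw [lt_div_iff₀ hN0] at h5
    rw [abs_le, ← neg_div, div_le_iff₀ hN0, le_div_iff₀ hN0]
    constructor <;> nlinarith
  rw [← limitKernel_abs]
  have hc := continuousAt_limitKernel (H := H) (t := t) hd.ne'
  obtain ⟨M, hM⟩ := eventually_atTop.1 hev
  choose! ξ hξ using hM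
  have hlim : Tendsto ξ atTop (𝓝 |x - y|) := by
    rw [tendsto_iff_dist_tendsto_zero]
    refine squeeze_zero' (Eventually.of_forall fun _ => dist_nonneg) ?_
      (tendsto_const_div_atTop_nhds_zero_nat 2)
    filter_upwards [eventually_ge_atTop M] with N hN
    rw [Real.dist_eq]
    exact (hξ N hN).1
  refine (hc.tendsto.comp hlim).congr' ?_
  filter_upwards [eventually_ge_atTop M] with N hN
  exact (hξ N hN).2.symm

/-! ### Traces of powers as cyclic sums and cyclic integrals -/

/-- A cyclic product is a product along a path, times the closing factor. -/
lemma prod_finRotate {α M : Type*} [CommMonoid M] (f : α → α → M) (n : ℕ) (x : Fin (n + 1) → α) :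
    ∏ j, f (x j) (x (finRotate (n + 1) j)) =
      (∏ j : Fin n, f (x j.castSucc) (x j.succ)) * f (x (Fin.last n)) (x 0) := by
  rw [Fin.prod_univ_castSucc]
  congr 1
  · refine Finset.prod_congr rfl fun j _ => ?_
    rw [finRotate_apply, Fin.coeSucc_eq_succ]
  · rw [finRotate_apply, Fin.last_add_one]

lemma prod_path_cons {α M : Type*} [CommMonoid M] (f : α → α → M) (n : ℕ) (a : α)
    (y : Fin (n + 1) → α) :
    ∏ j : Fin (n + 1), f ((Fin.cons a y : Fin (n + 2) → α) j.castSucc)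
        ((Fin.cons a y : Fin (n + 2) → α) j.succ) =
      f a (y 0) * ∏ j : Fin n, f (y j.castSucc) (y j.succ) := by
  rw [Fin.prod_univ_succ]
  congr 1

lemma sum_fin_succ_fun {α M : Type*} [Fintype α] [AddCommMonoid M] (n : ℕ)
    (F : (Fin (n + 1) → α) → M) :
    ∑ x, F x = ∑ a, ∑ y : Fin n → α, F (Fin.cons a y) := by
  rw [← Fintype.sum_prod_type']
  exact (Fintype.sum_equiv (Fin.consEquiv fun _ => α) (fun p => F (Fin.cons p.1 p.2)) F
    fun p => rfl).symm

lemma sum_path_eq_pow_mulVec {ι : Type*} [Fintype ι] [DecidableEq ι] (f : ι → ι → ℝ)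
    (g : ι → ℝ) (n : ℕ) (a : ι) :
    ∑ y : Fin n → ι, (∏ j : Fin n, f ((Fin.cons a y : Fin (n + 1) → ι) j.castSucc)
        ((Fin.cons a y : Fin (n + 1) → ι) j.succ)) *
      g ((Fin.cons a y : Fin (n + 1) → ι) (Fin.last n)) = ((Matrix.of f ^ n).mulVec g) a := by
  induction n generalizing a with
  | zero => simp
  | succ n ih =>
    rw [sum_fin_succ_fun, pow_succ', ← Matrix.mulVec_mulVec, Matrix.mulVec, dotProduct]
    refine Finset.sum_congr rfl fun b _ => ?_
    rw [← ih b, Finset.mul_sum]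
    refine Finset.sum_congr rfl fun y _ => ?_
    rw [prod_path_cons, mul_assoc, ← Fin.succ_last, Fin.cons_succ, Fin.cons_zero, Matrix.of_apply]

/-- The trace of a power of a matrix is a cyclic sum. -/
lemma trace_pow_eq_sum_cyclic {ι : Type*} [Fintype ι] [DecidableEq ι] (f : ι → ι → ℝ) (n : ℕ) :
    (Matrix.of f ^ (n + 1)).trace =
      ∑ x : Fin (n + 1) → ι, ∏ j, f (x j) (x (finRotate (n + 1) j)) := by
  rw [sum_fin_succ_fun, Matrix.trace]
  refine Finset.sum_congr rfl fun a _ => ?_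
  rw [Matrix.diag_apply, pow_succ, Matrix.mul_apply]
  refine (sum_path_eq_pow_mulVec f (fun b => f b a) n a).symm.trans ?_
  exact Finset.sum_congr rfl fun y _ => (prod_finRotate f n (Fin.cons a y)).symm

lemma restrict_unitCube (m : ℕ) : (volume : Measure (Fin m → ℝ)).restrict (unitCube m) =
    Measure.pi fun _ => (volume : Measure ℝ).restrict (Set.Icc 0 1) := by
  rw [unitCube, ← Set.pi_univ_Icc, volume_pi, Measure.restrict_pi_pi]
  rfl

lemma lintegral_pi_succ {α : Type*} [MeasurableSpace α] (μ : Measure α) [SigmaFinite μ] (n : ℕ)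
    {F : (Fin (n + 1) → α) → ENNReal} (hF : Measurable F) :
    ∫⁻ x, F x ∂(Measure.pi fun _ => μ) =
      ∫⁻ y, ∫⁻ a, F (Fin.cons a y) ∂μ ∂(Measure.pi fun _ : Fin n => μ) := by
  have h := (measurePreserving_piFinSuccAbove (fun _ : Fin (n + 1) => μ) 0).symm
  rw [← h.lintegral_comp hF, lintegral_prod_symm]
  swap
  · exact (hF.comp h.measurable).aemeasurable
  refine lintegral_congr fun y => lintegral_congr fun a => ?_
  simp [MeasurableEquiv.piFinSuccAbove, Fin.insertNthEquiv, Fin.insertNth_zero']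

/-- Integrating the vertices of a path one after the other. -/
lemma lintegral_path_le {α : Type*} [MeasurableSpace α] (μ : Measure α) [IsProbabilityMeasure μ]
    {G : α → α → ENNReal} (hG : Measurable fun p : α × α => G p.1 p.2) {B : ENNReal}
    (hB : ∀ y, ∫⁻ x, G x y ∂μ ≤ B) (n : ℕ) :
    ∫⁻ y, ∏ j : Fin n, G (y j.castSucc) (y j.succ) ∂(Measure.pi fun _ : Fin (n + 1) => μ)
      ≤ B ^ n := by
  have hGm : ∀ {m : ℕ} (i j : Fin m), Measurable fun x : Fin m → α => G (x i) (x j) :=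
    fun i j => hG.comp (f := fun x : Fin _ → α => (x i, x j))
      ((measurable_pi_apply i).prodMk (measurable_pi_apply j))
  induction n with
  | zero => simp
  | succ n ih =>
    rw [lintegral_pi_succ μ _ (Finset.measurable_fun_prod _ fun j _ => hGm _ _)]
    calc _ = ∫⁻ y, (∫⁻ a, G a (y 0) ∂μ) * ∏ j : Fin n, G (y j.castSucc) (y j.succ)
          ∂(Measure.pi fun _ : Fin (n + 1) => μ) := by
          refine lintegral_congr fun y => ?_
          simp_rw [prod_path_cons]
          rw [lintegral_mul_const _ (by exact hG.comp (measurable_id.prodMk measurable_const))]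
      _ ≤ ∫⁻ y, B * ∏ j : Fin n, G (y j.castSucc) (y j.succ)
          ∂(Measure.pi fun _ : Fin (n + 1) => μ) :=
          lintegral_mono fun y => mul_le_mul_left (hB _) _
      _ ≤ B ^ (n + 1) := by
          rw [lintegral_const_mul _ (Finset.measurable_fun_prod _ fun j _ => hGm _ _), pow_succ']
          gcongr

/-- The closing edge and the first edge of a cycle are integrated together. -/
lemma lintegral_cyclic_le {α : Type*} [MeasurableSpace α] (μ : Measure α) [IsProbabilityMeasure μ]
    {G : α → α → ENNReal} (hG : Measurable fun p : α × α => G p.1 p.2) {A B : ENNReal}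
    (hA : ∀ y z, ∫⁻ x, G x y * G z x ∂μ ≤ A) (hB : ∀ y, ∫⁻ x, G x y ∂μ ≤ B) (n : ℕ) :
    ∫⁻ x, ∏ j, G (x j) (x (finRotate (n + 2) j)) ∂(Measure.pi fun _ : Fin (n + 2) => μ)
      ≤ A * B ^ n := by
  have hGm : ∀ {m : ℕ} (i j : Fin m), Measurable fun x : Fin m → α => G (x i) (x j) :=
    fun i j => hG.comp (f := fun x : Fin _ → α => (x i, x j))
      ((measurable_pi_apply i).prodMk (measurable_pi_apply j))
  rw [lintegral_pi_succ μ _ (Finset.measurable_fun_prod _ fun j _ => hGm _ _)]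
  calc _ = ∫⁻ y, (∫⁻ a, G a (y 0) * G (y (Fin.last n)) a ∂μ) *
          ∏ j : Fin n, G (y j.castSucc) (y j.succ) ∂(Measure.pi fun _ : Fin (n + 1) => μ) := by
        refine lintegral_congr fun y => ?_
        simp_rw [prod_finRotate, prod_path_cons]
        rw [← lintegral_mul_const _ (by
          exact (hG.comp (measurable_id.prodMk measurable_const)).mul
            (hG.comp (measurable_const.prodMk measurable_id)))]
        refine lintegral_congr fun a => ?_
        rw [← Fin.succ_last, Fin.cons_succ, Fin.cons_zero]
        ring
    _ ≤ ∫⁻ y, A * ∏ j : Fin n, G (y j.castSucc) (y j.succ)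
          ∂(Measure.pi fun _ : Fin (n + 1) => μ) :=
        lintegral_mono fun y => mul_le_mul_left (hA _ _) _
    _ ≤ A * B ^ n := by
        rw [lintegral_const_mul _ (Finset.measurable_fun_prod _ fun j _ => hGm _ _)]
        gcongr
        exact lintegral_path_le μ hG hB n

/-- The mass of a Riesz kernel on the unit interval is bounded uniformly in its pole. -/
lemma exists_integral_abs_sub_rpow_le {p : ℝ} (hp : -1 < p) : ∃ A : ℝ, 0 ≤ A ∧
    ∀ y ∈ Set.Icc (0 : ℝ) 1, IntegrableOn (fun x => |x - y| ^ p) (Set.Icc 0 1) ∧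
      ∫ x in Set.Icc (0 : ℝ) 1, |x - y| ^ p ≤ A := by
  have hint : ∀ y : ℝ, IntegrableOn (fun x => |x - y| ^ p) (Set.Icc (-1 + y) (1 + y)) := fun y => by
    have h := (measurePreserving_sub_right volume y).integrableOn_comp_preimage
      (Homeomorph.subRight y).measurableEmbedding (f := fun x => |x| ^ p) (s := Set.Icc (-1) 1)
    rw [Set.preimage_sub_const_Icc] at h
    exact h.2 (integrableOn_abs_rpow hp 1)
  refine ⟨∫ x in Set.Icc (-1 : ℝ) 1, |x| ^ p, integral_nonneg fun x => by positivity,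
    fun y hy => ?_⟩
  have hsub : Set.Icc (0 : ℝ) 1 ⊆ Set.Icc (-1 + y) (1 + y) :=
    Set.Icc_subset_Icc (by linarith [hy.2]) (by linarith [hy.1])
  refine ⟨(hint y).mono_set hsub, ?_⟩
  have h := (measurePreserving_sub_right volume y).setIntegral_preimage_emb
      (Homeomorph.subRight y).measurableEmbedding (fun x => |x| ^ p) (Set.Icc (-1) 1)
  rw [Set.preimage_sub_const_Icc] at h
  rw [← h]
  exact setIntegral_mono_set (hint y) (ae_of_all _ fun x => by positivity)
    (LE.le.eventuallyLE hsub)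

/-- Cyclic products of square integrable Riesz kernels are integrable. -/
lemma integrable_cyclic_rpow {p : ℝ} (hp : -1 < 2 * p) (n : ℕ) :
    IntegrableOn (fun x : Fin (n + 2) → ℝ => ∏ j, |x j - x (finRotate (n + 2) j)| ^ p)
      (unitCube (n + 2)) := by
  set μ := (volume : Measure ℝ).restrict (Set.Icc 0 1) with hμ
  have hμ1 : IsProbabilityMeasure μ := ⟨by simp [hμ]⟩
  obtain ⟨A, hA0, hA⟩ := exists_integral_abs_sub_rpow_le hp
  obtain ⟨B, hB0, hB⟩ := exists_integral_abs_sub_rpow_le (by linarith : -1 < p)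
  -- the kernel is cut off outside of the unit interval, so that its bounds are uniform
  classical
  set G : ℝ → ℝ → ENNReal := fun x y =>
    if x ∈ Set.Icc (0 : ℝ) 1 ∧ y ∈ Set.Icc (0 : ℝ) 1 then ENNReal.ofReal (|x - y| ^ p) else 0
    with hG
  have hGm : Measurable fun q : ℝ × ℝ => G q.1 q.2 := by
    refine Measurable.ite ?_ (by fun_prop) measurable_const
    exact (measurableSet_Icc.preimage measurable_fst).inter
      (measurableSet_Icc.preimage measurable_snd)
  have hsq : ∀ y, ∫⁻ x, G x y ^ 2 ∂μ ≤ ENNReal.ofReal A := by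
    intro y
    by_cases hy : y ∈ Set.Icc (0 : ℝ) 1
    · calc ∫⁻ x, G x y ^ 2 ∂μ ≤ ∫⁻ x, ENNReal.ofReal (|x - y| ^ (2 * p)) ∂μ := by
            refine lintegral_mono fun x => ?_
            simp only [hG]
            split_ifs
            · rw [← ENNReal.ofReal_pow (by positivity), ← Real.rpow_natCast,
                ← Real.rpow_mul (abs_nonneg _), mul_comm p]
              norm_num
            · simp
        _ = ENNReal.ofReal (∫ x, |x - y| ^ (2 * p) ∂μ) :=
            (ofReal_integral_eq_lintegral_ofReal (hA y hy).1
              (ae_of_all _ fun x => by positivity)).symm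
        _ ≤ _ := ENNReal.ofReal_le_ofReal (hA y hy).2
    · simp [hG, -Set.mem_Icc, hy]
  have hGB : ∀ y, ∫⁻ x, G x y ∂μ ≤ ENNReal.ofReal B := by
    intro y
    by_cases hy : y ∈ Set.Icc (0 : ℝ) 1
    · calc ∫⁻ x, G x y ∂μ ≤ ∫⁻ x, ENNReal.ofReal (|x - y| ^ p) ∂μ := by
            refine lintegral_mono fun x => ?_
            simp only [hG]
            split_ifs <;> simp
        _ = ENNReal.ofReal (∫ x, |x - y| ^ p ∂μ) :=
            (ofReal_integral_eq_lintegral_ofReal (hB y hy).1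
              (ae_of_all _ fun x => by positivity)).symm
        _ ≤ _ := ENNReal.ofReal_le_ofReal (hB y hy).2
    · simp [hG, -Set.mem_Icc, hy]
  have hGs : ∀ x y, G x y = G y x := fun x y => by
    simp only [hG, and_comm, abs_sub_comm]
  have hGA : ∀ y z, ∫⁻ x, G x y * G z x ∂μ ≤ 2 * ENNReal.ofReal A := by
    intro y z
    calc ∫⁻ x, G x y * G z x ∂μ ≤ ∫⁻ x, (G x y ^ 2 + G x z ^ 2) ∂μ := by
          refine lintegral_mono fun x => ?_
          rw [hGs z x]
          rcases le_total (G x y) (G x z) with h | h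
          · calc G x y * G x z ≤ G x z * G x z := mul_le_mul_left h _
              _ = G x z ^ 2 := (pow_two _).symm
              _ ≤ _ := le_add_self
          · calc G x y * G x z ≤ G x y * G x y := mul_le_mul_right h _
              _ = G x y ^ 2 := (pow_two _).symm
              _ ≤ _ := le_self_add
      _ = ∫⁻ x, G x y ^ 2 ∂μ + ∫⁻ x, G x z ^ 2 ∂μ := lintegral_add_left
          ((hGm.comp (measurable_id.prodMk measurable_const)).pow_const 2) _
      _ ≤ _ := by rw [two_mul]; exact add_le_add (hsq y) (hsq z)
  have hfin := (lintegral_cyclic_le μ hGm hGA hGB n).trans_lt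
    (ENNReal.mul_lt_top (ENNReal.mul_lt_top (by simp) ENNReal.ofReal_lt_top)
      (ENNReal.pow_lt_top ENNReal.ofReal_lt_top))
  rw [hμ, ← restrict_unitCube] at hfin
  refine ⟨(Finset.measurable_fun_prod _ fun j _ => by fun_prop).aestronglyMeasurable, ?_⟩
  refine lt_of_le_of_lt ?_ hfin
  refine setLIntegral_mono_ae' measurableSet_Icc (ae_of_all _ fun x hx => ?_)
  have hx' : ∀ i, x i ∈ Set.Icc (0 : ℝ) 1 := fun i => ⟨hx.1 i, hx.2 i⟩
  rw [Real.enorm_of_nonneg (by positivity), ENNReal.ofReal_prod_of_nonneg fun j _ => by positivity]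
  refine Finset.prod_le_prod' fun j _ => ?_
  simp only [hG]
  rw [if_pos ⟨hx' _, hx' _⟩]

/-- The grid cell of a point of the unit interval, as an element of `Fin N`. -/
def cellFin {N : ℕ} (hN : 1 ≤ N) (x : ℝ) : Fin N := ⟨cellIndex N x, cellIndex_lt hN x⟩

lemma measurable_cellFin {N : ℕ} (hN : 1 ≤ N) : Measurable (cellFin hN) :=
  measurable_to_countable' fun i => by
    have : cellFin hN ⁻¹' {i} = cellIndex N ⁻¹' {(i : ℕ)} := by
      ext x
      simp [cellFin, Fin.ext_iff]
    rw [this]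
    exact measurable_cellIndex N (measurableSet_singleton _)

/-- The cells have mass `1 / N`. -/
lemma map_cellFin_singleton {N : ℕ} (hN : 1 ≤ N) (i : Fin N) :
    (((volume : Measure ℝ).restrict (Set.Icc 0 1)).map (cellFin hN)).real {i} = 1 / N := by
  have hN0 : (0 : ℝ) < N := by exact_mod_cast hN
  rw [map_measureReal_apply (measurable_cellFin hN) (measurableSet_singleton _),
    ← Measure.restrict_congr_set (Ico_ae_eq_Icc (α := ℝ) (μ := volume)),
    measureReal_restrict_apply (measurable_cellFin hN (measurableSet_singleton _))]
  have hset : cellFin hN ⁻¹' {i} ∩ Set.Ico 0 1 = Set.Ico ((i : ℝ) / N) (((i : ℝ) + 1) / N) := by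
    ext x
    have hi : ((i : ℕ) : ℝ) + 1 ≤ N := by exact_mod_cast i.2
    have hi0 : (0 : ℝ) ≤ (i : ℕ) := Nat.cast_nonneg _
    simp only [Set.mem_inter_iff, Set.mem_preimage, Set.mem_singleton_iff, Set.mem_Ico, cellFin,
      Fin.ext_iff, cellIndex, div_le_iff₀ hN0, lt_div_iff₀ hN0]
    constructor
    · rintro ⟨h, h0, h1⟩
      have hfl : ⌊N * x⌋₊ ≤ N - 1 := by
        have : ⌊N * x⌋₊ < N := (Nat.floor_lt (by positivity)).2 (by nlinarith)
        omega
      rw [min_eq_left hfl, Nat.floor_eq_iff (by positivity)] at h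
      constructor <;> linarith [h.1, h.2]
    · rintro ⟨h1, h2⟩
      have hx0 : 0 ≤ x := by
        by_contra! h
        nlinarith
      have hx1 : x < 1 := by
        by_contra! h
        nlinarith
      refine ⟨?_, hx0, hx1⟩
      have h : ⌊N * x⌋₊ = (i : ℕ) :=
        (Nat.floor_eq_iff (by positivity)).2 ⟨by linarith, by linarith⟩
      rw [h]
      have := i.2
      omega
  rw [hset, Real.volume_real_Ico_of_le (by gcongr; linarith)]
  field_simp
  ring

/-- The integral over the cube of a function of the grid cells is a normalized sum. -/
lemma integral_unitCube_cellFin {N : ℕ} (hN : 1 ≤ N) (m : ℕ) (F : (Fin m → Fin N) → ℝ) :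
    ∫ x in unitCube m, F (fun j => cellFin hN (x j)) = (1 / N) ^ m * ∑ i, F i := by
  have hm : Measurable fun x : Fin m → ℝ => fun j => cellFin hN (x j) :=
    measurable_pi_lambda _ fun j => (measurable_cellFin hN).comp (measurable_pi_apply j)
  rw [restrict_unitCube,
    ← integral_map (φ := fun x : Fin m → ℝ => fun j => cellFin hN (x j)) hm.aemeasurable
      (Measurable.of_discrete).aestronglyMeasurable,
    Measure.pi_map_pi fun _ => (measurable_cellFin hN).aemeasurable, integral_fintype (by
      exact Integrable.of_finite), Finset.mul_sum]
  refine Finset.sum_congr rfl fun i _ => ?_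
  rw [measureReal_def, Measure.pi_singleton, ENNReal.toReal_prod, smul_eq_mul]
  congr 1
  simp_rw [← measureReal_def, map_cellFin_singleton]
  simp

/-- The covariance matrix of the increments. -/
def covMatrix (H t : ℝ) (N : ℕ) : Matrix (Fin N) (Fin N) ℝ :=
  Matrix.of fun i j => incrCov H t N ((i : ℝ) - (j : ℝ))

/-- The traces as integrals over the cube, the sums being integrals of functions of the grid
cells. -/
lemma pow_mul_trace_covMatrix {H t : ℝ} {N : ℕ} (hN : 1 ≤ N) (n : ℕ) :
    (N : ℝ) ^ (n + 1) * (covMatrix H t N ^ (n + 1)).trace =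
      ∫ x in unitCube (n + 1), ∏ j, stepKernel H t N (x j) (x (finRotate (n + 1) j)) := by
  have hN0 : (N : ℝ) ≠ 0 := by positivity
  have h := integral_unitCube_cellFin hN (n + 1) fun i =>
    ∏ j, ((N : ℝ) ^ 2 * incrCov H t N ((i j : ℝ) - (i (finRotate (n + 1) j) : ℝ)))
  simp only [Finset.prod_mul_distrib, Finset.prod_const, Finset.card_univ, Fintype.card_fin,
    ← Finset.mul_sum] at h
  rw [covMatrix, trace_pow_eq_sum_cyclic]
  simp only [stepKernel, Finset.prod_mul_distrib, Finset.prod_const, Finset.card_univ,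
    Fintype.card_fin]
  refine Eq.trans ?_ h.symm
  rw [← mul_assoc]
  congr 1
  rw [← mul_pow]
  congr 1
  field_simp

/-- Almost every point of the cube avoids the hyperplanes on which a cyclic product is singular. -/
lemma ae_ne_finRotate (n : ℕ) : ∀ᵐ x : Fin (n + 2) → ℝ, ∀ j, x j ≠ x (finRotate (n + 2) j) := by
  rw [ae_all_iff]
  intro j
  have hj : j ≠ finRotate (n + 2) j := by
    rw [finRotate_apply]
    intro h
    simp at h
  set E : Submodule ℝ (Fin (n + 2) → ℝ) :=
    LinearMap.ker (LinearMap.proj (R := ℝ) (φ := fun _ : Fin (n + 2) => ℝ) j -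
      LinearMap.proj (finRotate (n + 2) j)) with hE
  have hE' : E ≠ ⊤ := by
    intro h
    have : Pi.single j (1 : ℝ) ∈ E := h ▸ Submodule.mem_top
    rw [hE, LinearMap.mem_ker] at this
    simp at this
  filter_upwards [measure_eq_zero_iff_ae_notMem.1 (Measure.addHaar_submodule volume E hE')]
    with x hx h
  refine hx ?_
  simp [hE, h]

lemma integrableOn_cyclicProduct {H : ℝ} (t : ℝ) (hH : 3 / 4 < H) (n : ℕ) :
    IntegrableOn (cyclicProduct H t (n + 2)) (unitCube (n + 2)) := by
  refine Integrable.mono' ((integrable_cyclic_rpow (p := 2 * H - 2) (by linarith) n).const_mul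
    (kernelConst H t ^ (n + 2))) ?_ ?_
  · unfold cyclicProduct limitKernel
    exact (Finset.measurable_fun_prod _ fun j _ => by fun_prop).aestronglyMeasurable
  · filter_upwards [ae_restrict_of_ae (ae_ne_finRotate n), ae_restrict_mem measurableSet_Icc]
      with x hx hx1
    have hx' : ∀ i, x i ∈ Set.Icc (0 : ℝ) 1 := fun i => ⟨hx1.1 i, hx1.2 i⟩
    rw [cyclicProduct, norm_prod]
    calc _ ≤ ∏ j, (kernelConst H t * |x j - x (finRotate (n + 2) j)| ^ (2 * H - 2)) := by
          refine Finset.prod_le_prod (fun j _ => norm_nonneg _) fun j _ => ?_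
          refine abs_limitKernel_le (sub_ne_zero.2 (hx j)) ?_
          rw [abs_le]
          have h1 := hx' j
          have h2 := hx' (finRotate (n + 2) j)
          constructor <;> linarith [h1.1, h1.2, h2.1, h2.2]
      _ = _ := by simp [Finset.prod_mul_distrib]

/-- The normalized traces of the powers of the covariance matrix converge to cyclic integrals of
the limit kernel. -/
lemma tendsto_trace_covMatrix {H : ℝ} (t : ℝ) (hH : 3 / 4 < H) (hH1 : H < 1) (n : ℕ) :
    Tendsto (fun N : ℕ => (N : ℝ) ^ (n + 2) * (covMatrix H t N ^ (n + 2)).trace) atTop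
      (𝓝 (∫ x in unitCube (n + 2), cyclicProduct H t (n + 2) x)) := by
  obtain ⟨C, hC0, hC⟩ := exists_abs_stepKernel_le (t := t) hH hH1
  have hev : ∀ᶠ N : ℕ in atTop,
      ∫ x in unitCube (n + 2), ∏ j, stepKernel H t N (x j) (x (finRotate (n + 2) j)) =
        (N : ℝ) ^ (n + 2) * (covMatrix H t N ^ (n + 2)).trace := by
    filter_upwards [eventually_ge_atTop 1] with N hN
    exact (pow_mul_trace_covMatrix hN (n + 1)).symm
  refine Tendsto.congr' hev ?_
  refine tendsto_integral_filter_of_dominated_convergence (fun x =>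
    C ^ (n + 2) * ∏ j, |x j - x (finRotate (n + 2) j)| ^ (2 * H - 2)) ?_ ?_
    ((integrable_cyclic_rpow (by linarith) n).const_mul _) ?_
  · refine Eventually.of_forall fun N => Measurable.aestronglyMeasurable ?_
    refine Finset.measurable_fun_prod _ fun j _ => ?_
    have hc : ∀ i : Fin (n + 2), Measurable fun x : Fin (n + 2) → ℝ => (cellIndex N (x i) : ℝ) :=
      fun i => (measurable_from_nat (f := fun k : ℕ => (k : ℝ))).comp
        ((measurable_cellIndex N).comp (measurable_pi_apply i))
    unfold stepKernel incrCov incrVar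
    have h1 := hc j
    have h2 := hc (finRotate (n + 2) j)
    fun_prop
  · filter_upwards [eventually_ge_atTop 1] with N hN
    filter_upwards [ae_restrict_of_ae (ae_ne_finRotate n), ae_restrict_mem measurableSet_Icc]
      with x hx hx1
    have hx' : ∀ i, x i ∈ Set.Icc (0 : ℝ) 1 := fun i => ⟨hx1.1 i, hx1.2 i⟩
    rw [norm_prod]
    calc _ ≤ ∏ j, (C * |x j - x (finRotate (n + 2) j)| ^ (2 * H - 2)) :=
          Finset.prod_le_prod (fun j _ => norm_nonneg _) fun j _ =>
            hC N hN _ (hx' _) _ (hx' _) (hx j)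
      _ = _ := by simp [Finset.prod_mul_distrib]
  · filter_upwards [ae_restrict_of_ae (ae_ne_finRotate n), ae_restrict_mem measurableSet_Icc]
      with x hx hx1
    have hx' : ∀ i, x i ∈ Set.Icc (0 : ℝ) 1 := fun i => ⟨hx1.1 i, hx1.2 i⟩
    exact tendsto_finsetProd _ fun j _ => tendsto_stepKernel (hx' _) (hx' _) (hx j)

/-- The sum of the entries of the covariance matrix is the variance of the increment over the unit
interval. -/
lemma sum_covMatrix {H : ℝ} (t : ℝ) (hH : 0 < H) {N : ℕ} (hN : 1 ≤ N) :
    ∑ i, ∑ j, covMatrix H t N i j = k₁ t + k₂ H := by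
  have hN0 : (N : ℝ) ≠ 0 := by positivity
  set q : ℕ → ℕ → ℝ := fun i j => incrVar H t (|(i : ℝ) - j| / N) with hq
  have he : ∀ i j : ℕ, incrCov H t N ((i : ℝ) - j) =
      ((q (i + 1) j - q i j) - (q (i + 1) (j + 1) - q i (j + 1))) / 2 := fun i j => by
    simp only [hq, incrCov]
    push_cast
    rw [show (i : ℝ) - j + 1 = i + 1 - j by ring, show (i : ℝ) - j - 1 = i - (j + 1) by ring,
      show (i : ℝ) + 1 - (j + 1) = i - j by ring]
    ring
  simp only [covMatrix, Matrix.of_apply]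
  rw [Fin.sum_univ_eq_sum_range (fun i : ℕ => ∑ j : Fin N, incrCov H t N ((i : ℝ) - (j : ℝ))) N]
  have h1 : ∀ i : ℕ, ∑ j : Fin N, incrCov H t N ((i : ℝ) - (j : ℝ)) =
      ((q i N - q i 0) - (q (i + 1) N - q (i + 1) 0)) / 2 := fun i => by
    rw [Fin.sum_univ_eq_sum_range (fun j : ℕ => incrCov H t N ((i : ℝ) - j)) N]
    have h2 := Finset.sum_range_sub (fun j => (q i j - q (i + 1) j) / 2) N
    rw [show ((q i N - q i 0) - (q (i + 1) N - q (i + 1) 0)) / 2 =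
      (q i N - q (i + 1) N) / 2 - (q i 0 - q (i + 1) 0) / 2 by ring, ← h2]
    refine Finset.sum_congr rfl fun j _ => ?_
    rw [he]
    ring
  have h3 := Finset.sum_range_sub (fun i => (q i 0 - q i N) / 2) N
  have h4 : ∑ i ∈ Finset.range N, ∑ j : Fin N, incrCov H t N ((i : ℝ) - (j : ℝ)) =
      (q N 0 - q N N) / 2 - (q 0 0 - q 0 N) / 2 := by
    rw [← h3]
    refine Finset.sum_congr rfl fun i _ => ?_
    rw [h1]
    ring
  rw [h4]
  simp only [hq, incrVar]
  have e1 : 2 * H ≠ 0 := by positivity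
  have e2 : 2 * H + 1 ≠ 0 := by positivity
  simp [hN0, Real.zero_rpow e1, Real.zero_rpow e2]
  ring

lemma isSymm_covMatrix (H t : ℝ) (N : ℕ) (i j : Fin N) :
    covMatrix H t N i j = covMatrix H t N j i := by
  simp only [covMatrix, Matrix.of_apply, incrCov]
  rw [abs_sub_comm (i : ℝ) j, ← abs_neg ((i : ℝ) - j + 1), ← abs_neg ((i : ℝ) - j - 1),
    show -((i : ℝ) - j + 1) = j - i - 1 by ring, show -((i : ℝ) - j - 1) = j - i + 1 by ring]
  ring

/-- The Cauchy-Schwarz inequality for the sum of the entries of a symmetric matrix. -/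
lemma sq_sum_le_trace_sq {N : ℕ} (R : Matrix (Fin N) (Fin N) ℝ) (hR : ∀ i j, R i j = R j i) :
    (∑ i, ∑ j, R i j) ^ 2 ≤ (N : ℝ) ^ 2 * (R ^ 2).trace := by
  have h := sq_sum_le_card_mul_sum_sq (s := (Finset.univ : Finset (Fin N × Fin N)))
    (f := fun q => R q.1 q.2)
  rw [Fintype.sum_prod_type, Fintype.sum_prod_type] at h
  refine h.trans (le_of_eq ?_)
  rw [pow_two R, Matrix.trace]
  simp only [Matrix.diag_apply, Matrix.mul_apply, Finset.card_univ, Fintype.card_prod,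
    Fintype.card_fin]
  push_cast
  rw [pow_two (N : ℝ)]
  congr 1
  refine Finset.sum_congr rfl fun i _ => Finset.sum_congr rfl fun j _ => ?_
  rw [hR j i]
  ring

/-- The Cauchy-Schwarz inequality, applied to the vector of the row sums and to the square of the
matrix. -/
lemma sum_pow_four_le_trace {N : ℕ} (R : Matrix (Fin N) (Fin N) ℝ) (hR : ∀ i j, R i j = R j i) :
    (∑ i, ∑ j, R i j) ^ 4 ≤ (N : ℝ) ^ 4 * (R ^ 4).trace := by
  have hsymm : ∀ i j, (R ^ 2) i j = (R ^ 2) j i := fun i j => by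
    rw [pow_two, Matrix.mul_apply, Matrix.mul_apply]
    refine Finset.sum_congr rfl fun k _ => ?_
    rw [hR i k, hR k j]
    ring
  have h1 := sq_sum_le_trace_sq (R ^ 2) hsymm
  rw [← pow_mul] at h1
  have h2 : ∑ i, ∑ j, (R ^ 2) i j = ∑ k, (∑ j, R k j) ^ 2 := by
    simp_rw [pow_two R, Matrix.mul_apply]
    rw [Finset.sum_congr rfl fun i _ => Finset.sum_comm, Finset.sum_comm]
    refine Finset.sum_congr rfl fun k _ => ?_
    rw [pow_two, Finset.sum_mul_sum]
    refine Finset.sum_congr rfl fun i _ => Finset.sum_congr rfl fun j _ => ?_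
    rw [hR i k]
  have h3 := sq_sum_le_card_mul_sum_sq (s := (Finset.univ : Finset (Fin N)))
    (f := fun k => ∑ j, R k j)
  rw [← h2, Finset.card_univ, Fintype.card_fin] at h3
  calc (∑ i, ∑ j, R i j) ^ 4 = ((∑ i, ∑ j, R i j) ^ 2) ^ 2 := by ring
    _ ≤ (N * ∑ i, ∑ j, (R ^ 2) i j) ^ 2 := by gcongr
    _ = N ^ 2 * (∑ i, ∑ j, (R ^ 2) i j) ^ 2 := by ring
    _ ≤ N ^ 2 * (N ^ 2 * (R ^ 4).trace) := by gcongr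
    _ = N ^ 4 * (R ^ 4).trace := by ring

/-- For `t > 1` the variance of the increment over the unit interval is positive:
`k₂ > -1 / 2 > -k₁`. -/
lemma k₁_add_k₂_pos {H t : ℝ} (hH : 3 / 4 < H) (ht : 1 < t) : 0 < k₁ t + k₂ H := by
  have h : (4 * H - 1) / (4 * (2 * H + 1)) < 1 / 2 := by
    rw [div_lt_div_iff₀ (by linarith) (by norm_num)]
    linarith
  rw [k₁, k₂]
  linarith

/-- The cyclic integral of order four is bounded below by the fourth power of the variance of the
increment over the unit interval. -/
lemma integral_cyclicProduct_four_pos {H t : ℝ} (hH : 3 / 4 < H) (hH1 : H < 1) (ht : 1 < t) :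
    0 < ∫ x in unitCube 4, cyclicProduct H t 4 x := by
  refine lt_of_lt_of_le (pow_pos (k₁_add_k₂_pos hH ht) 4)
    (ge_of_tendsto (tendsto_trace_covMatrix t hH hH1 2) ?_)
  filter_upwards [eventually_ge_atTop 1] with N hN
  rw [← sum_covMatrix t (by linarith) hN]
  exact sum_pow_four_le_trace _ (isSymm_covMatrix H t N)

/-- The cyclic integral of order two is `2 K₀`. -/
lemma integral_cyclicProduct_two {H : ℝ} (t : ℝ) (hH : 3 / 4 < H) :
    ∫ x in unitCube 2, cyclicProduct H t 2 x = 2 * K₀ H t := by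
  have hint : IntegrableOn (fun z => limitKernel H t z ^ 2) (Set.Icc (-1) 1) := by
    refine Integrable.mono' ((integrableOn_abs_rpow (p := 2 * (2 * H - 2))
      (by linarith) 1).const_mul (kernelConst H t ^ 2)) (by
        unfold limitKernel
        exact Measurable.aestronglyMeasurable (by fun_prop)) ?_
    have h0 : ∀ᵐ z : ℝ, z ≠ 0 := by simp [ae_iff]
    filter_upwards [ae_restrict_of_ae h0, ae_restrict_mem measurableSet_Icc] with z hz hz1
    rw [Real.norm_eq_abs, abs_pow, mul_comm 2 (2 * H - 2), Real.rpow_mul (abs_nonneg _),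
      Real.rpow_two, ← mul_pow]
    gcongr
    exact abs_limitKernel_le hz (abs_le.2 hz1)
  have h := integral_sub_square_of_even (φ := fun z => limitKernel H t z ^ 2) zero_le_one
    (fun z => by rw [limitKernel_neg]) hint
  have hmp := measurePreserving_finTwoArrow ((volume : Measure ℝ).restrict (Set.Icc 0 1))
  rw [restrict_unitCube, K₀]
  refine Eq.trans ?_ (h.trans ?_)
  · rw [← hmp.integral_comp (MeasurableEquiv.finTwoArrow).measurableEmbedding]
    refine integral_congr_ae (ae_of_all _ fun x => ?_)
    simp only [cyclicProduct, Fin.prod_univ_two, finRotate_apply, MeasurableEquiv.finTwoArrow]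
    simp only [Fin.isValue, zero_add, Fin.reduceAdd]
    rw [← limitKernel_neg H t (x 1 - x 0), neg_sub, ← pow_two]
    rfl
  · congr 1
    exact intervalIntegral.integral_congr fun z _ => mul_comm _ _

/-- Term by term integration of the square of the kernel. -/
lemma K₀_eq {H : ℝ} (t : ℝ) (hH : 3 / 4 < H) : K₀ H t =
      k₁ t ^ 2 * (H ^ 2 * (2 * H - 1) / (2 * (4 * H - 3)))
        + 2 * k₁ t * k₂ H * (H ^ 2 * (2 * H + 1) / (2 * (4 * H - 1)))
        + k₂ H ^ 2 * (H * (2 * H + 1) ^ 2 / (4 * (4 * H - 1))) := by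
  set A := k₁ t * (H * (2 * H - 1)) with hA
  set B := k₂ H * (H * (2 * H + 1)) with hB
  have hI : ∀ p : ℝ, -1 < p → IntervalIntegrable (fun x : ℝ => x ^ p - x ^ (p + 1)) volume 0 1 ∧
      ∫ x in (0 : ℝ)..1, (x ^ p - x ^ (p + 1)) = 1 / ((p + 1) * (p + 2)) := fun p hp => by
    have i1 : IntervalIntegrable (fun x : ℝ => x ^ p) volume 0 1 :=
      intervalIntegral.intervalIntegrable_rpow' hp
    have i2 : IntervalIntegrable (fun x : ℝ => x ^ (p + 1)) volume 0 1 :=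
      intervalIntegral.intervalIntegrable_rpow' (by linarith)
    refine ⟨i1.sub i2, ?_⟩
    have h1 : p + 1 ≠ 0 := by linarith
    have h2 : p + 1 + 1 ≠ 0 := by linarith
    have h3 : p + 2 ≠ 0 := by linarith
    rw [intervalIntegral.integral_sub i1 i2, integral_rpow (Or.inl hp),
      integral_rpow (Or.inl (by linarith)), Real.one_rpow, Real.one_rpow, Real.zero_rpow h1,
      Real.zero_rpow h2]
    field_simp
    ring
  obtain ⟨i1, e1⟩ := hI (4 * H - 4) (by linarith)
  obtain ⟨i2, e2⟩ := hI (4 * H - 3) (by linarith)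
  obtain ⟨i3, e3⟩ := hI (4 * H - 2) (by linarith)
  have hfun : ∀ x ∈ Set.Ioc (0 : ℝ) 1, limitKernel H t x ^ 2 * (1 - x) =
      A ^ 2 * (x ^ (4 * H - 4) - x ^ (4 * H - 4 + 1)) +
        2 * A * B * (x ^ (4 * H - 3) - x ^ (4 * H - 3 + 1)) +
        B ^ 2 * (x ^ (4 * H - 2) - x ^ (4 * H - 2 + 1)) := fun x hx => by
    have hx0 := hx.1
    have q1 : x ^ (4 * H - 4) = (x ^ (2 * H - 2)) ^ 2 := by
      rw [← Real.rpow_two, ← Real.rpow_mul hx0.le]; congr 1; ring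
    have q2 : x ^ (2 * H - 1) = x ^ (2 * H - 2) * x := by
      rw [← Real.rpow_add_one hx0.ne']; congr 1; ring
    have q3 : x ^ (4 * H - 3) = (x ^ (2 * H - 2)) ^ 2 * x := by
      rw [← q1, ← Real.rpow_add_one hx0.ne']; congr 1; ring
    have q4 : x ^ (4 * H - 2) = (x ^ (2 * H - 2)) ^ 2 * x * x := by
      rw [← q3, ← Real.rpow_add_one hx0.ne']; congr 1; ring
    rw [limitKernel_of_pos hx0, ← hA, ← hB, Real.rpow_add_one hx0.ne', Real.rpow_add_one hx0.ne',
      Real.rpow_add_one hx0.ne', q2, q1, q3, q4]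
    ring
  rw [K₀, intervalIntegral.integral_of_le zero_le_one,
    setIntegral_congr_fun measurableSet_Ioc hfun, ← intervalIntegral.integral_of_le zero_le_one,
    intervalIntegral.integral_add ((i1.const_mul _).add (i2.const_mul _)) (i3.const_mul _),
    intervalIntegral.integral_add (i1.const_mul _) (i2.const_mul _),
    intervalIntegral.integral_const_mul, intervalIntegral.integral_const_mul,
    intervalIntegral.integral_const_mul, e1, e2, e3, hA, hB]
  have h1 : 4 * H - 3 ≠ 0 := by linarith
  have h2 : 4 * H - 1 ≠ 0 := by linarith
  have h3 : 2 * H - 1 ≠ 0 := by linarith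
  have h4 : H ≠ 0 := by linarith
  rw [show (4 * H - 4 + 1) * (4 * H - 4 + 2) = (4 * H - 3) * (2 * (2 * H - 1)) by ring,
    show (4 * H - 3 + 1) * (4 * H - 3 + 2) = 2 * (2 * H - 1) * (4 * H - 1) by ring,
    show (4 * H - 2 + 1) * (4 * H - 2 + 2) = (4 * H - 1) * (4 * H) by ring]
  generalize 4 * H - 3 = a at *
  generalize 4 * H - 1 = b at *
  generalize 2 * H - 1 = c at *
  field_simp

/-- As `k₂ < 0`, positivity is not visible on the explicit formula; it follows from the lower bound
`(k₁ + k₂)²` for the normalized traces of the squares of the covariance matrices. -/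
lemma K₀_pos {H t : ℝ} (hH : 3 / 4 < H) (hH1 : H < 1) (ht : 1 < t) : 0 < K₀ H t := by
  have h : (k₁ t + k₂ H) ^ 2 ≤ ∫ x in unitCube 2, cyclicProduct H t 2 x := by
    refine ge_of_tendsto (tendsto_trace_covMatrix t hH hH1 0) ?_
    filter_upwards [eventually_ge_atTop 1] with N hN
    rw [← sum_covMatrix t (by linarith) hN]
    exact sq_sum_le_trace_sq _ (isSymm_covMatrix H t N)
  rw [integral_cyclicProduct_two t hH] at h
  linarith [pow_pos (k₁_add_k₂_pos hH ht) 2]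

/-! ### Laws determined by their moments -/

/-- The exponential moment `E cosh(aX)` depends on the moments only, even if it is infinite; a law
with the moments of another one therefore inherits its exponential moments. -/
lemma lintegral_cosh_eq_tsum {ρ : Measure ℝ} (hρ : ∀ m : ℕ, Integrable (fun x : ℝ => x ^ m) ρ)
    (a : ℝ) :
    ∫⁻ x, ENNReal.ofReal (Real.cosh (a * x)) ∂ρ =
      ∑' k : ℕ, ENNReal.ofReal (a ^ (2 * k) / (2 * k).factorial * ∫ x, x ^ (2 * k) ∂ρ) := by
  have h0 : ∀ (k : ℕ) (y : ℝ), 0 ≤ y ^ (2 * k) := fun k y => (even_two_mul k).pow_nonneg y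
  have h1 : ∀ x : ℝ, ENNReal.ofReal (Real.cosh (a * x)) =
      ∑' k : ℕ, ENNReal.ofReal (a ^ (2 * k) / (2 * k).factorial * x ^ (2 * k)) := fun x => by
    have h := Real.hasSum_cosh (a * x)
    rw [← h.tsum_eq, ENNReal.ofReal_tsum_of_nonneg
      (fun k => div_nonneg (h0 _ _) (by positivity)) h.summable]
    refine tsum_congr fun k => ?_
    rw [mul_pow, mul_div_right_comm]
  simp_rw [h1]
  rw [lintegral_tsum fun k => by fun_prop]
  refine tsum_congr fun k => ?_
  rw [← integral_const_mul, ofReal_integral_eq_lintegral_ofReal ((hρ _).const_mul _)]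
  exact ae_of_all _ fun x => mul_nonneg (div_nonneg (h0 _ _) (by positivity)) (h0 _ _)

/-- If `E cosh(aX)` is finite, then `E exp(zX)` is finite for `|z| < a`. -/
lemma mem_interior_integrableExpSet {ρ : Measure ℝ} {a : ℝ}
    (h : ∫⁻ x, ENNReal.ofReal (Real.cosh (a * x)) ∂ρ < ⊤) {z : ℝ} (hz : |z| < a) :
    z ∈ interior (integrableExpSet id ρ) := by
  have hsub : Set.Ioo (-a) a ⊆ integrableExpSet id ρ := fun y hy => by
    have hc : Integrable (fun x : ℝ => 2 * Real.cosh (a * x)) ρ := by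
      refine Integrable.const_mul ⟨by fun_prop, ?_⟩ 2
      refine lt_of_le_of_lt (lintegral_mono fun x => ?_) h
      rw [Real.enorm_of_nonneg (Real.cosh_pos _).le]
    refine hc.mono' (by fun_prop) (ae_of_all _ fun x => ?_)
    rw [Real.norm_of_nonneg (Real.exp_pos _).le, Real.cosh_eq]
    have h1 : y * x ≤ |a * x| := by
      rw [abs_mul]
      calc y * x ≤ |y * x| := le_abs_self _
        _ = |y| * |x| := abs_mul _ _
        _ ≤ |a| * |x| := by
          exact mul_le_mul_of_nonneg_right ((abs_lt.2 hy).le.trans (le_abs_self a)) (abs_nonneg x)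
    have h2 := Real.exp_pos (a * x)
    have h3 := Real.exp_pos (-(a * x))
    have h4 : Real.exp (y * x) ≤ Real.exp (|a * x|) := Real.exp_le_exp.2 h1
    simp only [id]
    rcases abs_choice (a * x) with h5 | h5 <;> rw [h5] at h4 <;> linarith
  exact interior_mono hsub (by rw [interior_Ioo]; exact abs_lt.1 hz)

/-- A law with an exponential moment is determined by its moments. -/
lemma eq_of_moments_eq {μ ν : Measure ℝ} [IsProbabilityMeasure μ] [IsProbabilityMeasure ν] {a : ℝ}
    (ha : 0 < a) (hexp : ∫⁻ x, ENNReal.ofReal (Real.cosh (a * x)) ∂μ < ⊤)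
    (hμ : ∀ m : ℕ, Integrable (fun x : ℝ => x ^ m) μ)
    (hν : ∀ m : ℕ, Integrable (fun x : ℝ => x ^ m) ν)
    (h : ∀ m : ℕ, ∫ x, x ^ m ∂μ = ∫ x, x ^ m ∂ν) : μ = ν := by
  have hexp' : ∫⁻ x, ENNReal.ofReal (Real.cosh (a * x)) ∂ν < ⊤ := by
    rw [lintegral_cosh_eq_tsum hν]
    simp_rw [← h]
    rwa [← lintegral_cosh_eq_tsum hμ]
  set S : Set ℂ := {z | z.re ∈ Set.Ioo (-a) a} with hS
  have han : ∀ ρ : Measure ℝ, ∫⁻ x, ENNReal.ofReal (Real.cosh (a * x)) ∂ρ < ⊤ →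
      AnalyticOnNhd ℂ (complexMGF id ρ) S := fun ρ hρ z hz =>
    analyticAt_complexMGF (mem_interior_integrableExpSet hρ (abs_lt.2 hz))
  have h0S : (0 : ℂ) ∈ S := by simp [hS, ha]
  have hder : ∀ n, iteratedDeriv n (complexMGF id μ) 0 = iteratedDeriv n (complexMGF id ν) 0 := by
    intro n
    rw [iteratedDeriv_complexMGF (mem_interior_integrableExpSet hexp (by simpa using ha)),
      iteratedDeriv_complexMGF (mem_interior_integrableExpSet hexp' (by simpa using ha))]
    simp only [id, zero_mul, Complex.exp_zero, mul_one, ← Complex.ofReal_pow]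
    rw [integral_complex_ofReal, integral_complex_ofReal, h]
  have hev : complexMGF id μ =ᶠ[𝓝 0] complexMGF id ν := by
    have h1 := (han μ hexp 0 h0S).hasFPowerSeriesAt
    have h2 := (han ν hexp' 0 h0S).hasFPowerSeriesAt
    simp_rw [← hder] at h2
    rw [hasFPowerSeriesAt_iff] at h1 h2
    filter_upwards [h1, h2] with z hz1 hz2
    simpa using hz1.unique hz2
  have hpre : IsPreconnected S :=
    ((convex_Ioo (-a) a).linear_preimage Complex.reLm).isPreconnected
  have heq := (han μ hexp).eqOn_of_preconnected_of_eventuallyEq (han ν hexp') hpre h0S hev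
  refine Measure.ext_of_charFun (funext fun s => ?_)
  rw [← complexMGF_id_mul_I, ← complexMGF_id_mul_I]
  exact heq (by simp [hS, ha])

lemma memLp_id_of_moments {ρ : Measure ℝ} (hρ : ∀ m : ℕ, Integrable (fun x : ℝ => x ^ m) ρ)
    (k : ℕ) : MemLp (id : ℝ → ℝ) k ρ := by
  rcases eq_or_ne k 0 with rfl | hk
  · simpa using aestronglyMeasurable_id
  · rw [← integrable_norm_rpow_iff (by fun_prop) (by simpa using hk) (by simp)]
    refine (hρ k).norm.congr (ae_of_all _ fun x => ?_)
    simp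

lemma moments_eq_of_iteratedDeriv_charFun_eq {μ ν : Measure ℝ} [IsProbabilityMeasure μ]
    [IsProbabilityMeasure ν] (hμ : ∀ m : ℕ, Integrable (fun x : ℝ => x ^ m) μ)
    (hν : ∀ m : ℕ, Integrable (fun x : ℝ => x ^ m) ν) (m : ℕ)
    (h : iteratedDeriv m (charFun μ) 0 = iteratedDeriv m (charFun ν) 0) :
    ∫ x, x ^ m ∂μ = ∫ x, x ^ m ∂ν := by
  rw [iteratedDeriv_charFun_zero (memLp_id_of_moments hμ m),
    iteratedDeriv_charFun_zero (memLp_id_of_moments hν m)] at h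
  have := mul_left_cancel₀ (pow_ne_zero m Complex.I_ne_zero) h
  exact_mod_cast this

/-! ### Cumulants -/

lemma integrable_pow_of_cosh {ρ : Measure ℝ} {a : ℝ} (ha : 0 < a)
    (h : ∫⁻ x, ENNReal.ofReal (Real.cosh (a * x)) ∂ρ < ⊤) (m : ℕ) :
    Integrable (fun x : ℝ => x ^ m) ρ :=
  integrable_pow_of_mem_interior_integrableExpSet (X := id)
    (mem_interior_integrableExpSet h (z := 0) (by simpa using ha)) m

/-- The derivatives at the origin of a characteristic function satisfy a recursion whose
coefficients are the cumulants. -/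
lemma iteratedDeriv_charFun_succ {μ : Measure ℝ} [IsProbabilityMeasure μ]
    (hμ : ∀ m : ℕ, Integrable (fun x : ℝ => x ^ m) μ) (n : ℕ) :
    iteratedDeriv (n + 1) (charFun μ) 0 = ∑ i ∈ Finset.range (n + 1), (n.choose i : ℂ) *
      iteratedDeriv i (charFun μ) 0 *
        iteratedDeriv (n - i + 1) (fun s : ℝ => Complex.log (charFun μ s)) 0 := by
  set f := charFun μ with hf
  set g := fun s : ℝ => Complex.log (f s) with hg
  have hsm : ∀ k : ℕ, ContDiff ℝ k f := fun k => contDiff_charFun (memLp_id_of_moments hμ k)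
  have hf0 : f 0 = 1 := by simp [hf]
  have hslit : ∀ᶠ s in 𝓝 (0 : ℝ), f s ∈ Complex.slitPlane :=
    (hsm 0).continuous.continuousAt.eventually_mem
      (by rw [hf0]; exact Complex.isOpen_slitPlane.mem_nhds Complex.one_mem_slitPlane)
  have hgsm : ∀ k : ℕ, ContDiffAt ℝ k g 0 := fun k => by
    have h1 : ContDiffAt ℝ k Complex.log (f 0) :=
      (Complex.contDiffAt_log (by rw [hf0]; exact Complex.one_mem_slitPlane)).restrict_scalars ℝ
    exact h1.comp 0 (hsm k).contDiffAt
  have hder : deriv f =ᶠ[𝓝 0] fun s => f s * deriv g s := by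
    filter_upwards [hslit] with s hs
    have h1 : HasDerivAt f (deriv f s) s :=
      ((hsm 1).differentiable (by simp)).differentiableAt.hasDerivAt
    rw [(h1.clog_real hs).deriv, mul_div_cancel₀ _ (Complex.slitPlane_ne_zero hs)]
  rw [iteratedDeriv_succ', hder.iteratedDeriv_eq, iteratedDeriv_fun_mul (hsm n).contDiffAt]
  · refine Finset.sum_congr rfl fun i _ => ?_
    rw [← iteratedDeriv_succ']
  · exact ((hgsm (n + 1)).fderiv_right (m := n) (by simp)).clm_apply contDiffAt_const

/-- By recursion, the cumulants determine the derivatives of the characteristic function at the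
origin. -/
lemma iteratedDeriv_charFun_eq_of_cumulant_eq {μ ν : Measure ℝ} [IsProbabilityMeasure μ]
    [IsProbabilityMeasure ν] (hμ : ∀ m : ℕ, Integrable (fun x : ℝ => x ^ m) μ)
    (hν : ∀ m : ℕ, Integrable (fun x : ℝ => x ^ m) ν)
    (h : ∀ m : ℕ, 1 ≤ m → cumulant μ m = cumulant ν m) (m : ℕ) :
    iteratedDeriv m (charFun μ) 0 = iteratedDeriv m (charFun ν) 0 := by
  have h' : ∀ m : ℕ, iteratedDeriv (m + 1) (fun s : ℝ => Complex.log (charFun μ s)) 0 =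
      iteratedDeriv (m + 1) (fun s : ℝ => Complex.log (charFun ν s)) 0 := fun m =>
    mul_left_cancel₀ (pow_ne_zero (m + 1) (neg_ne_zero.2 Complex.I_ne_zero))
      (h (m + 1) (by omega))
  induction m using Nat.strong_induction_on with
  | _ m ih =>
    rcases m with _ | n
    · simp
    · rw [iteratedDeriv_charFun_succ hμ, iteratedDeriv_charFun_succ hν]
      refine Finset.sum_congr rfl fun i hi => ?_
      rw [ih i (by simpa using hi), h']

/-- Cumulants are read off from a power series expansion of the logarithm of the characteristic
function. -/
lemma cumulant_eq_of_hasSum {μ : Measure ℝ} {c : ℕ → ℂ} {L : ℝ → ℂ} (hc0 : c 0 = 0)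
    (hL : ∀ᶠ s : ℝ in 𝓝 0, HasSum (fun m : ℕ => (s : ℂ) ^ m * c m) (L s))
    (hμ : ∀ᶠ s : ℝ in 𝓝 0, charFun μ s = Complex.exp (L s)) (m : ℕ) :
    cumulant μ m = (-Complex.I) ^ m * (m.factorial * c m) := by
  set q : FormalMultilinearSeries ℝ ℝ ℂ := fun n =>
    ContinuousMultilinearMap.mkPiRing ℝ (Fin n) (c n) with hq
  have hcoeff : ∀ n, q.coeff n = c n := fun n => by
    simp [hq, FormalMultilinearSeries.coeff]
  have hps : HasFPowerSeriesAt L q 0 := by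
    rw [hasFPowerSeriesAt_iff]
    filter_upwards [hL] with s hs
    simpa [hcoeff, zero_add, Complex.real_smul] using hs
  have hL0 : L 0 = 0 := by
    have h := hL.self_of_nhds
    have h2 : HasSum (fun m : ℕ => ((0 : ℝ) : ℂ) ^ m * c m) 0 := by
      convert hasSum_zero using 2 with m
      rcases m with _ | m <;> simp [hc0]
    exact h.unique h2
  have hlog : (fun s : ℝ => Complex.log (charFun μ s)) =ᶠ[𝓝 0] L := by
    have h1 : ∀ᶠ s in 𝓝 (0 : ℝ), L s ∈ Metric.ball (0 : ℂ) 1 :=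
      hps.continuousAt.eventually_mem (by rw [hL0]; exact Metric.ball_mem_nhds _ one_pos)
    filter_upwards [h1, hμ] with s hs1 hs2
    have h3 : |(L s).im| < 1 :=
      (Complex.abs_im_le_norm _).trans_lt (by simpa using hs1)
    rw [abs_lt] at h3
    have h4 := Real.pi_gt_three
    rw [hs2, Complex.log_exp (by linarith) (by linarith)]
  obtain ⟨r, hr⟩ := hps
  rw [cumulant, hlog.iteratedDeriv_eq, iteratedDeriv, ← hr.factorial_smul]
  simp [hq]

/-! ### The limit law -/

/-- The bounds satisfied by the power sums of nonnegative numbers whose squares add up to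
`1 / 2`. -/
def IsChaosSequence (p : ℕ → ℝ) : Prop :=
  ∀ m : ℕ, 0 ≤ p (m + 2) ∧ p (m + 2) ≤ √(1 / 2) ^ m / 2

lemma norm_chaosLogMgf_term_le {p : ℕ → ℝ} (hp : IsChaosSequence p) {z : ℂ} (hz : ‖z‖ ≤ 1 / 2)
    (m : ℕ) : ‖(2 * z) ^ (m + 2) * p (m + 2) / (2 * (m + 2 : ℂ))‖ ≤ √(1 / 2) ^ m := by
  have h1 : ‖2 * z‖ ≤ 1 := by rw [norm_mul, Complex.norm_ofNat]; linarith
  have h2 : ‖(2 * (m + 2 : ℂ))‖ = 2 * ((m : ℝ) + 2) := by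
    rw [show (2 * (m + 2 : ℂ)) = ((2 * ((m : ℝ) + 2) : ℝ) : ℂ) by push_cast; rfl,
      Complex.norm_real, Real.norm_of_nonneg (by positivity)]
  rw [norm_div, norm_mul, norm_pow, Complex.norm_real, Real.norm_of_nonneg (hp m).1, h2]
  have h3 : (0 : ℝ) ≤ √(1 / 2) ^ m := by positivity
  have h4 : (0 : ℝ) ≤ m := Nat.cast_nonneg m
  rw [div_le_iff₀ (by positivity)]
  calc ‖2 * z‖ ^ (m + 2) * p (m + 2) ≤ 1 * (√(1 / 2) ^ m / 2) :=
        mul_le_mul (pow_le_one₀ (norm_nonneg _) h1) (hp m).2 (hp m).1 zero_le_one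
    _ ≤ √(1 / 2) ^ m * (2 * (m + 2)) := by nlinarith

lemma summable_sqrt_half_pow : Summable fun m : ℕ => √(1 / 2) ^ m :=
  summable_geometric_of_lt_one (Real.sqrt_nonneg _) (by
    rw [Real.sqrt_lt' one_pos]; norm_num)

lemma hasSum_chaosLogMgf {p : ℕ → ℝ} (hp : IsChaosSequence p) {z : ℂ} (hz : ‖z‖ ≤ 1 / 2) :
    HasSum (fun m : ℕ => (2 * z) ^ (m + 2) * p (m + 2) / (2 * (m + 2 : ℂ))) (chaosLogMgf p z) :=
  (Summable.of_norm_bounded summable_sqrt_half_pow (norm_chaosLogMgf_term_le hp hz)).hasSum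

lemma norm_chaosLogMgf_le {p : ℕ → ℝ} (hp : IsChaosSequence p) {z : ℂ} (hz : ‖z‖ ≤ 1 / 2) :
    ‖chaosLogMgf p z‖ ≤ ∑' m : ℕ, √(1 / 2) ^ m :=
  tsum_of_norm_bounded summable_sqrt_half_pow.hasSum (norm_chaosLogMgf_term_le hp hz)

/-- Dominated convergence of the series, by the geometric bound on the coefficients. -/
lemma tendsto_chaosLogMgf {p : ℕ → ℕ → ℝ} {q : ℕ → ℝ} (hp : ∀ N, IsChaosSequence (p N))
    (h : ∀ m, Tendsto (fun N => p N (m + 2)) atTop (𝓝 (q (m + 2)))) {z : ℂ} (hz : ‖z‖ ≤ 1 / 2) :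
    Tendsto (fun N => chaosLogMgf (p N) z) atTop (𝓝 (chaosLogMgf q z)) := by
  refine tendsto_tsum_of_dominated_convergence summable_sqrt_half_pow (fun m => ?_)
    (Eventually.of_forall fun N m => norm_chaosLogMgf_term_le (hp N) hz m)
  exact (((Complex.continuous_ofReal.tendsto _).comp (h m)).const_mul _).div_const _

/-- A uniform exponential moment from the moment generating function at `± 1 / 2`. -/
lemma lintegral_cosh_le {ρ : Measure ℝ} [IsProbabilityMeasure ρ] {p : ℕ → ℝ}
    (hp : IsChaosSequence p)
    (h : ∀ z : ℂ, ‖z‖ ≤ 1 / 2 → ∫ x : ℝ, Complex.exp (z * x) ∂ρ = Complex.exp (chaosLogMgf p z)) :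
    ∫⁻ x, ENNReal.ofReal (Real.cosh (1 / 2 * x)) ∂ρ ≤
      ENNReal.ofReal (Real.exp (∑' m : ℕ, √(1 / 2) ^ m)) := by
  have key : ∀ b : ℝ, |b| ≤ 1 / 2 → Integrable (fun x : ℝ => Real.exp (b * x)) ρ ∧
      ∫ x, Real.exp (b * x) ∂ρ ≤ Real.exp (∑' m : ℕ, √(1 / 2) ^ m) := by
    intro b hb
    have hb' : ‖(b : ℂ)‖ ≤ 1 / 2 := by rwa [Complex.norm_real]
    have h1 := h b hb'
    have h2 : ∀ x : ℝ, Complex.exp (b * x) = ((Real.exp (b * x) : ℝ) : ℂ) := fun x => by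
      push_cast; rfl
    simp_rw [h2] at h1
    rw [integral_complex_ofReal] at h1
    constructor
    -- a function which is not integrable has integral zero, while an exponential does not vanish
    · by_contra hni
      rw [integral_undef hni] at h1
      exact Complex.exp_ne_zero _ h1.symm
    · calc ∫ x, Real.exp (b * x) ∂ρ ≤ ‖((∫ x, Real.exp (b * x) ∂ρ : ℝ) : ℂ)‖ := by
            rw [Complex.norm_real]; exact le_abs_self _
        _ ≤ Real.exp ‖chaosLogMgf p b‖ := by rw [h1]; exact Complex.norm_exp_le_exp_norm _
        _ ≤ _ := Real.exp_le_exp.2 (norm_chaosLogMgf_le hp hb')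
  obtain ⟨i1, b1⟩ := key (1 / 2) (by norm_num [abs_of_pos])
  obtain ⟨i2, b2⟩ := key (-(1 / 2)) (by norm_num [abs_of_pos])
  have hc : ∀ x : ℝ, Real.cosh (1 / 2 * x) =
      (Real.exp (1 / 2 * x) + Real.exp (-(1 / 2) * x)) / 2 := fun x => by
    rw [Real.cosh_eq, neg_mul]
  simp_rw [hc]
  rw [← ofReal_integral_eq_lintegral_ofReal (by exact (i1.add i2).div_const 2)
    (ae_of_all _ fun x => by positivity)]
  refine ENNReal.ofReal_le_ofReal ?_
  rw [integral_div, integral_add i1 i2]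
  linarith

/-- Tightness from a uniform exponential moment, by Markov's inequality. -/
lemma isTightMeasureSet_of_lintegral_cosh_le {S : Set (Measure ℝ)} {a : ℝ} (ha : 0 < a)
    {C : ENNReal} (hC : C ≠ ⊤)
    (h : ∀ ρ ∈ S, ∫⁻ x, ENNReal.ofReal (Real.cosh (a * x)) ∂ρ ≤ C) : IsTightMeasureSet S := by
  refine isTightMeasureSet_of_tendsto_measure_norm_gt ?_
  have hlim : Tendsto (fun r : ℝ => C / ENNReal.ofReal (Real.cosh (a * r))) atTop (𝓝 0) := by
    have h1 : Tendsto (fun r : ℝ => Real.cosh (a * r)) atTop atTop := by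
      have h2 : Tendsto (fun r : ℝ => Real.exp (a * r) / 2) atTop atTop :=
        (Real.tendsto_exp_atTop.comp (tendsto_id.const_mul_atTop ha)).atTop_div_const two_pos
      refine tendsto_atTop_mono (fun r => ?_) h2
      rw [Real.cosh_eq]
      linarith [Real.exp_pos (-(a * r))]
    exact ENNReal.Tendsto.const_div (ENNReal.tendsto_ofReal_nhds_top.2 h1) (Or.inr hC) |>.trans
      (by simp)
  refine tendsto_of_tendsto_of_tendsto_of_le_of_le' tendsto_const_nhds hlim
    (Eventually.of_forall fun r => zero_le) ?_
  filter_upwards [eventually_ge_atTop 0] with r hr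
  refine iSup₂_le fun ρ hρ => ?_
  have h0 : ENNReal.ofReal (Real.cosh (a * r)) ≠ 0 := by
    simpa using Real.cosh_pos (a * r)
  calc ρ {x | r < ‖x‖} ≤
        ρ {x | ENNReal.ofReal (Real.cosh (a * r)) ≤ ENNReal.ofReal (Real.cosh (a * x))} := by
        refine measure_mono fun x hx => ?_
        simp only [Set.mem_ofPred_eq, Real.norm_eq_abs] at hx ⊢
        refine ENNReal.ofReal_le_ofReal (Real.cosh_le_cosh.2 ?_)
        rw [abs_mul, abs_mul, abs_of_nonneg hr]
        gcongr
    _ ≤ (∫⁻ x, ENNReal.ofReal (Real.cosh (a * x)) ∂ρ) / ENNReal.ofReal (Real.cosh (a * r)) :=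
        meas_ge_le_lintegral_div (by fun_prop) h0 (by simp)
    _ ≤ _ := by gcongr; exact h ρ hρ

/-- Exponential moments pass to weak limits. -/
lemma lintegral_cosh_le_of_tendsto {ι : Type*} {U : Filter ι} [U.NeBot]
    {ρ : ι → ProbabilityMeasure ℝ} {μ : ProbabilityMeasure ℝ} (h : Tendsto ρ U (𝓝 μ)) {a : ℝ}
    {C : ENNReal}
    (hC : ∀ᶠ i in U, ∫⁻ x, ENNReal.ofReal (Real.cosh (a * x)) ∂(ρ i : Measure ℝ) ≤ C) :
    ∫⁻ x, ENNReal.ofReal (Real.cosh (a * x)) ∂(μ : Measure ℝ) ≤ C := by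
  -- the function is an increasing limit of bounded continuous functions
  have hbound : ∀ (n : ℕ) (x y : ℝ), dist (min (Real.cosh (a * x)).toNNReal (n : NNReal))
      (min (Real.cosh (a * y)).toNNReal (n : NNReal)) ≤ n := by
    intro n x y
    rw [NNReal.dist_eq, abs_le]
    have h1 : ((min (Real.cosh (a * x)).toNNReal (n : NNReal) : NNReal) : ℝ) ≤ n := by
      exact_mod_cast min_le_right _ _
    have h2 : ((min (Real.cosh (a * y)).toNNReal (n : NNReal) : NNReal) : ℝ) ≤ n := by
      exact_mod_cast min_le_right _ _
    have h3 := (min (Real.cosh (a * x)).toNNReal (n : NNReal)).coe_nonneg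
    have h4 := (min (Real.cosh (a * y)).toNNReal (n : NNReal)).coe_nonneg
    constructor <;> linarith
  set g : ℕ → BoundedContinuousFunction ℝ NNReal := fun n =>
    BoundedContinuousFunction.mkOfBound
      ⟨fun x => min (Real.cosh (a * x)).toNNReal (n : NNReal), by fun_prop⟩ n (hbound n) with hg
  have hle : ∀ n, ∫⁻ x, g n x ∂(μ : Measure ℝ) ≤ C := fun n => by
    have h1 := ProbabilityMeasure.tendsto_iff_forall_lintegral_tendsto.1 h (g n)
    refine le_of_tendsto h1 ?_
    filter_upwards [hC] with i hi
    refine (lintegral_mono fun x => ?_).trans hi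
    exact ENNReal.coe_le_coe.2 (min_le_left _ _)
  have hmono : ∀ x, Monotone fun n => (g n x : ENNReal) := fun x n m hnm => by
    refine ENNReal.coe_le_coe.2 (min_le_min le_rfl ?_)
    exact_mod_cast hnm
  have hsup : ∀ x, ENNReal.ofReal (Real.cosh (a * x)) = ⨆ n, (g n x : ENNReal) := fun x => by
    refine le_antisymm ?_ (iSup_le fun n => ENNReal.coe_le_coe.2 (min_le_left _ _))
    obtain ⟨n, hn⟩ := exists_nat_ge (Real.cosh (a * x)).toNNReal
    refine le_iSup_of_le n (ENNReal.coe_le_coe.2 (le_min le_rfl hn))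
  simp_rw [hsup]
  rw [lintegral_iSup (fun n => (g n).continuous.measurable.coe_nnreal_ennreal)
    fun n m hnm x => hmono x hnm]
  exact iSup_le hle

/-- Convergence in law from the convergence of the logarithms of the moment generating functions
near the origin. -/
lemma exists_limit_law {ρ : ℕ → ProbabilityMeasure ℝ} {p : ℕ → ℕ → ℝ} {q : ℕ → ℝ}
    (hp : ∀ N, IsChaosSequence (p N))
    (hmgf : ∀ N, ∀ z : ℂ, ‖z‖ ≤ 1 / 2 →
      ∫ x : ℝ, Complex.exp (z * x) ∂(ρ N : Measure ℝ) = Complex.exp (chaosLogMgf (p N) z))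
    (hpq : ∀ m, Tendsto (fun N => p N (m + 2)) atTop (𝓝 (q (m + 2)))) :
    ∃ μ : ProbabilityMeasure ℝ, Tendsto ρ atTop (𝓝 μ) ∧
      ∫⁻ x, ENNReal.ofReal (Real.cosh (1 / 2 * x)) ∂(μ : Measure ℝ) < ⊤ ∧
      ∀ s : ℝ, |s| ≤ 1 / 2 → charFun (μ : Measure ℝ) s =
        Complex.exp (chaosLogMgf q (s * Complex.I)) := by
  set C := ENNReal.ofReal (Real.exp (∑' m : ℕ, √(1 / 2) ^ m)) with hC
  have hcosh : ∀ N, ∫⁻ x, ENNReal.ofReal (Real.cosh (1 / 2 * x)) ∂(ρ N : Measure ℝ) ≤ C :=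
    fun N => lintegral_cosh_le (hp N) (hmgf N)
  have hcompact : IsCompact (closure (Set.range ρ)) := by
    refine isCompact_closure_of_isTightMeasureSet
      (isTightMeasureSet_of_lintegral_cosh_le (a := 1 / 2) (by norm_num) (C := C) (by simp [hC]) ?_)
    rintro _ ⟨_, ⟨N, rfl⟩, rfl⟩
    exact hcosh N
  have hlim : ∀ U : Ultrafilter ℕ, (U : Filter ℕ) ≤ atTop → ∃ μ : ProbabilityMeasure ℝ,
      Tendsto ρ U (𝓝 μ) ∧
      ∫⁻ x, ENNReal.ofReal (Real.cosh (1 / 2 * x)) ∂(μ : Measure ℝ) < ⊤ ∧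
      ∀ s : ℝ, |s| ≤ 1 / 2 → charFun (μ : Measure ℝ) s =
        Complex.exp (chaosLogMgf q (s * Complex.I)) := by
    intro U hU
    obtain ⟨μ, -, hμ⟩ := hcompact.ultrafilter_le_nhds (U.map ρ)
      (le_trans (by simp) (monotone_principal subset_closure))
    have hμ' : Tendsto ρ U (𝓝 μ) := hμ
    refine ⟨μ, hμ', lt_of_le_of_lt
      (lintegral_cosh_le_of_tendsto hμ' (Eventually.of_forall hcosh)) (by simp [hC]),
      fun s hs => ?_⟩
    have hz : ‖(s : ℂ) * Complex.I‖ ≤ 1 / 2 := by simpa using hs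
    have h1 : Tendsto (fun N => charFun (ρ N : Measure ℝ) s) U (𝓝 (charFun (μ : Measure ℝ) s)) := by
      simp_rw [charFun_eq_integral_innerProbChar]
      exact (ProbabilityMeasure.tendsto_iff_forall_integral_rclike_tendsto ℂ).1 hμ'
        (BoundedContinuousFunction.innerProbChar s)
    have h2 : Tendsto (fun N => charFun (ρ N : Measure ℝ) s) atTop
        (𝓝 (Complex.exp (chaosLogMgf q (s * Complex.I)))) := by
      have h3 : ∀ N, charFun (ρ N : Measure ℝ) s =
          Complex.exp (chaosLogMgf (p N) (s * Complex.I)) := fun N => by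
        rw [← hmgf N _ hz, charFun_apply_real]
        refine integral_congr_ae (ae_of_all _ fun x => ?_)
        simp only
        congr 1
        ring
      simp_rw [h3]
      exact (Complex.continuous_exp.tendsto _).comp (tendsto_chaosLogMgf hp hpq hz)
    exact tendsto_nhds_unique h1 (h2.mono_left hU)
  obtain ⟨μ, -, hμ1, hμ2⟩ := hlim (hyperfilter ℕ) Nat.hyperfilter_le_atTop
  refine ⟨μ, (tendsto_iff_ultrafilter _ _ _).2 fun U hU => ?_, hμ1, hμ2⟩
  obtain ⟨ν, hν, hν1, hν2⟩ := hlim U hU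
  have hμm := integrable_pow_of_cosh (by norm_num) hμ1
  have hνm := integrable_pow_of_cosh (by norm_num) hν1
  have hev : charFun (μ : Measure ℝ) =ᶠ[𝓝 0] charFun (ν : Measure ℝ) := by
    filter_upwards [Metric.closedBall_mem_nhds (0 : ℝ) (by norm_num : (0 : ℝ) < 1 / 2)] with s hs
    have hs' : |s| ≤ 1 / 2 := by simpa using hs
    rw [hμ2 s hs', hν2 s hs']
  have heq : (μ : Measure ℝ) = ν := eq_of_moments_eq (by norm_num) hμ1 hμm hνm fun m =>
    moments_eq_of_iteratedDeriv_charFun_eq hμm hνm m (hev.iteratedDeriv_eq m)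
  have : μ = ν := Subtype.ext heq
  rw [this]
  exact hν

/-- The cumulants of a law of the second chaos. -/
lemma cumulant_of_charFun_eq {μ : Measure ℝ} {q : ℕ → ℝ} (hq : IsChaosSequence q)
    (h : ∀ s : ℝ, |s| ≤ 1 / 2 → charFun μ s = Complex.exp (chaosLogMgf q (s * Complex.I))) :
    cumulant μ 1 = 0 ∧ ∀ m : ℕ, cumulant μ (m + 2) =
      ((2 ^ (m + 1) * ((m + 1).factorial : ℝ) * q (m + 2) : ℝ) : ℂ) := by
  set c : ℕ → ℂ := fun n => if n < 2 then 0 else (2 * Complex.I) ^ n * q n / (2 * n) with hc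
  have hev : ∀ᶠ s : ℝ in 𝓝 0, |s| ≤ 1 / 2 := by
    filter_upwards [Metric.closedBall_mem_nhds (0 : ℝ) (by norm_num : (0 : ℝ) < 1 / 2)] with s hs
    simpa using hs
  have key := cumulant_eq_of_hasSum (μ := μ) (c := c)
    (L := fun s : ℝ => chaosLogMgf q (s * Complex.I)) (by simp [hc]) ?_ (hev.mono h)
  · refine ⟨by rw [key]; simp [hc], fun m => ?_⟩
    rw [key]
    simp only [hc]
    rw [if_neg (by omega), Nat.factorial_succ (m + 1), mul_pow 2 Complex.I]
    have hI : (-Complex.I) ^ (m + 2) * Complex.I ^ (m + 2) = 1 := by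
      rw [← mul_pow]; simp
    have hm : ((m : ℂ) + 1 + 1) ≠ 0 := by exact_mod_cast (by omega : m + 1 + 1 ≠ 0)
    have hm' : ((m : ℂ) + 2) ≠ 0 := by exact_mod_cast (by omega : m + 2 ≠ 0)
    calc _ = ((-Complex.I) ^ (m + 2) * Complex.I ^ (m + 2)) *
          (((m + 1 + 1 : ℕ) * (m + 1).factorial : ℕ) * (2 ^ (m + 2) * q (m + 2) /
            (2 * (m + 2 : ℕ)))) := by ring
      _ = _ := by
        rw [hI]
        push_cast
        rw [show (m : ℂ) + 1 + 1 = m + 2 by ring]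
        field_simp
        ring
  · filter_upwards [hev] with s hs
    have hz : ‖(s : ℂ) * Complex.I‖ ≤ 1 / 2 := by simpa using hs
    rw [← hasSum_nat_add_iff' 2]
    simp only [Finset.sum_range_succ, Finset.sum_range_zero]
    have h0 : c 0 = 0 := by simp [hc]
    have h1 : c 1 = 0 := by simp [hc]
    rw [h0, h1, mul_zero, mul_zero, add_zero, add_zero, sub_zero]
    refine (hasSum_chaosLogMgf hq hz).congr_fun ?_
    intro m
    simp only [hc]
    rw [if_neg (by omega)]
    push_cast
    ring

/-- The fourth cumulant of a Gaussian law vanishes. -/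
lemma cumulant_gaussianReal_four (a : ℝ) (v : NNReal) : cumulant (gaussianReal a v) 4 = 0 := by
  set c : ℕ → ℂ := fun n => if n = 1 then a * Complex.I else if n = 2 then -v / 2 else 0 with hc
  rw [cumulant_eq_of_hasSum (c := c) (L := fun s : ℝ => s * a * Complex.I - v * s ^ 2 / 2)
    (by simp [hc]) (Eventually.of_forall fun s => ?_) (Eventually.of_forall fun s => ?_)]
  · simp [hc]
  · have hval : (s : ℂ) * a * Complex.I - v * s ^ 2 / 2 =
        ∑ m ∈ Finset.range 3, (s : ℂ) ^ m * c m := by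
      simp [hc, Finset.sum_range_succ]
      ring
    rw [hval]
    refine hasSum_sum_of_ne_finset_zero fun m hm => ?_
    simp only [Finset.mem_range, not_lt] at hm
    simp only [hc]
    rw [if_neg (by omega), if_neg (by omega), mul_zero]
  · rw [charFun_gaussianReal]

/-! ### The normalized quadratic variation -/

lemma incrVar_mesh_pos {H t h : ℝ} (hH : 3 / 4 < H) (ht : 1 < t) (h0 : 0 < h) (h1 : h ≤ 1) :
    0 < incrVar H t h := by
  have hk : k₂ H ≤ 0 := by
    rw [k₂, neg_nonpos]
    exact div_nonneg (by linarith) (by linarith)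
  have h2 : 0 < k₁ t + k₂ H * h := by nlinarith [k₁_add_k₂_pos hH ht]
  rw [incrVar, Real.rpow_add_one h0.ne', show k₁ t * h ^ (2 * H) + k₂ H * (h ^ (2 * H) * h) =
    h ^ (2 * H) * (k₁ t + k₂ H * h) by ring]
  positivity

lemma incrCov_zero {H : ℝ} (t : ℝ) (hH : 0 < H) (N : ℕ) :
    incrCov H t N 0 = incrVar H t (1 / N) := by
  have e1 : 2 * H ≠ 0 := by positivity
  have e2 : 2 * H + 1 ≠ 0 := by positivity
  have h0 : incrVar H t 0 = 0 := by simp [incrVar, Real.zero_rpow e1, Real.zero_rpow e2]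
  simp [incrCov, h0]

lemma trace_covMatrix {H : ℝ} (t : ℝ) (hH : 0 < H) (N : ℕ) :
    (covMatrix H t N).trace = N * incrVar H t (1 / N) := by
  simp [Matrix.trace, covMatrix, incrCov_zero t hH]

lemma trace_covMatrix_sq_pos {H t : ℝ} (hH : 3 / 4 < H) (ht : 1 < t) {N : ℕ} (hN : 1 ≤ N) :
    0 < (covMatrix H t N ^ 2).trace := by
  have h := sq_sum_le_trace_sq _ (isSymm_covMatrix H t N)
  rw [sum_covMatrix t (by linarith) hN] at h
  have h1 := pow_pos (k₁_add_k₂_pos hH ht) 2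
  have h2 : (0 : ℝ) < (N : ℝ) ^ 2 := by positivity
  exact (mul_pos_iff_of_pos_left h2).1 (h1.trans_le h)

lemma sum_Icc_eq_sum_fin {M : Type*} [AddCommMonoid M] (N : ℕ) (f : ℕ → M) :
    ∑ i ∈ Finset.Icc 1 N, f i = ∑ i : Fin N, f (i + 1) := by
  rw [Fin.sum_univ_eq_sum_range (fun i => f (i + 1)) N]
  refine Finset.sum_nbij' (fun i => i - 1) (fun i => i + 1) ?_ ?_ ?_ ?_ ?_ <;>
    simp only [Finset.mem_Icc, Finset.mem_range] <;> intro i hi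
  · omega
  · omega
  · omega
  · omega
  · rw [Nat.sub_add_cancel hi.1]

/-- Increments are indexed from `1` in the quadratic variation and from `0` in the matrix. -/
lemma increment_succ {Ω : Type*} (u : ℝ → ℝ → Ω → ℝ) (t : ℝ) (N i : ℕ) (ω : Ω) :
    increment u t N (i + 1) ω = u t (((i : ℝ) + 1) / N) ω - u t ((i : ℝ) / N) ω := by
  simp [increment]

section Solution

variable {Ω : Type*} [MeasurableSpace Ω] {P : Measure Ω} {H t T : ℝ}
  {W : NoiseIndex T → Ω → ℝ} {u : ℝ → ℝ → Ω → ℝ}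

/-- The covariance of the increments, from their variances by polarization. -/
lemma integral_increment_mul (hH : 3 / 4 < H) (hH1 : H < 1) (ht : 1 < t) (htT : t ≤ T)
    (hW : IsFractionalWhiteNoise H T P W) (hu : IsMildSolution H T P W u) {N : ℕ} (hN : 1 ≤ N)
    (i j : Fin N) :
    ∫ ω, increment u t N (i + 1) ω * increment u t N (j + 1) ω ∂P = covMatrix H t N i j := by
  have hN0 : (0 : ℝ) < N := by exact_mod_cast hN
  have hL2 : ∀ x, MemLp (u t x) 2 P := fun x => (hu t ⟨by linarith, htT⟩ x).1
  have hsq : ∀ x y : ℝ, Integrable (fun ω => (u t x ω - u t y ω) ^ 2) P := fun x y =>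
    ((hL2 x).sub (hL2 y)).integrable_sq
  have hi : ((i : ℕ) : ℝ) + 1 ≤ N := by exact_mod_cast i.2
  have hj : ((j : ℕ) : ℝ) + 1 ≤ N := by exact_mod_cast j.2
  have hi0 : (0 : ℝ) ≤ (i : ℕ) := Nat.cast_nonneg _
  have hj0 : (0 : ℝ) ≤ (j : ℕ) := Nat.cast_nonneg _
  have hvar : ∀ x y : ℝ, |x - y| ≤ N →
      ∫ ω, (u t (x / N) ω - u t (y / N) ω) ^ 2 ∂P = incrVar H t (|x - y| / N) := by
    intro x y hxy
    have e : |x / N - y / N| = |x - y| / N := by rw [← sub_div, abs_div, abs_of_pos hN0]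
    rw [hu.integral_sub_sq (by linarith) hH1 hW (by linarith) htT, e]
    rw [e]
    exact ((div_le_one hN0).2 hxy).trans ht.le
  have hpol : ∀ ω, increment u t N (i + 1) ω * increment u t N (j + 1) ω =
      ((u t (((i : ℝ) + 1) / N) ω - u t ((j : ℝ) / N) ω) ^ 2
        + (u t ((i : ℝ) / N) ω - u t (((j : ℝ) + 1) / N) ω) ^ 2
        - (u t (((i : ℝ) + 1) / N) ω - u t (((j : ℝ) + 1) / N) ω) ^ 2
        - (u t ((i : ℝ) / N) ω - u t ((j : ℝ) / N) ω) ^ 2) / 2 := fun ω => by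
    rw [increment_succ, increment_succ]
    ring
  simp_rw [hpol]
  rw [integral_div, integral_sub (by exact ((hsq _ _).add (hsq _ _)).sub (hsq _ _)) (hsq _ _),
    integral_sub (by exact (hsq _ _).add (hsq _ _)) (hsq _ _), integral_add (hsq _ _) (hsq _ _),
    hvar _ _ (by rw [abs_le]; constructor <;> linarith),
    hvar _ _ (by rw [abs_le]; constructor <;> linarith),
    hvar _ _ (by rw [abs_le]; constructor <;> linarith),
    hvar _ _ (by rw [abs_le]; constructor <;> linarith), covMatrix, Matrix.of_apply, incrCov,
    show (i : ℝ) + 1 - j = i - j + 1 by ring, show (i : ℝ) - (j + 1) = i - j - 1 by ring,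
    show (i : ℝ) + 1 - (j + 1) = i - j by ring]
  ring

lemma memLp_increment (ht : 1 < t) (htT : t ≤ T) (hu : IsMildSolution H T P W u) (N i : ℕ) :
    MemLp (increment u t N i) 2 P :=
  (hu t ⟨by linarith, htT⟩ _).1.sub (hu t ⟨by linarith, htT⟩ _).1

lemma toLp_increment_mem_firstChaos (ht : 1 < t) (htT : t ≤ T)
    (hW : IsFractionalWhiteNoise H T P W) (hu : IsMildSolution H T P W u) (N i : ℕ) :
    (memLp_increment ht htT hu N i).toLp _ ∈ firstChaos P W := by
  have h1 := (hu t ⟨by linarith, htT⟩ ((i : ℝ) / N)).mem_firstChaos hW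
  have h2 := (hu t ⟨by linarith, htT⟩ (((i : ℝ) - 1) / N)).mem_firstChaos hW
  have := (firstChaos P W).sub_mem h1 h2
  rwa [← MemLp.toLp_sub] at this

lemma integral_of_mem_firstChaos [IsProbabilityMeasure P]
    (hW : IsFractionalWhiteNoise H T P W) {Z : Lp ℝ 2 P}
    (hZ : Z ∈ firstChaos P W) : ∫ ω, Z ω ∂P = 0 := by
  have h := integral_map (μ := P) (φ := Z) (f := fun x : ℝ => x)
    (Lp.aestronglyMeasurable Z).aemeasurable (by fun_prop)
  rw [map_of_mem_firstChaos hW hZ] at h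
  rw [← h]
  simp

lemma aemeasurable_normQuadVar (ht : 1 < t) (htT : t ≤ T) (hu : IsMildSolution H T P W u)
    (N : ℕ) : AEMeasurable (normQuadVar P u t N) P := by
  have h : ∀ i, AEMeasurable (increment u t N i) P := fun i =>
    (memLp_increment ht htT hu N i).aestronglyMeasurable.aemeasurable
  unfold normQuadVar quadVar
  refine AEMeasurable.div_const (AEMeasurable.const_mul ?_ _) _
  exact Finset.aemeasurable_fun_sum _ fun i _ => (((h i).pow_const 2).div_const _).sub_const _

lemma integral_increment_sq (hH : 3 / 4 < H) (hH1 : H < 1) (ht : 1 < t) (htT : t ≤ T)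
    (hW : IsFractionalWhiteNoise H T P W) (hu : IsMildSolution H T P W u) {N i : ℕ}
    (hi : i ∈ Finset.Icc 1 N) :
    ∫ ω, increment u t N i ω ^ 2 ∂P = incrVar H t (1 / N) := by
  rw [Finset.mem_Icc] at hi
  have h := integral_increment_mul hH hH1 ht htT hW hu (hi.1.trans hi.2)
    (⟨i - 1, by omega⟩ : Fin N) ⟨i - 1, by omega⟩
  simp only [Nat.sub_add_cancel hi.1, covMatrix, Matrix.of_apply, sub_self,
    incrCov_zero t (by linarith : 0 < H)] at h
  simp_rw [pow_two]
  exact h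

/-- The second moment and the moment generating function of the quadratic variation. -/
lemma increments_quadratic_form_law [IsProbabilityMeasure P] (hH : 3 / 4 < H) (hH1 : H < 1)
    (ht : 1 < t) (htT : t ≤ T) (hW : IsFractionalWhiteNoise H T P W)
    (hu : IsMildSolution H T P W u) {N : ℕ} (hN : 1 ≤ N) :
    ∫ ω, (∑ i : Fin N, increment u t N (i + 1) ω ^ 2 - (covMatrix H t N).trace) ^ 2 ∂P =
      2 * (covMatrix H t N ^ 2).trace ∧
    ∀ c : ℝ, 0 ≤ c → c ^ 2 * (covMatrix H t N ^ 2).trace = 1 / 2 →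
      IsChaosSequence (fun m => c ^ m * (covMatrix H t N ^ m).trace) ∧
      ∀ z : ℂ, ‖z‖ ≤ 1 / 2 →
        ∫ ω, Complex.exp (z * (c * (∑ i : Fin N, increment u t N (i + 1) ω ^ 2 -
            (covMatrix H t N).trace) : ℝ)) ∂P =
          Complex.exp (chaosLogMgf (fun m => c ^ m * (covMatrix H t N ^ m).trace) z) := by
  have hmem := fun i : ℕ => toLp_increment_mem_firstChaos ht htT hW hu N i
  have hae := fun i : ℕ => (memLp_increment ht htT hu N i).coeFn_toLp
  obtain ⟨h1, h2⟩ := quadratic_form_law (P := P) (D := fun i : Fin N => increment u t N (i + 1))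
    (hasGaussianLaw_of_mem_firstChaos hW fun i => ⟨_, hmem (i + 1), hae (i + 1)⟩)
    (fun i => by rw [← integral_of_mem_firstChaos hW (hmem (i + 1))]
                 exact (integral_congr_ae (hae (i + 1))).symm)
    (R := covMatrix H t N)
    (fun i j => (integral_increment_mul hH hH1 ht htT hW hu hN i j).symm)
  refine ⟨h1, fun c hc hc2 => ?_⟩
  obtain ⟨h3, h4, h5⟩ := h2 c hc hc2
  exact ⟨fun m => ⟨h3 (m + 2), h4 m⟩, h5⟩

/-- The quadratic variation as a centered quadratic form of the increments. -/
lemma quadVar_eq (hH : 3 / 4 < H) (hH1 : H < 1) (ht : 1 < t) (htT : t ≤ T)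
    (hW : IsFractionalWhiteNoise H T P W) (hu : IsMildSolution H T P W u) {N : ℕ} (hN : 1 ≤ N)
    (ω : Ω) :
    quadVar P u t N ω = 1 / (N * incrVar H t (1 / N)) *
      (∑ i : Fin N, increment u t N (i + 1) ω ^ 2 - (covMatrix H t N).trace) := by
  have hN0 : (0 : ℝ) < N := by exact_mod_cast hN
  have hq := incrVar_mesh_pos (h := 1 / N) hH ht (by positivity)
    (by rw [div_le_one hN0]; exact_mod_cast hN)
  have h1 : ∀ i ∈ Finset.Icc 1 N, increment u t N i ω ^ 2 / (∫ ω', increment u t N i ω' ^ 2 ∂P) - 1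
      = (increment u t N i ω ^ 2 - incrVar H t (1 / N)) / incrVar H t (1 / N) := fun i hi => by
    rw [integral_increment_sq hH hH1 ht htT hW hu hi, sub_div, div_self hq.ne']
  rw [quadVar, Finset.sum_congr rfl h1, ← Finset.sum_div, Finset.sum_sub_distrib,
    sum_Icc_eq_sum_fin N fun i => increment u t N i ω ^ 2, trace_covMatrix t (by linarith)]
  simp only [Finset.sum_const, Nat.card_Icc, add_tsub_cancel_right, nsmul_eq_mul]
  field_simp

/-- The variance of the quadratic variation in terms of the covariance matrix. -/
lemma quadVarSq_eq [IsProbabilityMeasure P] (hH : 3 / 4 < H) (hH1 : H < 1) (ht : 1 < t)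
    (htT : t ≤ T) (hW : IsFractionalWhiteNoise H T P W) (hu : IsMildSolution H T P W u) {N : ℕ}
    (hN : 1 ≤ N) :
    quadVarSq P u t N = 2 * (covMatrix H t N ^ 2).trace / (N * incrVar H t (1 / N)) ^ 2 := by
  rw [quadVarSq]
  simp_rw [quadVar_eq hH hH1 ht htT hW hu hN, mul_pow]
  rw [integral_const_mul, (increments_quadratic_form_law hH hH1 ht htT hW hu hN).1]
  ring

/-- The factor which normalizes the centered sum of the squares of the increments. -/
def normFactor (H t : ℝ) (N : ℕ) : ℝ := 1 / √(2 * (covMatrix H t N ^ 2).trace)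

lemma normFactor_sq_mul_trace (hH : 3 / 4 < H) (ht : 1 < t) {N : ℕ} (hN : 1 ≤ N) :
    normFactor H t N ^ 2 * (covMatrix H t N ^ 2).trace = 1 / 2 := by
  have h := trace_covMatrix_sq_pos hH ht hN
  rw [normFactor, div_pow, Real.sq_sqrt (by positivity)]
  field_simp

/-- After normalization the variance of a single increment cancels. -/
lemma normQuadVar_eq [IsProbabilityMeasure P] (hH : 3 / 4 < H) (hH1 : H < 1) (ht : 1 < t)
    (htT : t ≤ T) (hW : IsFractionalWhiteNoise H T P W) (hu : IsMildSolution H T P W u) {N : ℕ}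
    (hN : 1 ≤ N) (ω : Ω) :
    normQuadVar P u t N ω = normFactor H t N *
      (∑ i : Fin N, increment u t N (i + 1) ω ^ 2 - (covMatrix H t N).trace) := by
  have hN0 : (0 : ℝ) < N := by exact_mod_cast hN
  have hq := incrVar_mesh_pos (h := 1 / N) hH ht (by positivity)
    (by rw [div_le_one hN0]; exact_mod_cast hN)
  have h := trace_covMatrix_sq_pos hH ht hN
  rw [normQuadVar, quadVarSq_eq hH hH1 ht htT hW hu hN, quadVar_eq hH hH1 ht htT hW hu hN,
    Real.sqrt_div (by positivity), Real.sqrt_sq (by positivity), normFactor]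
  field_simp

/-- The normalized square of an element of the first chaos, minus one, is in the second chaos. -/
lemma exists_mem_secondChaos [IsProbabilityMeasure P] (hW : IsFractionalWhiteNoise H T P W)
    {X : Ω → ℝ} (hX : MemLp X 2 P) (hXc : hX.toLp X ∈ firstChaos P W) {q : ℝ} (hq : 0 < q)
    (hXq : ∫ ω, X ω ^ 2 ∂P = q) :
    ∃ Y ∈ secondChaos P W, Y =ᵐ[P] fun ω => X ω ^ 2 / q - 1 := by
  set Z : Lp ℝ 2 P := (1 / √q) • hX.toLp X with hZ
  have hZc : Z ∈ firstChaos P W := (firstChaos P W).smul_mem _ hXc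
  have hZn : ‖Z‖ = 1 := by
    rw [hZ, norm_smul, ← Real.sqrt_sq (norm_nonneg (hX.toLp X)), norm_toLp_sq, hXq, norm_div,
      norm_one, Real.norm_of_nonneg (Real.sqrt_nonneg q), one_div,
      inv_mul_cancel₀ (Real.sqrt_pos.2 hq).ne']
  have hZm : MemLp (fun ω => Z ω ^ 2 - 1) 2 P := by
    have h1 := (integral_sq_sub_sq_gaussianReal zero_le_one).2.2
    have h2 := map_of_mem_firstChaos hW hZc
    rw [hZn, one_pow] at h2
    rw [← h2] at h1
    exact h1.comp_of_map (Lp.aestronglyMeasurable Z).aemeasurable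
  refine ⟨hZm.toLp _, Submodule.le_topologicalClosure _ (Submodule.subset_span
    ⟨Z, hZc, hZn, hZm.coeFn_toLp⟩), ?_⟩
  filter_upwards [hZm.coeFn_toLp, Lp.coeFn_smul (1 / √q) (hX.toLp X), hX.coeFn_toLp]
    with ω h1 h2 h3
  rw [h1, hZ, h2, Pi.smul_apply, h3, smul_eq_mul, mul_pow, div_pow, Real.sq_sqrt hq.le]
  ring

/-- The quadratic variation is a linear combination of terms `X² - 1` with `X` a normalized element
of the first chaos. -/
lemma normQuadVar_mem_secondChaos [IsProbabilityMeasure P] (hH : 3 / 4 < H) (hH1 : H < 1)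
    (ht : 1 < t) (htT : t ≤ T) (hW : IsFractionalWhiteNoise H T P W)
    (hu : IsMildSolution H T P W u) {N : ℕ} (hN : 1 ≤ N) :
    ∃ Y ∈ secondChaos P W, Y =ᵐ[P] normQuadVar P u t N := by
  have hN0 : (0 : ℝ) < N := by exact_mod_cast hN
  set q := incrVar H t (1 / N) with hqdef
  have hq : 0 < q := incrVar_mesh_pos hH ht (by positivity)
    (by rw [div_le_one hN0]; exact_mod_cast hN)
  have h : ∀ i : Fin N, ∃ Y ∈ secondChaos P W,
      Y =ᵐ[P] fun ω => increment u t N (i + 1) ω ^ 2 / q - 1 := fun i =>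
    exists_mem_secondChaos hW (memLp_increment ht htT hu N (i + 1))
      (toLp_increment_mem_firstChaos ht htT hW hu N (i + 1)) hq
      (integral_increment_sq hH hH1 ht htT hW hu (Finset.mem_Icc.2 ⟨by omega, by omega⟩))
  choose Y hY hYae using h
  refine ⟨(normFactor H t N * q) • ∑ i, Y i, (secondChaos P W).smul_mem _
    ((secondChaos P W).sum_mem fun i _ => hY i), ?_⟩
  filter_upwards [Lp.coeFn_smul (normFactor H t N * q) (∑ i, Y i),
    Lp.coeFn_finsetSum Finset.univ Y, ae_all_iff.2 hYae] with ω h1 h2 h3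
  rw [h1, Pi.smul_apply, h2, normQuadVar_eq hH hH1 ht htT hW hu hN, trace_covMatrix t (by linarith),
    smul_eq_mul, mul_assoc]
  simp only [Finset.sum_apply, h3]
  rw [Finset.sum_sub_distrib, ← Finset.sum_div]
  simp only [Finset.sum_const, Finset.card_univ, Fintype.card_fin, nsmul_eq_mul]
  rw [← hqdef]
  field_simp

/-- The asymptotics of the variance of the quadratic variation. -/
lemma tendsto_quadVarSq [IsProbabilityMeasure P] (hH : 3 / 4 < H) (hH1 : H < 1)
    (ht : 1 < t) (htT : t ≤ T) (hW : IsFractionalWhiteNoise H T P W)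
    (hu : IsMildSolution H T P W u) :
    Tendsto (fun N : ℕ => (N : ℝ) ^ (4 - 4 * H) * quadVarSq P u t N) atTop
      (𝓝 (4 * K₀ H t / k₁ t ^ 2)) := by
  have h1 := tendsto_trace_covMatrix t hH hH1 0
  simp only [zero_add] at h1
  rw [integral_cyclicProduct_two t hH] at h1
  have hk : k₁ t ≠ 0 := by rw [k₁]; positivity
  have h2 : Tendsto (fun N : ℕ => k₁ t + k₂ H * (1 / (N : ℝ))) atTop (𝓝 (k₁ t)) := by
    simpa using (tendsto_one_div_atTop_nhds_zero_nat.const_mul (k₂ H)).const_add (k₁ t)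
  have h3 := (h1.const_mul 2).div (h2.pow 2) (pow_ne_zero 2 hk)
  rw [show 2 * (2 * K₀ H t) = 4 * K₀ H t by ring] at h3
  refine h3.congr' ?_
  filter_upwards [eventually_ge_atTop 1] with N hN
  have hN0 : (0 : ℝ) < N := by exact_mod_cast hN
  have hx : (0 : ℝ) < (N : ℝ) ^ (2 * H) := by positivity
  have e1 : (N : ℝ) ^ (4 - 4 * H) = (N : ℝ) ^ 4 / ((N : ℝ) ^ (2 * H)) ^ 2 := by
    rw [Real.rpow_sub hN0, ← Real.rpow_two, ← Real.rpow_mul hN0.le,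
      show 2 * H * 2 = 4 * H by ring]
    norm_num
  have e2 : incrVar H t (1 / N) = (k₁ t + k₂ H * (1 / (N : ℝ))) / (N : ℝ) ^ (2 * H) := by
    rw [incrVar, Real.rpow_add_one (by positivity), Real.div_rpow zero_le_one hN0.le,
      Real.one_rpow]
    ring
  rw [quadVarSq_eq hH hH1 ht htT hW hu hN, e1, e2]
  simp only [Pi.div_apply]
  field_simp

/-- The coefficients of the limit law: the limits of the normalized traces of the powers of the
covariance matrices. -/
def limitCoeff (H t : ℝ) (m : ℕ) : ℝ :=
  (1 / √(4 * K₀ H t)) ^ m * ∫ x in unitCube m, cyclicProduct H t m x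

lemma tendsto_normFactor_pow_mul_trace (hH : 3 / 4 < H) (hH1 : H < 1) (ht : 1 < t) (m : ℕ) :
    Tendsto (fun N : ℕ => normFactor H t N ^ (m + 2) * (covMatrix H t N ^ (m + 2)).trace) atTop
      (𝓝 (limitCoeff H t (m + 2))) := by
  have h1 := tendsto_trace_covMatrix t hH hH1 0
  simp only [zero_add] at h1
  rw [integral_cyclicProduct_two t hH] at h1
  have hK := K₀_pos hH hH1 ht
  have h2 : Tendsto (fun N : ℕ => 1 / √(2 * ((N : ℝ) ^ 2 * (covMatrix H t N ^ 2).trace))) atTop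
      (𝓝 (1 / √(4 * K₀ H t))) := by
    have := (Real.continuous_sqrt.tendsto _).comp (h1.const_mul 2)
    rw [show 2 * (2 * K₀ H t) = 4 * K₀ H t by ring] at this
    exact tendsto_const_nhds.div this (Real.sqrt_pos.2 (by positivity)).ne'
  refine ((h2.pow (m + 2)).mul (tendsto_trace_covMatrix t hH hH1 m)).congr' ?_
  filter_upwards [eventually_ge_atTop 1] with N hN
  have hN0 : (0 : ℝ) < N := by exact_mod_cast hN
  have h := trace_covMatrix_sq_pos hH ht hN
  have e : 1 / √(2 * ((N : ℝ) ^ 2 * (covMatrix H t N ^ 2).trace)) * N = normFactor H t N := by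
    rw [show 2 * ((N : ℝ) ^ 2 * (covMatrix H t N ^ 2).trace) =
      (N : ℝ) ^ 2 * (2 * (covMatrix H t N ^ 2).trace) by ring, Real.sqrt_mul (by positivity),
      Real.sqrt_sq hN0.le, normFactor]
    field_simp
  rw [← e, mul_pow _ (N : ℝ)]
  ring

/-- The cumulants in terms of the coefficients of the limit law. -/
lemma limitCumulant_eq (hH : 3 / 4 < H) (hH1 : H < 1) (ht : 1 < t) (m : ℕ) :
    limitCumulant H t (m + 2) = 2 ^ (m + 1) * ((m + 1).factorial : ℝ) * limitCoeff H t (m + 2) := by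
  have hK := K₀_pos hH hH1 ht
  rw [limitCumulant, if_neg (by omega), limitCoeff]
  split_ifs with h
  · obtain rfl : m = 0 := by omega
    simp only [zero_add]
    rw [integral_cyclicProduct_two t hH, div_pow, Real.sq_sqrt (by positivity)]
    simp
    field_simp
    norm_num
  · have e : (4 * K₀ H t) ^ (-((m + 2 : ℕ) : ℝ) / 2) = (1 / √(4 * K₀ H t)) ^ (m + 2) := by
      rw [Real.sqrt_eq_rpow, one_div, ← Real.rpow_neg (by positivity), ← Real.rpow_natCast,
        ← Real.rpow_mul (by positivity)]
      congr 1
      ring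
    rw [e, show m + 2 - 1 = m + 1 by omega]
    ring

lemma limitCumulant_four_pos (hH : 3 / 4 < H) (hH1 : H < 1) (ht : 1 < t) :
    0 < limitCumulant H t 4 := by
  have hK := K₀_pos hH hH1 ht
  have h := integral_cyclicProduct_four_pos hH hH1 ht
  rw [limitCumulant_eq hH hH1 ht 2, limitCoeff]
  positivity

/-- The convergence in law of the normalized quadratic variation. -/
lemma exists_limit_law_normQuadVar [IsProbabilityMeasure P] (hH : 3 / 4 < H) (hH1 : H < 1)
    (ht : 1 < t) (htT : t ≤ T) (hW : IsFractionalWhiteNoise H T P W)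
    (hu : IsMildSolution H T P W u) :
    ∃ (μ : Measure ℝ) (_ : IsProbabilityMeasure μ),
      TendstoInDistribution (normQuadVar P u t) atTop (id : ℝ → ℝ) (fun _ => P) μ ∧
      ∫⁻ x, ENNReal.ofReal (Real.cosh (1 / 2 * x)) ∂μ < ⊤ ∧
      ∀ m : ℕ, 1 ≤ m → cumulant μ m = (limitCumulant H t m : ℂ) := by
  have hm := aemeasurable_normQuadVar ht htT hu
  have hN : ∀ N : ℕ, 1 ≤ N + 1 := fun N => by omega
  have hc : ∀ N : ℕ, 0 ≤ normFactor H t N := fun N => by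
    rw [normFactor]; positivity
  have hlaw := fun N : ℕ => (increments_quadratic_form_law hH hH1 ht htT hW hu (hN N)).2 _
    (hc _) (normFactor_sq_mul_trace hH ht (hN N))
  set ρ : ℕ → ProbabilityMeasure ℝ := fun N =>
    ⟨P.map (normQuadVar P u t N), Measure.isProbabilityMeasure_map (hm N)⟩ with hρ
  have hlim : ∀ m, Tendsto (fun N : ℕ => normFactor H t (N + 1) ^ (m + 2) *
      (covMatrix H t (N + 1) ^ (m + 2)).trace) atTop (𝓝 (limitCoeff H t (m + 2))) := fun m =>
    (tendsto_add_atTop_iff_nat 1).2 (tendsto_normFactor_pow_mul_trace hH hH1 ht m)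
  have hq : IsChaosSequence (limitCoeff H t) := fun m =>
    ⟨ge_of_tendsto' (hlim m) fun N => ((hlaw N).1 m).1,
      le_of_tendsto' (hlim m) fun N => ((hlaw N).1 m).2⟩
  obtain ⟨μ, hμ1, hμ2, hμ3⟩ := exists_limit_law (ρ := fun N => ρ (N + 1))
    (p := fun N m => normFactor H t (N + 1) ^ m * (covMatrix H t (N + 1) ^ m).trace)
    (fun N => (hlaw N).1) (fun N z hz => by
      rw [← (hlaw N).2 z hz]
      simp only [hρ, ProbabilityMeasure.coe_mk]
      rw [integral_map (hm _) (by fun_prop)]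
      simp_rw [normQuadVar_eq hH hH1 ht htT hW hu (hN N)]) hlim
  refine ⟨μ, inferInstance, ⟨hm, aemeasurable_id, ?_⟩, hμ2, fun m hm1 => ?_⟩
  · have h1 : Tendsto ρ atTop (𝓝 μ) := (tendsto_add_atTop_iff_nat 1).1 hμ1
    have hid : (⟨(μ : Measure ℝ).map id, Measure.isProbabilityMeasure_map aemeasurable_id⟩ :
        ProbabilityMeasure ℝ) = μ := Subtype.ext Measure.map_id
    rw [hid]
    exact h1
  · obtain ⟨c1, c2⟩ := cumulant_of_charFun_eq hq hμ3
    rcases m with _ | _ | m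
    · omega
    · rw [zero_add, c1, limitCumulant, if_pos rfl, Complex.ofReal_zero]
    · rw [c2, limitCumulant_eq hH hH1 ht]

end Solution

end FracWave

end

theorem mainTheorem4 {Ω : Type*} [MeasurableSpace Ω] (P : Measure Ω) [IsProbabilityMeasure P]
    (H t T : ℝ) (hH : 3 / 4 < H) (hH1 : H < 1) (ht : 1 < t) (htT : t ≤ T)
    (W : FracWave.NoiseIndex T → Ω → ℝ) (hW : FracWave.IsFractionalWhiteNoise H T P W)
    (u : ℝ → ℝ → Ω → ℝ) (hu : FracWave.IsMildSolution H T P W u) :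
    -- `F_N` is well defined and belongs to the second chaos
    (∀ N : ℕ, 1 ≤ N →
      (∀ i ∈ Finset.Icc 1 N, 0 < ∫ ω, (FracWave.increment u t N i ω) ^ 2 ∂P) ∧
      0 < FracWave.quadVarSq P u t N ∧
      ∃ Y ∈ FracWave.secondChaos P W, Y =ᵐ[P] FracWave.normQuadVar P u t N) ∧
    -- the asymptotics of `v_N`, with the explicit value of `K₀`
    Tendsto (fun N : ℕ => (N : ℝ) ^ (4 - 4 * H) * FracWave.quadVarSq P u t N) atTop
      (𝓝 (4 * FracWave.K₀ H t / FracWave.k₁ t ^ 2)) ∧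
    FracWave.K₀ H t =
      FracWave.k₁ t ^ 2 * (H ^ 2 * (2 * H - 1) / (2 * (4 * H - 3)))
        + 2 * FracWave.k₁ t * FracWave.k₂ H * (H ^ 2 * (2 * H + 1) / (2 * (4 * H - 1)))
        + FracWave.k₂ H ^ 2 * (H * (2 * H + 1) ^ 2 / (4 * (4 * H - 1))) ∧
    0 < FracWave.K₀ H t ∧
    -- the cyclic integrals converge absolutely
    (∀ m : ℕ, 3 ≤ m →
      IntegrableOn (FracWave.cyclicProduct H t m) (FracWave.unitCube m)) ∧
    -- convergence in law to a non-Gaussian law, determined by its cumulants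
    ∃ (μ : Measure ℝ) (_ : IsProbabilityMeasure μ),
      TendstoInDistribution (FracWave.normQuadVar P u t) atTop (id : ℝ → ℝ) (fun _ => P) μ ∧
      (∀ m : ℕ, Integrable (fun x : ℝ => x ^ m) μ) ∧
      (∀ m : ℕ, 1 ≤ m → FracWave.cumulant μ m = (FracWave.limitCumulant H t m : ℂ)) ∧
      (∀ (a : ℝ) (v : NNReal), μ ≠ gaussianReal a v) ∧
      (∀ ν : Measure ℝ, IsProbabilityMeasure ν →
        (∀ m : ℕ, Integrable (fun x : ℝ => x ^ m) ν) →
        (∀ m : ℕ, 1 ≤ m → FracWave.cumulant ν m = (FracWave.limitCumulant H t m : ℂ)) →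
        ν = μ) := by
  obtain ⟨μ, hμ, hlim, hexp, hcum⟩ :=
    FracWave.exists_limit_law_normQuadVar hH hH1 ht htT hW hu
  have hmom := FracWave.integrable_pow_of_cosh (by norm_num) hexp
  refine ⟨fun N hN => ⟨fun i hi => ?_, ?_,
    FracWave.normQuadVar_mem_secondChaos hH hH1 ht htT hW hu hN⟩,
    FracWave.tendsto_quadVarSq hH hH1 ht htT hW hu, FracWave.K₀_eq t hH,
    FracWave.K₀_pos hH hH1 ht, fun m hm => ?_, μ, hμ, hlim, hmom, hcum, fun a v h => ?_,
    fun ν hν hνm hνc => ?_⟩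
  · have hN0 : (0 : ℝ) < N := by exact_mod_cast hN
    rw [FracWave.integral_increment_sq hH hH1 ht htT hW hu hi]
    exact FracWave.incrVar_mesh_pos hH ht (by positivity)
      (by rw [div_le_one hN0]; exact_mod_cast hN)
  · have hN0 : (0 : ℝ) < N := by exact_mod_cast hN
    have h1 := FracWave.incrVar_mesh_pos (h := 1 / N) hH ht (by positivity)
      (by rw [div_le_one hN0]; exact_mod_cast hN)
    have h2 := FracWave.trace_covMatrix_sq_pos hH ht hN
    rw [FracWave.quadVarSq_eq hH hH1 ht htT hW hu hN]
    positivity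
  · obtain ⟨n, rfl⟩ := Nat.exists_eq_add_of_le' (by omega : 2 ≤ m)
    exact FracWave.integrableOn_cyclicProduct t hH n
  -- the fourth cumulant tells the limit from a Gaussian law
  · have h4 := hcum 4 (by norm_num)
    rw [h, FracWave.cumulant_gaussianReal_four] at h4
    have h5 := FracWave.limitCumulant_four_pos hH hH1 ht
    rw [← Complex.ofReal_zero, Complex.ofReal_inj] at h4
    exact h5.ne h4
  · refine (FracWave.eq_of_moments_eq (by norm_num) hexp hmom hνm fun m => ?_).symm
    exact FracWave.moments_eq_of_iteratedDeriv_charFun_eq hmom hνm m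
      (FracWave.iteratedDeriv_charFun_eq_of_cumulant_eq hmom hνm
        (fun m hm => (hcum m hm).trans (hνc m hm).symm) m)
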